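/- Let $X$ be a complex manifold (Hausdorff, countable at infinity) and let $W(X)$ be the set of its irreducible hypersurfaces (closed irreducible analytic subsets of codimension one). An orbifold divisor on $X$ is a formal sum $\Delta=\sum_{D\in W(X)}(1-\frac1{m(D)})D$ given by a function $m=m_\Delta:W(X)\to\mathbb{Q}\cup\{+\infty\}$ with $m\ge 1$, such that every compact subset of $X$ meets only finitely many $D$ with $m(D)>1$. Its support $\lceil\Delta\rceil$ is the union of the $D$ with $m(D)>1$. The pair $(X|\Delta)$ is a smooth geometric orbifold if $\lceil\Delta\rceil$ has normal crossings, i.e. if near every point there are holomorphic coordinates $x=(x_1,\dots,x_p)$ adapted to $\Delta$: every $D$ with $m(D)>1$ is locally a union of coordinate hyperplanes. In such coordinates let $m_j$ be $m(D)$ if $\{x_j=0\}$ is a branch of a $D$ with $m(D)>1$, and $m_j=1$ otherwise. For integers $N,q\ge 0$, $S^N\Omega^q(X|\Delta)$ is the locally free subsheaf of $\mathrm{Sym}^N(\Omega^q_X(\log\lceil\Delta\rceil))$ generated over $\mathcal{O}_X$, in adapted coordinates, by $$\prod_{j=1}^p x_j^{\lceil k_j/m_j\rceil-k_j}\;dx_{J_1}\cdots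 dx_{J_N},$$ where $J_1,\dots,J_N$ are subsets with $q$ elements of $\{1,\dots,p\}$, $dx_J=\bigwedge_{j\in J}dx_j$, $k_j$ is the number of indices $l$ with $j\in J_l$, and $k/(+\infty)=0$. Let $(Y|\Delta_Y)$ and $(X|\Delta_X)$ be smooth geometric orbifolds and $f:Y\to X$ a holomorphic map. One says that $f$ is an orbifold morphism $(Y|\Delta_Y)\to(X|\Delta_X)$ if $f$ maps no connected component of $Y$ into $\lceil\Delta_X\rceil$, and if $t\cdot m_{\Delta_Y}(E)\ge m_{\Delta_X}(D)$ for all $D\in W(X)$, $E\in W(Y)$ and all integers $t>0$ such that $f^*(D)=tE+R$ with $R$ effective and not containing $E$. 1. Suppose that the irreducible components of $\lceil\Delta_X\rceil$ are smooth. If $f$ is an orbifold morphism, then $f^*\big(S^N\Omega^q(X|\Delta_X)\big)\subset S^N\Omega^q(Y|\Delta_Y)$ for all $N,q\ge 0$. 2. Conversely, suppose that $f$ maps no connected component of $Y$ into $\lceil\Delta_X\rceil$ (so that the pullback $f^*$ is defined), and that the numerators of the finite multiplicities $m_{\Delta_X}(D)$, written in lowest terms, have a least common multiple $N>0$ (which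 is automatic if $X$ is compact). If $f^*\big(S^N\Omega^1(X|\Delta_X)\big)\subset S^N\Omega^1(Y|\Delta_Y)$, then $f$ is an orbifold morphism. -/

import Mathlib

open scoped Manifold ContDiff Topology NNRat

noncomputable section

namespace GeomOrbifold

/-- The model space `ℂⁿ`; a complex manifold of dimension `n` is a space charted on it with
analytic (that is, holomorphic) transition maps. -/
abbrev Model (n : ℕ) : Type := Fin n → ℂ

section Divisors

variable (n : ℕ) (X : Type*) [TopologicalSpace X] [ChartedSpace (Model n) X]

/-- Local holomorphic coordinate systems. -/
abbrev holCharts : Set (OpenPartialHomeomorph X (Model n)) :=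
  IsManifold.maximalAtlas 𝓘(ℂ, Model n) ω X

variable {X}

/-- `h` is holomorphic on a neighbourhood of `a`. -/
def HolAt (h : X → ℂ) (a : X) : Prop :=
  ContMDiffAt 𝓘(ℂ, Model n) 𝓘(ℂ, ℂ) ω h a

/-- A closed analytic subset, empty or of pure codimension one: near every point `a` of `X`
(also off `D`, which makes `D` closed) it is the zero set of one holomorphic function that does
not vanish identically near `a`. -/
def IsHypersurface (D : Set X) : Prop :=
  ∀ a : X, ∃ h : X → ℂ, HolAt n h a ∧ (¬ ∀ᶠ z in 𝓝 a, h z = 0) ∧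
    ∀ᶠ z in 𝓝 a, (z ∈ D ↔ h z = 0)

/-- Near `a ∈ D` the set `D` is the coordinate hyperplane `φ_i = 0` of the chart `φ`. -/
def IsStraightenedBy (D : Set X) (a : X) (φ : OpenPartialHomeomorph X (Model n))
    (i : Fin n) : Prop :=
  φ ∈ holCharts n X ∧ a ∈ φ.source ∧ a ∈ D ∧ ∀ z ∈ φ.source, (z ∈ D ↔ φ z i = 0)

/-- The regular points of a hypersurface. -/
def regularLocus (D : Set X) : Set X :=
  {a | ∃ φ i, IsStraightenedBy n D a φ i}

variable (X)

/-- The set `W(X)` of irreducible Weil divisors: hypersurfaces which are irreducible, i.e.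
whose regular locus is connected (and nonempty). -/
structure PrimeDivisor where
  carrier : Set X
  isHypersurface : IsHypersurface n carrier
  irreducible : IsConnected (regularLocus n carrier)

/-- An orbifold divisor `Δ = ∑ (1 - 1/m(D)) D`, given by its multiplicity function
`m : W(X) → ℚ ∪ {+∞}`, with values `≥ 1` and equal to `1` locally for almost all `D`. -/
structure OrbifoldDivisor where
  mult : PrimeDivisor n X → WithTop ℚ≥0
  one_le_mult : ∀ D, 1 ≤ mult D
  locallyFinite : ∀ K : Set X, IsCompact K →
    {D | mult D ≠ 1 ∧ (D.carrier ∩ K).Nonempty}.Finite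

variable {n X}

/-- The support of `Δ`: the union of the `D` with `m(D) > 1`. -/
def OrbifoldDivisor.support (Δ : OrbifoldDivisor n X) : Set X :=
  ⋃ D ∈ {D | 1 < Δ.mult D}, D.carrier

/-- Local coordinates adapted to `Δ`. The coordinate hyperplane `x_j = 0` is either labelled
by a prime divisor, of which it is then a local branch, or has no label. Each component `D`
of the support of `Δ` is, on the domain of the chart, the union of the coordinate
hyperplanes labelled by it. -/
structure AdaptedChart (Δ : OrbifoldDivisor n X) where
  chart : OpenPartialHomeomorph X (Model n)
  chart_mem : chart ∈ holCharts n X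
  label : Fin n → Option (PrimeDivisor n X)
  mem_iff : ∀ D, 1 < Δ.mult D → ∀ z ∈ chart.source,
    (z ∈ D.carrier ↔ ∃ j, label j = some D ∧ chart z j = 0)

/-- The multiplicity `m_j` of the coordinate hyperplane `x_j = 0`. -/
def AdaptedChart.m {Δ : OrbifoldDivisor n X} (φ : AdaptedChart Δ) (j : Fin n) :
    WithTop ℚ≥0 :=
  match φ.label j with
  | none => 1
  | some D => Δ.mult D

/-- On the manifold `X`, the pair `(X|Δ)` is smooth: the support of `Δ` is a divisor with
normal crossings, i.e. adapted coordinates exist near every point. -/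
def OrbifoldDivisor.IsSmooth (Δ : OrbifoldDivisor n X) : Prop :=
  ∀ a : X, ∃ φ : AdaptedChart Δ, a ∈ φ.chart.source

/-- The components of the support of `Δ` are smooth hypersurfaces (so that normal crossings
are simple normal crossings). -/
def OrbifoldDivisor.HasSmoothComponents (Δ : OrbifoldDivisor n X) : Prop :=
  ∀ D, 1 < Δ.mult D → D.carrier ⊆ regularLocus n D.carrier

/-- The numerator of a multiplicity. Infinite multiplicities do not contribute to the least
common multiple of the numerators, hence the value `1`. -/
def num : WithTop ℚ≥0 → ℕ
  | ⊤ => 1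
  | (r : ℚ≥0) => r.num

/-- `N` is the least common multiple of the numerators of the multiplicities of `Δ`. -/
def OrbifoldDivisor.IsLcmOfNumerators (Δ : OrbifoldDivisor n X) (N : ℕ) : Prop :=
  0 < N ∧ (∀ D, num (Δ.mult D) ∣ N) ∧ ∀ M : ℕ, (∀ D, num (Δ.mult D) ∣ M) → N ∣ M

variable (n)

/-- `h` is a reduced local equation of `D` at `a`: it generates the ideal of germs of
holomorphic functions at `a` that vanish on `D`. -/
def IsLocalEquation (D : Set X) (a : X) (h : X → ℂ) : Prop :=
  HolAt n h a ∧ (∀ᶠ z in 𝓝 a, z ∈ D → h z = 0) ∧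
    ∀ g : X → ℂ, HolAt n g a → (∀ᶠ z in 𝓝 a, z ∈ D → g z = 0) →
      ∃ u : X → ℂ, HolAt n u a ∧ ∀ᶠ z in 𝓝 a, g z = u z * h z

end Divisors

section Morphisms

variable {n p : ℕ} {Y X : Type*} [TopologicalSpace Y] [ChartedSpace (Model n) Y]
  [TopologicalSpace X] [ChartedSpace (Model p) X]

/-- `f^*(D) = t • E + R` with `R` effective and not containing `E`. The coefficient `t` is
read off at a regular point `b` of `E` (it is the same at all of them): if `E` is given by
`y_i = 0` near `b` and `D` by the reduced equation `h = 0` near `f b`, then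
`h ∘ f = y_i ^ t * g` near `b`, where `g` does not vanish identically on `E` near `b`. -/
def HasPullbackCoeff (f : Y → X) (D : PrimeDivisor p X) (E : PrimeDivisor n Y) (t : ℕ) :
    Prop :=
  ∃ (b : Y) (φ : OpenPartialHomeomorph Y (Model n)) (i : Fin n) (h : X → ℂ) (g : Y → ℂ),
    IsStraightenedBy n E.carrier b φ i ∧ IsLocalEquation p D.carrier (f b) h ∧ HolAt n g b ∧
      (∀ᶠ z in 𝓝 b, h (f z) = φ z i ^ t * g z) ∧ ∃ᶠ z in 𝓝 b, z ∈ E.carrier ∧ g z ≠ 0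

/-- No connected component of `Y` is mapped into the support of `Δ`; for connected nonempty
`Y` this says that `f(Y)` is not contained in the support. -/
def NotIntoSupport (f : Y → X) (Δ : OrbifoldDivisor p X) : Prop :=
  ∀ y : Y, ¬ f '' connectedComponent y ⊆ Δ.support

/-- The holomorphic map `f` is an orbifold morphism `(Y|Δ_Y) → (X|Δ_X)` (`X` being a manifold,
all its Weil divisors are Cartier, so nothing is required about `ℚ`-factoriality). -/
structure IsOrbifoldMorphism (f : Y → X) (ΔY : OrbifoldDivisor n Y)
    (ΔX : OrbifoldDivisor p X) : Prop where
  notIntoSupport : NotIntoSupport f ΔX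
  mult_le : ∀ (D : PrimeDivisor p X) (E : PrimeDivisor n Y) (t : ℕ), 0 < t →
    HasPullbackCoeff f D E t → ΔX.mult D ≤ (t : WithTop ℚ≥0) * ΔY.mult E

end Morphisms

section Forms

variable {n : ℕ} {X : Type*} [TopologicalSpace X] [ChartedSpace (Model n) X]

variable (n) in
/-- The fibre `⋀^q T_x^* X`. -/
abbrev FormFibre (q : ℕ) (x : X) : Type :=
  TangentSpace 𝓘(ℂ, Model n) x [⋀^Fin q]→ₗ[ℂ] ℂ

variable (n) in
/-- The symmetric algebra of `⋀^q T_x^* X`; its part of degree `N` is the fibre at `x` of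
`Sym^N (Ω^q_X)`. -/
abbrev SymFibre (q : ℕ) (x : X) : Type :=
  SymmetricAlgebra ℂ (FormFibre n q x)

/-- The differentials at `x` of the coordinates with indices `j 0, …, j (q - 1)`. -/
def coordDifferentials {q : ℕ} (φ : OpenPartialHomeomorph X (Model n)) (j : Fin q → Fin n)
    (x : X) : TangentSpace 𝓘(ℂ, Model n) x →ₗ[ℂ] (Fin q → ℂ) :=
  LinearMap.pi fun i =>
    (mfderiv 𝓘(ℂ, Model n) 𝓘(ℂ, ℂ) (fun z => φ z (j i)) x).toLinearMap

/-- Subsets of `{1, …, n}` with `q` elements. -/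
abbrev Idx (n q : ℕ) : Type := {J : Finset (Fin n) // J.card = q}

/-- `dx_J = dx_{j_1} ∧ … ∧ dx_{j_q}` at `x`, for `J = {j_1 < … < j_q}`; it sends
`(v_1, …, v_q)` to `det (dx_{j_i} (v_l))`. -/
def dForm {q : ℕ} (φ : OpenPartialHomeomorph X (Model n)) (J : Idx n q) (x : X) :
    FormFibre n q x :=
  Matrix.detRowAlternating.compLinearMap
    (coordDifferentials φ (J.1.orderEmbOfFin J.2) x)

/-- The number `k_j` of occurrences of `j` in `J_1, …, J_N`. -/
def occ {q N : ℕ} (s : Sym (Idx n q) N) (j : Fin n) : ℕ :=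
  ((s : Multiset (Idx n q)).filter fun J => j ∈ J.1).card

/-- The integer `⌈k / m⌉`, equal to `0` for `m = +∞`. -/
def ceilDiv (k : ℕ) : WithTop ℚ≥0 → ℕ
  | ⊤ => 0
  | (r : ℚ≥0) => ⌈(k : ℚ≥0) / r⌉₊

/-- The generator `x^⌈k/m⌉ ⨂_l dx_{J_l}/x_{J_l} = ∏_j x_j^(⌈k_j/m_j⌉ - k_j) ⨂_l dx_{J_l}`
of `S^N Ω^q(X|Δ)`, at a point `x` off the support of `Δ`. The unordered `N`-tuple
`(J_1, …, J_N)` is an element of `Sym`. -/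
def generator {Δ : OrbifoldDivisor n X} (φ : AdaptedChart Δ) {q N : ℕ} (s : Sym (Idx n q) N)
    (x : X) : SymFibre n q x :=
  (∏ j, φ.chart x j ^ ((ceilDiv (occ s j) (φ.m j) : ℤ) - (occ s j : ℤ))) •
    ((s : Multiset (Idx n q)).map fun J =>
      SymmetricAlgebra.ι ℂ (FormFibre n q x) (dForm φ.chart J x)).prod

/-- `σ`, whose values matter only off `Z`, is a section over the open set `V` of the
locally free sheaf `S^N Ω^q(X|Δ)`: near every point of `V` it is a combination, with
holomorphic coefficients, of the generators in adapted coordinates. Here `Z` is a closed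
nowhere dense set that contains the support of `Δ` (usually the support itself); as the
coefficients are determined off `Z`, so is the section. -/
def IsOrbSection (Δ : OrbifoldDivisor n X) (N q : ℕ) (Z V : Set X)
    (σ : (x : X) → SymFibre n q x) : Prop :=
  ∀ a ∈ V, ∃ φ : AdaptedChart Δ, a ∈ φ.chart.source ∧
    ∃ A : Sym (Idx n q) N → X → ℂ, (∀ s, HolAt n (A s) a) ∧
      ∀ᶠ z in 𝓝 a, z ∉ Z → σ z = ∑ s, A s z • generator φ s z

end Forms

section Pullback

variable {n p : ℕ} {Y X : Type*} [TopologicalSpace Y] [ChartedSpace (Model n) Y]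
  [TopologicalSpace X] [ChartedSpace (Model p) X]

/-- The pullback of `q`-covectors at `f y` to `q`-covectors at `y`. -/
def pullbackForm (f : Y → X) (q : ℕ) (y : Y) :
    FormFibre p q (f y) →ₗ[ℂ] FormFibre n q y where
  toFun α := α.compLinearMap
    (mfderiv 𝓘(ℂ, Model n) 𝓘(ℂ, Model p) f y).toLinearMap
  map_add' _ _ := rfl
  map_smul' _ _ := rfl

/-- The pullback `f^*σ`. -/
def pullbackSym (f : Y → X) (q : ℕ) (σ : (x : X) → SymFibre p q x) (y : Y) :
    SymFibre n q y :=
  SymmetricAlgebra.lift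
    (SymmetricAlgebra.ι ℂ (FormFibre n q y) ∘ₗ pullbackForm f q y) (σ (f y))

/-- `f^*(S^N Ω^q(X|Δ_X)) ⊆ S^N Ω^q(Y|Δ_Y)`: for every section `σ` over an open set `V`, the
pullback `f^*σ`, which is given off the preimage of the support of `Δ_X`, is a section of
`S^N Ω^q(Y|Δ_Y)` over `f⁻¹(V)`. This is meaningful if no component of `Y` is mapped into the
support of `Δ_X`. -/
def PullbackIncluded (f : Y → X) (ΔY : OrbifoldDivisor n Y) (ΔX : OrbifoldDivisor p X)
    (N q : ℕ) : Prop :=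
  ∀ (V : Set X) (σ : (x : X) → SymFibre p q x), IsOpen V →
    IsOrbSection ΔX N q ΔX.support V σ →
      IsOrbSection ΔY N q (ΔY.support ∪ f ⁻¹' ΔX.support) (f ⁻¹' V) (pullbackSym f q σ)

end Pullback

end GeomOrbifold

end

/-! Part 1 compares orders of vanishing. Let `F_j` be the components of `f` in adapted charts. The
pullback of the generator of `J_1, …, J_N` is a combination of the generators of `I_1, …, I_N`, with
coefficients `∏_l minor(J_l, I_l) · ∏_i y_i^(k_i - ⌈k_i/m_i⌉)` divided by `∏_j F_j^(k_j -
⌈k_j/m_j⌉)`, and these quotients have to be holomorphic. By the Riemann extension theorem it is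
enough to bound them near the smooth points of a hypersurface (`wall`) that contains the zeros of
the denominator (`exists_eq_mul_of_isBigO`). Near such a point the wall has one equation `v`, and
`F_j = v^t_j · unit` whenever `m_j ≠ 1`. Since `d(v^t u) = t v^(t-1) u dv + v^t du` and `dv ∧ dv =
0`, each minor loses at most one power of `v` against `∑ t_j`. The inequalities `m_j ≤ t_j m(E)`
compensate the total loss (`isBigO_prod_minor`, `ceilDiv_le_sum`). They come from the morphism
condition because, the components of the support being smooth, `x_j = 0` is the whole of `D` near
the image point. Off the support of `Δ_Y` the condition is applied to an irreducible component `E`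
of `f⁻¹(D)`, of multiplicity one, whose existence has to be proved
(`IsHypersurface.exists_primeDivisor`).

The complex analysis rests on one device: cutting a hypersurface `T = 0` with small discs `z + λe`.
The power sums of the zeros on a disc are residue integrals, hence holomorphic in `z`. Their Hankel
determinant is a discriminant, off which the zeros are holomorphic functions of `z` with distinct
values. This yields the extension theorem, the density of the regular points, and the analyticity of
the closure of a component of the regular locus.

Part 2 tests the inclusion on the single section `x_j^(⌈N/m_j⌉ - N) (dx_j)^N`, evaluated at the
Euler field `w_i ∂/∂w_i` of a chart in which `E` is `w_i = 0`. If `x_j ∘ f` vanishes to order `T >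
0` along `E`, the left side has order exactly `T⌈N/m_j⌉`, while every generator on `Y` gives order
at least `⌈N/m(E)⌉`. As the numerator of a finite `m_j` divides `N`, the quotient `N/m_j` is an
integer, so `⌈N/m(E)⌉ ≤ T⌈N/m_j⌉` becomes `m_j ≤ T m(E)`. Finally `T ≤ t`, because `x_j` divides the
equation of `D`. -/

noncomputable section

namespace GeomOrbifold

/-! ### Holomorphic dependence of integrals on a parameter -/

section ParametricIntegral

open Metric Set intervalIntegral MeasureTheory
open scoped NNReal ENNReal

variable {E : Type*} [NormedAddCommGroup E] [NormedSpace ℂ E]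

/-- Near a point of analyticity of the integrand, integrals over short arcs are analytic in the
parameter. -/
theorem exists_nhds_analyticAt_intervalIntegral {g : E × ℂ → ℂ} {x₀ : E} {ζ₀ : ℂ}
    (hg : AnalyticAt ℂ g (x₀, ζ₀)) :
    ∃ N : Set ℂ, IsOpen N ∧ ζ₀ ∈ N ∧ ∀ (γ w : ℝ → ℂ), Continuous γ → Continuous w →
      ∀ a b : ℝ, (∀ t ∈ uIcc a b, γ t ∈ N) →
        AnalyticAt ℂ (fun x => ∫ t in a..b, w t * g (x, γ t)) x₀ := by
  obtain ⟨p, R, hp⟩ := hg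
  obtain ⟨ρ', hρ'0, hρ'R⟩ := ENNReal.lt_iff_exists_nnreal_btwn.1 hp.r_pos
  -- One `ρ` is spent on moving the centre to `(x₀, γ t)`, the other on the parameter.
  obtain ⟨ρ, rfl⟩ : ∃ ρ : ℝ≥0, ρ' = ρ + ρ := ⟨ρ' / 2, by simp⟩
  have hρ0 : 0 < ρ := by
    have : (0 : ℝ≥0) < ρ + ρ := by exact_mod_cast hρ'0
    by_contra h
    simp only [not_lt, nonpos_iff_eq_zero] at h
    simp [h] at this
  have hρR : (ρ : ℝ≥0∞) + ρ < R := by exact_mod_cast hρ'R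
  have hρrad : (ρ : ℝ≥0∞) + ρ < p.radius := hρR.trans_le hp.r_le
  have hρ1 : (ρ : ℝ≥0∞) < p.radius := lt_of_le_of_lt le_self_add hρrad
  refine ⟨ball ζ₀ ρ, isOpen_ball, mem_ball_self (by exact_mod_cast hρ0), ?_⟩
  intro γ w hγ hw a b hab
  set inl : E →L[ℂ] E × ℂ := ContinuousLinearMap.inl ℂ E ℂ with hinl
  set η : ℝ → E × ℂ := fun t => (0, γ t - ζ₀) with hη
  have hηc : Continuous η := by fun_prop
  have hηn : ∀ t ∈ uIcc a b, ‖η t‖₊ ≤ ρ := by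
    intro t ht
    have := hab t ht
    rw [mem_ball, dist_eq_norm] at this
    have h2 : ‖η t‖ = ‖γ t - ζ₀‖ := by simp [hη, Prod.norm_def]
    rw [← NNReal.coe_le_coe, coe_nnnorm, h2]
    exact this.le
  set q : ℝ → FormalMultilinearSeries ℂ E ℂ :=
    fun t => (p.changeOrigin (η t)).compContinuousLinearMap inl with hq
  -- A bound for the re-centred coefficients that does not depend on `t`; it allows integration term
  -- by term.
  set B : ℕ → ℝ≥0 := fun k => ∑' s : Σ l : ℕ, { s : Finset (Fin (k + l)) // s.card = l },
    ‖p (k + s.1)‖₊ * ρ ^ s.1 with hB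
  have hBsum : Summable fun k => B k * ρ ^ k := by
    have := (NNReal.summable_sigma.1 (p.changeOriginSeries_summable_aux₁ hρrad)).2
    simpa only [hB, ← NNReal.tsum_mul_right] using this
  have hqB : ∀ t ∈ uIcc a b, ∀ k, ‖q t k‖₊ ≤ B k := by
    intro t ht k
    have h1 : ‖q t k‖₊ ≤ ‖p.changeOrigin (η t) k‖₊ := by
      have := (p.changeOrigin (η t) k).norm_compContinuousLinearMap_le (fun _ : Fin k => inl)
      have h3 : ‖inl‖ ≤ 1 := ContinuousLinearMap.norm_inl_le_one ℂ E ℂ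
      have h4 : ∏ _i : Fin k, ‖inl‖ ≤ 1 := Finset.prod_le_one (fun _ _ => norm_nonneg _)
        fun _ _ => h3
      exact this.trans (mul_le_of_le_one_right (norm_nonneg _) h4)
    have h2 : (‖η t‖₊ : ℝ≥0∞) < p.radius :=
      lt_of_le_of_lt (by exact_mod_cast hηn t ht) hρ1
    refine h1.trans ((p.nnnorm_changeOrigin_le k h2).trans ?_)
    refine Summable.tsum_le_tsum (fun s => ?_) (p.changeOriginSeries_summable_aux₂ h2 k)
      (p.changeOriginSeries_summable_aux₂ hρ1 k)
    gcongr
    exact hηn t ht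
  have hqc : ∀ k, ContinuousOn (fun t => q t k) (uIcc a b) := by
    intro k
    have h1 : ContinuousOn (fun x => p.changeOrigin x k) (eball 0 p.radius) :=
      (p.hasFPowerSeriesOnBall_changeOrigin k (hp.r_pos.trans_le hp.r_le)).continuousOn
    have h2 : ContinuousOn (fun t => p.changeOrigin (η t) k) (uIcc a b) := by
      refine h1.comp hηc.continuousOn fun t ht => ?_
      rw [mem_eball_zero_iff]
      exact lt_of_le_of_lt (by exact_mod_cast hηn t ht) hρ1
    exact (ContinuousMultilinearMap.compContinuousLinearMapL (𝕜 := ℂ) (F := ℂ)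
      (fun _ : Fin k => inl)).continuous.comp_continuousOn h2
  obtain ⟨M, hM⟩ := (isCompact_uIcc (a := a) (b := b)).exists_bound_of_continuousOn
    hw.continuousOn
  have hM0 : 0 ≤ M := (norm_nonneg _).trans (hM a left_mem_uIcc)
  have hsumt : ∀ t ∈ uIcc a b, ∀ y : E, ‖y‖ < ρ →
      HasSum (fun k => q t k fun _ => y) (g (x₀ + y, γ t)) := by
    intro t ht y hy
    have h1 := hp.changeOrigin (y := η t)
      (lt_of_le_of_lt (by exact_mod_cast hηn t ht)
        (lt_of_le_of_lt le_self_add hρR))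
    have h2 := h1.hasSum (y := inl y) (by
      rw [mem_eball_zero_iff, lt_tsub_iff_right]
      refine lt_of_le_of_lt (add_le_add ?_ ?_) hρR
      · have : ‖inl y‖₊ ≤ ρ := by
          rw [← NNReal.coe_le_coe, coe_nnnorm]
          simpa [hinl, Prod.norm_def] using hy.le
        exact_mod_cast this
      · exact_mod_cast hηn t ht)
    simpa [hq, hη, hinl, Function.comp_def] using h2
  set Q : FormalMultilinearSeries ℂ E ℂ := fun k => ∫ t in a..b, w t • q t k with hQ
  refine ⟨Q, ρ, ?_, by exact_mod_cast hρ0, ?_⟩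
  · refine Q.le_radius_of_summable_norm ?_
    have : Summable fun k => ((B k * ρ ^ k : ℝ≥0) : ℝ) * (M * |b - a|) :=
      (NNReal.summable_coe.2 hBsum).mul_right _
    refine Summable.of_nonneg_of_le (fun k => by positivity) (fun k => ?_) this
    have h1 : ‖Q k‖ ≤ (M * B k) * |b - a| := by
      refine intervalIntegral.norm_integral_le_of_norm_le_const fun t ht => ?_
      have ht' := uIoc_subset_uIcc ht
      rw [norm_smul]
      exact mul_le_mul (hM t ht') (by exact_mod_cast hqB t ht' k) (norm_nonneg _) hM0
    push_cast
    calc ‖Q k‖ * (ρ : ℝ) ^ k ≤ (M * B k) * |b - a| * (ρ : ℝ) ^ k := by gcongr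
      _ = _ := by ring
  · intro y hy
    have hy' : ‖y‖ < ρ := by
      rw [mem_eball_zero_iff] at hy
      have : ‖y‖₊ < ρ := by exact_mod_cast hy
      exact_mod_cast this
    have hQy : ∀ k, (Q k fun _ => y) = ∫ t in a..b, w t * q t k fun _ => y := by
      intro k
      have hint : IntervalIntegrable (fun t => w t • q t k) volume a b :=
        (hw.continuousOn.smul (hqc k)).intervalIntegrable
      have := ContinuousLinearMap.intervalIntegral_comp_comm
        (ContinuousMultilinearMap.apply ℂ (fun _ : Fin k => E) ℂ (fun _ => y)) hint
      simp only [ContinuousMultilinearMap.apply_apply, smul_apply,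
        smul_eq_mul] at this
      exact this.symm
    simp only [hQy]
    have hqy : ∀ t ∈ uIcc a b, ∀ k, ‖q t k fun _ => y‖ ≤ B k * ρ ^ k := by
      intro t ht k
      refine ((q t k).le_opNorm _).trans ?_
      rw [Finset.prod_const, Finset.card_univ, Fintype.card_fin]
      gcongr
      exact_mod_cast hqB t ht k
    refine intervalIntegral.hasSum_integral_of_dominated_convergence
      (bound := fun k _ => M * (B k * ρ ^ k)) ?_ ?_ ?_ ?_ ?_
    · intro k
      have hc : ContinuousOn (fun t => w t * q t k fun _ => y) (uIcc a b) := by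
        refine hw.continuousOn.mul ?_
        exact (ContinuousMultilinearMap.apply ℂ (fun _ : Fin k => E) ℂ
          (fun _ => y)).continuous.comp_continuousOn (hqc k)
      exact (hc.mono uIoc_subset_uIcc).aestronglyMeasurable measurableSet_uIoc
    · intro k
      refine ae_of_all _ fun t ht => ?_
      have ht' := uIoc_subset_uIcc ht
      rw [norm_mul]
      exact mul_le_mul (hM t ht') (hqy t ht' k) (norm_nonneg _) hM0
    · exact ae_of_all _ fun t _ => (by exact_mod_cast (NNReal.summable_coe.2 hBsum).mul_left M)
    · simp
    · exact ae_of_all _ fun t ht =>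
        (hsumt t (uIoc_subset_uIcc ht) y hy').mul_left (w t)

/-- Circle integrals of an analytic integrand are analytic in the parameter. -/
theorem analyticAt_circleIntegral {g : E × ℂ → ℂ} {x₀ : E} {c : ℂ} {r : ℝ}
    (hr : 0 ≤ r) (hg : ∀ ζ ∈ sphere c r, AnalyticAt ℂ g (x₀, ζ)) :
    AnalyticAt ℂ (fun x => ∮ ζ in C(c, r), g (x, ζ)) x₀ := by
  have hmem : ∀ t : ℝ, circleMap c r t ∈ sphere c r := circleMap_mem_sphere c hr
  choose N hNo hN hNint using fun t : ℝ =>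
    exists_nhds_analyticAt_intervalIntegral (hg (circleMap c r t) (hmem t))
  set cov : ℝ → Set (Icc (0 : ℝ) (2 * Real.pi)) := fun t =>
    {s | circleMap c r s ∈ N t} with hcov
  have hcovo : ∀ t, IsOpen (cov t) := fun t =>
    (hNo t).preimage ((continuous_circleMap c r).comp continuous_subtype_val)
  obtain ⟨t, ht0, htm, ⟨m, htend⟩, hsub⟩ := exists_monotone_Icc_subset_open_cover_Icc
    Real.two_pi_pos.le hcovo (fun s _ => mem_iUnion.2 ⟨s, hN s⟩)
  have hpiece : ∀ k, AnalyticAt ℂ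
      (fun x => ∫ θ in (t k : ℝ)..(t (k + 1) : ℝ), deriv (circleMap c r) θ *
        g (x, circleMap c r θ)) x₀ := by
    intro k
    obtain ⟨i, hi⟩ := hsub k
    refine hNint i (circleMap c r) (deriv (circleMap c r)) (continuous_circleMap c r)
      ((contDiff_circleMap c r (n := ⊤)).continuous_deriv le_top) _ _ ?_
    intro s hs
    rw [uIcc_of_le (by exact_mod_cast htm k.le_succ)] at hs
    have hs' : s ∈ Icc (0 : ℝ) (2 * Real.pi) :=
      ⟨(t k).2.1.trans hs.1, hs.2.trans (t (k + 1)).2.2⟩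
    exact hi (show (⟨s, hs'⟩ : Icc (0 : ℝ) (2 * Real.pi)) ∈ Icc (t k) (t (k + 1)) from hs)
  have hsum : AnalyticAt ℂ (fun x => ∑ k ∈ Finset.range m,
      ∫ θ in (t k : ℝ)..(t (k + 1) : ℝ), deriv (circleMap c r) θ *
        g (x, circleMap c r θ)) x₀ := Finset.analyticAt_fun_sum _ fun k _ => hpiece k
  refine hsum.congr ?_
  -- Adding up the arcs needs an integrable integrand, which compactness of the circle provides for
  -- `x` near `x₀`.
  have hev : ∀ᶠ x in 𝓝 x₀, ∀ ζ ∈ sphere c r, ContinuousAt g (x, ζ) := by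
    refine IsCompact.eventually_forall_of_forall_eventually (isCompact_sphere c r) ?_
    intro ζ hζ
    exact (hg ζ hζ).eventually_continuousAt
  filter_upwards [hev] with x hx
  have hcont : Continuous fun θ : ℝ => deriv (circleMap c r) θ * g (x, circleMap c r θ) := by
    refine ((contDiff_circleMap c r (n := ⊤)).continuous_deriv le_top).mul ?_
    rw [continuous_iff_continuousAt]
    intro θ
    exact ContinuousAt.comp (f := fun θ : ℝ => (x, circleMap c r θ)) (hx _ (hmem θ))
      (continuousAt_const.prodMk (continuous_circleMap c r).continuousAt)
  have := intervalIntegral.sum_integral_adjacent_intervals (a := fun k => (t k : ℝ)) (n := m)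
    (μ := volume) (fun k _ => hcont.intervalIntegrable _ _)
  rw [this, circleIntegral, ht0, htend m le_rfl]
  simp [smul_eq_mul]

end ParametricIntegral

/-! ### Residues in one variable -/

section OneVariable

open Metric Set Filter Asymptotics

/-- Removable singularities at a finite set of points. -/
theorem exists_differentiableOn_of_finite_removable {Ω : Set ℂ} (hΩ : IsOpen Ω) (S : Finset ℂ) :
    ∀ φ : ℂ → ℂ, (∀ z ∈ Ω, z ∉ S → DifferentiableAt ℂ φ z) →
      (∀ s ∈ S, s ∈ Ω → φ =O[𝓝[≠] s] (fun _ => (1 : ℂ))) →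
      ∃ ψ : ℂ → ℂ, DifferentiableOn ℂ ψ Ω ∧ ∀ z, z ∉ S → ψ z = φ z := by
  induction S using Finset.induction_on with
  | empty =>
    intro φ hd _
    exact ⟨φ, fun z hz => (hd z hz (by simp)).differentiableWithinAt, fun _ _ => rfl⟩
  | insert s S hs ih =>
    intro φ hd hb
    by_cases hsΩ : s ∈ Ω
    swap
    · obtain ⟨ψ, h1, h2⟩ := ih φ
        (fun z hz hzS => hd z hz (by
          rw [Finset.mem_insert, not_or]
          exact ⟨fun h => hsΩ (h ▸ hz), hzS⟩))
        (fun s' hs' => hb s' (Finset.mem_insert_of_mem hs'))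
      exact ⟨ψ, h1, fun z hz => h2 z fun h => hz (Finset.mem_insert_of_mem h)⟩
    set φ' := Function.update φ s (limUnder (𝓝[≠] s) φ) with hφ'
    have hne : ∀ z, z ≠ s → φ' =ᶠ[𝓝 z] φ := fun z hz => by
      filter_upwards [isOpen_ne.mem_nhds hz] with x hx
      exact Function.update_of_ne hx _ _
    have hds : DifferentiableAt ℂ φ' s := by
      obtain ⟨C, hC⟩ := (hb s (Finset.mem_insert_self _ _) hsΩ).bound
      rw [eventually_nhdsWithin_iff] at hC
      have hSn : ((S : Set ℂ)ᶜ) ∈ 𝓝 s :=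
        S.finite_toSet.isClosed.isOpen_compl.mem_nhds (by simpa using hs)
      obtain ⟨U, hUsub, hUo, hsU⟩ := _root_.mem_nhds_iff.1
        (inter_mem (inter_mem hC hSn) (hΩ.mem_nhds hsΩ))
      have := Complex.differentiableOn_update_limUnder_of_bddAbove (f := φ) (hUo.mem_nhds hsU)
        (fun z hz => (hd z (hUsub hz.1).2 (by
          rw [Finset.mem_insert, not_or]
          exact ⟨hz.2, (hUsub hz.1).1.2⟩)).differentiableWithinAt)
        ⟨C, by
          rintro _ ⟨z, hz, rfl⟩
          simpa using (hUsub hz.1).1.1 hz.2⟩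
      exact this.differentiableAt (hUo.mem_nhds hsU)
    obtain ⟨ψ, h1, h2⟩ := ih φ'
      (fun z hz hzS => by
        rcases eq_or_ne z s with rfl | h
        · exact hds
        · exact (hd z hz (by simp [h, hzS])).congr_of_eventuallyEq (hne z h))
      (fun s' hs' hs'Ω => by
        have h : s' ≠ s := fun h => hs (h ▸ hs')
        exact (hb s' (Finset.mem_insert_of_mem hs') hs'Ω).congr'
          ((hne s' h).filter_mono nhdsWithin_le_nhds).symm EventuallyEq.rfl)
    refine ⟨ψ, h1, fun z hz => ?_⟩
    rw [Finset.mem_insert, not_or] at hz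
    rw [h2 z hz.2, hφ', Function.update_of_ne hz.1]

/-- Cauchy's theorem with finitely many removable singularities. -/
theorem circleIntegral_eq_zero_of_removable {c : ℂ} {r : ℝ} (hr : 0 < r) {Ω : Set ℂ}
    (hΩ : IsOpen Ω) (hsub : closedBall c r ⊆ Ω) (S : Finset ℂ) (hS : ∀ s ∈ S, s ∉ sphere c r)
    {φ : ℂ → ℂ} (hd : ∀ z ∈ Ω, z ∉ S → DifferentiableAt ℂ φ z)
    (hb : ∀ s ∈ S, s ∈ Ω → φ =O[𝓝[≠] s] (fun _ => (1 : ℂ))) :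
    (∮ z in C(c, r), φ z) = 0 := by
  obtain ⟨ψ, h1, h2⟩ := exists_differentiableOn_of_finite_removable hΩ S φ hd hb
  rw [circleIntegral.integral_congr (g := ψ) hr.le
    fun z hz => (h2 z fun h => hS z h hz).symm]
  exact Complex.circleIntegral_eq_zero_of_differentiable_on_off_countable hr.le countable_empty
    (h1.continuousOn.mono hsub)
    fun z hz => h1.differentiableAt (hΩ.mem_nhds (hsub (ball_subset_closedBall hz.1)))

/-- The Cauchy formula with finitely many removable singularities. -/
theorem circleIntegral_div_eq_of_removable {c : ℂ} {r : ℝ} (hr : 0 < r) {Ω : Set ℂ}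
    (hΩ : IsOpen Ω) (hsub : closedBall c r ⊆ Ω) (S : Finset ℂ) (hS : ∀ s ∈ S, s ∉ sphere c r)
    {φ : ℂ → ℂ} (hd : ∀ z ∈ Ω, z ∉ S → DifferentiableAt ℂ φ z)
    (hb : ∀ s ∈ S, s ∈ Ω → φ =O[𝓝[≠] s] (fun _ => (1 : ℂ))) {w : ℂ} (hw : w ∈ ball c r)
    (hwS : w ∉ S) :
    (∮ z in C(c, r), (z - w)⁻¹ * φ z) = 2 * Real.pi * Complex.I * φ w := by
  obtain ⟨ψ, h1, h2⟩ := exists_differentiableOn_of_finite_removable hΩ S φ hd hb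
  rw [circleIntegral.integral_congr (g := fun z => (z - w)⁻¹ * ψ z) hr.le
    fun z hz => by simp only [h2 z fun h => hS z h hz], ← h2 w hwS]
  exact Complex.circleIntegral_sub_inv_smul_of_differentiable_on_off_countable countable_empty hw
    (h1.continuousOn.mono hsub)
    fun z hz => h1.differentiableAt (hΩ.mem_nhds (hsub (ball_subset_closedBall hz.1)))

theorem finite_zeros_closedBall {c : ℂ} {r : ℝ} {h : ℂ → ℂ}
    (hh : AnalyticOnNhd ℂ h (closedBall c r)) (h0 : ∃ z ∈ closedBall c r, h z ≠ 0) :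
    {z ∈ closedBall c r | h z = 0}.Finite := by
  by_contra hinf
  obtain ⟨z, hz, hacc⟩ := Set.Infinite.exists_accPt_of_subset_isCompact hinf
    (isCompact_closedBall c r) (sep_subset _ _)
  have hfr : ∃ᶠ w in 𝓝[≠] z, h w = 0 :=
    (accPt_iff_frequently_nhdsNE.1 hacc).mono fun w hw => hw.2
  obtain ⟨w, hw, hw0⟩ := h0
  exact hw0 (hh.eqOn_zero_of_preconnected_of_frequently_eq_zero
    (convex_closedBall c r).isPreconnected hz hfr hw)

/-- The zeros of a function in a disc, with multiplicities, and their power sums. -/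
theorem exists_zeros_powerSums {c : ℂ} {r : ℝ} (hr : 0 < r) {h : ℂ → ℂ}
    (hh : AnalyticOnNhd ℂ h (closedBall c r)) (h0 : ∀ z ∈ sphere c r, h z ≠ 0) :
    ∃ (S : Finset ℂ) (μ : ℂ → ℕ), (∀ s ∈ S, s ∈ ball c r ∧ 0 < μ s) ∧
      (∀ z ∈ closedBall c r, h z = 0 ↔ z ∈ S) ∧
      ∀ m : ℕ, (∮ z in C(c, r), z ^ m * (deriv h z / h z)) =
        2 * Real.pi * Complex.I * ∑ s ∈ S, (μ s : ℂ) * s ^ m := by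
  obtain ⟨z₀, hz₀⟩ : (sphere c r).Nonempty := NormedSpace.sphere_nonempty.2 hr.le
  have hfin := finite_zeros_closedBall hh ⟨z₀, sphere_subset_closedBall hz₀, h0 z₀ hz₀⟩
  set S := hfin.toFinset with hSdef
  have hmem : ∀ s, s ∈ S ↔ s ∈ closedBall c r ∧ h s = 0 := fun s => by simp [hSdef]
  have hball : ∀ s ∈ S, s ∈ ball c r := fun s hs => by
    obtain ⟨h1, h2⟩ := (hmem s).1 hs
    rcases (mem_closedBall.1 h1).lt_or_eq with h3 | h3
    · exact h3
    · exact absurd h2 (h0 s h3)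
  have hloc : ∀ s : ℂ, ∃ (m : ℕ) (g : ℂ → ℂ), s ∈ S → 0 < m ∧ AnalyticAt ℂ g s ∧ g s ≠ 0 ∧
      ∀ᶠ z in 𝓝 s, h z = (z - s) ^ m * g z := by
    intro s
    by_cases hs : s ∈ S
    swap
    · exact ⟨0, 0, fun h => absurd h hs⟩
    obtain ⟨h1, h2⟩ := (hmem s).1 hs
    have hne : ¬ ∀ᶠ z in 𝓝 s, h z = 0 := fun hev =>
      h0 z₀ hz₀ (hh.eqOn_zero_of_preconnected_of_eventuallyEq_zero
        (convex_closedBall c r).isPreconnected h1 hev (sphere_subset_closedBall hz₀))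
    obtain ⟨m, g, hg, hgs, hgz⟩ := (hh s h1).exists_eventuallyEq_pow_smul_nonzero_iff.2 hne
    refine ⟨m, g, fun _ => ⟨?_, hg, hgs, hgz⟩⟩
    rcases Nat.eq_zero_or_pos m with rfl | hm
    · have := hgz.self_of_nhds
      simp [h2] at this
      exact absurd this.symm hgs
    · exact hm
  choose μ g hμg using hloc
  refine ⟨S, μ, fun s hs => ⟨hball s hs, (hμg s hs).1⟩,
    fun z hz => ⟨fun h => (hmem z).2 ⟨hz, h⟩, fun h => ((hmem z).1 h).2⟩, fun m => ?_⟩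
  -- subtract the principal parts
  set Ω : Set ℂ := {z | AnalyticAt ℂ h z ∧ (h z = 0 → z ∈ S)} with hΩdef
  have hΩnhds : ∀ z ∈ closedBall c r, Ω ∈ 𝓝 z := by
    intro z hz
    by_cases hz0 : h z = 0
    · have hzS : z ∈ S := (hmem z).2 ⟨hz, hz0⟩
      filter_upwards [(hh z hz).eventually_analyticAt, isOpen_ball.mem_nhds (hball z hzS)]
        with w hw hwb
      exact ⟨hw, fun h => (hmem w).2 ⟨ball_subset_closedBall hwb, h⟩⟩
    · filter_upwards [(hh z hz).eventually_analyticAt,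
        (hh z hz).continuousAt.eventually_ne hz0] with w hw hwb
      exact ⟨hw, fun h => absurd h hwb⟩
  have hΩsub : closedBall c r ⊆ interior Ω := fun z hz => mem_interior_iff_mem_nhds.2 (hΩnhds z hz)
  have hzero : (∮ z in C(c, r), (z ^ m * (deriv h z / h z) -
      ∑ s ∈ S, (μ s : ℂ) * ((z - s)⁻¹ * z ^ m))) = 0 := by
    refine circleIntegral_eq_zero_of_removable hr isOpen_interior hΩsub S
      (fun s hs h => h0 s h ((hmem s).1 hs).2) ?_ ?_
    · intro z hz hzS
      obtain ⟨h1, h2⟩ := interior_subset hz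
      have hz0 : h z ≠ 0 := fun h => hzS (h2 h)
      refine DifferentiableAt.sub (by
        exact (differentiableAt_id.pow m).mul (h1.deriv.differentiableAt.div
          h1.differentiableAt hz0)) ?_
      refine DifferentiableAt.fun_sum fun s hs => ?_
      have : z - s ≠ 0 := sub_ne_zero.2 fun h => hzS (h ▸ hs)
      exact ((((differentiableAt_id.sub_const s).inv this).mul
        (differentiableAt_id.pow m)).const_mul _)
    · intro s hs _
      obtain ⟨_, hg, hgs, hgz⟩ := hμg s hs
      -- With `h = (z - s)^μ g` one has `h'/h = μ/(z - s) + g'/g`, so the pole at `s` cancels and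
      -- this function remains.
      have hcont : ContinuousAt (fun z => z ^ m * (deriv (g s) z / g s z) -
          ∑ s' ∈ S.erase s, (μ s' : ℂ) * ((z - s')⁻¹ * z ^ m)) s := by
        refine ContinuousAt.sub (by
          exact (continuousAt_id.pow m).mul (hg.deriv.continuousAt.div hg.continuousAt hgs)) ?_
        refine tendsto_finsetSum _ fun s' hs' => ?_
        have : s - s' ≠ 0 := sub_ne_zero.2 (Finset.ne_of_mem_erase hs').symm
        have h2 : ContinuousAt (fun z => (μ s' : ℂ) * ((z - s')⁻¹ * z ^ m)) s :=
          (((continuousAt_id.sub continuousAt_const).inv₀ this).mul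
            (continuousAt_id.pow m)).const_mul _
        exact h2
      refine ((hcont.isBigO_one ℂ).mono nhdsWithin_le_nhds).congr' ?_ EventuallyEq.rfl
      have hder := hgz.eventually_nhds
      filter_upwards [nhdsWithin_le_nhds hder, nhdsWithin_le_nhds hg.eventually_analyticAt,
        nhdsWithin_le_nhds (hg.continuousAt.eventually_ne hgs), self_mem_nhdsWithin]
        with z hz hgza hgz0 hzs
      have hzs' : z - s ≠ 0 := sub_ne_zero.2 hzs
      have hd : deriv h z = (μ s : ℂ) * (z - s) ^ (μ s - 1) * g s z +
          (z - s) ^ (μ s) * deriv (g s) z := by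
        rw [EventuallyEq.deriv_eq hz]
        have := (((hasDerivAt_id z).sub_const s).pow (μ s)).mul
          hgza.differentiableAt.hasDerivAt
        simpa [Pi.mul_def, Pi.pow_def] using this.deriv
      have hpow : (z - s) ^ (μ s) = (z - s) ^ (μ s - 1) * (z - s) := by
        rw [← pow_succ, Nat.sub_add_cancel (hμg s hs).1]
      have hp0 : (z - s) ^ (μ s - 1) ≠ 0 := pow_ne_zero _ hzs'
      rw [← Finset.add_sum_erase S _ hs, hd, hz.self_of_nhds, hpow]
      field_simp
      ring
  have hterm : ∀ s ∈ S, (∮ z in C(c, r), (μ s : ℂ) * ((z - s)⁻¹ * z ^ m)) =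
      2 * Real.pi * Complex.I * ((μ s : ℂ) * s ^ m) := by
    intro s hs
    have := circleIntegral_div_eq_of_removable hr isOpen_univ (subset_univ _) ∅ (by simp)
      (φ := fun z => z ^ m) (fun z _ _ => differentiableAt_id.pow m) (by simp)
      (hball s hs) (by simp)
    have h2 := circleIntegral.integral_smul (μ s : ℂ) (fun z => (z - s)⁻¹ * z ^ m) c r
    simp only [smul_eq_mul] at h2
    rw [h2, this]
    ring
  have hci1 : CircleIntegrable (fun z => z ^ m * (deriv h z / h z)) c r := by
    refine ContinuousOn.circleIntegrable hr.le fun z hz => ?_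
    have h1 := hh z (sphere_subset_closedBall hz)
    exact ((continuousAt_id.pow m).mul (h1.deriv.continuousAt.div h1.continuousAt
      (h0 z hz))).continuousWithinAt
  have hci2 : ∀ s ∈ S, CircleIntegrable (fun z => (μ s : ℂ) * ((z - s)⁻¹ * z ^ m)) c r := by
    intro s hs
    refine ContinuousOn.circleIntegrable hr.le fun z hz => ?_
    have : z - s ≠ 0 := sub_ne_zero.2 fun h => h0 z hz (h ▸ ((hmem s).1 hs).2)
    exact ((((continuousAt_id.sub continuousAt_const).inv₀ this).mul
      (continuousAt_id.pow m)).const_mul _).continuousWithinAt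
  rw [circleIntegral.integral_sub hci1 (CircleIntegrable.fun_sum S hci2),
    circleIntegral.integral_fun_sum hci2, Finset.sum_congr rfl hterm, ← Finset.mul_sum,
    sub_eq_zero] at hzero
  exact hzero

end OneVariable

/-! ### Zeros on one-dimensional slices -/

section Slices

open Metric Set Filter Asymptotics

variable {V : Type*} [NormedAddCommGroup V] [NormedSpace ℂ V]

/-- On the discs `z + λ e`, `|λ - c| ≤ r`, with `z ∈ U`, the function `T` is holomorphic, and it
has no zeros on their boundaries. -/
structure IsSlice (T : V → ℂ) (e : V) (c : ℂ) (r : ℝ) (U : Set V) : Prop where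
  pos : 0 < r
  isOpen : IsOpen U
  analytic : ∀ z ∈ U, ∀ l ∈ closedBall c r, AnalyticAt ℂ T (z + l • e)
  ne_zero : ∀ z ∈ U, ∀ l ∈ sphere c r, T (z + l • e) ≠ 0

theorem continuous_slice (e : V) : Continuous fun q : V × ℂ => q.1 + q.2 • e := by fun_prop

theorem analyticAt_slice (e : V) (q : V × ℂ) :
    AnalyticAt ℂ (fun q : V × ℂ => q.1 + q.2 • e) q :=
  analyticAt_fst.add (analyticAt_snd.smul analyticAt_const)

theorem analyticAt_line (e z : V) (l : ℂ) : AnalyticAt ℂ (fun l : ℂ => z + l • e) l := by fun_prop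

theorem analyticAt_comp_slice {F : Type*} [NormedAddCommGroup F] [NormedSpace ℂ F] {T : V → F}
    {e z : V} {l : ℂ} (h : AnalyticAt ℂ T (z + l • e)) :
    AnalyticAt ℂ (fun q : V × ℂ => T (q.1 + q.2 • e)) (z, l) :=
  AnalyticAt.fun_comp_of_eq h (analyticAt_slice e (z, l)) rfl

theorem analyticAt_comp_line {T : V → ℂ} {e z : V} {l : ℂ} (h : AnalyticAt ℂ T (z + l • e)) :
    AnalyticAt ℂ (fun l : ℂ => T (z + l • e)) l :=
  AnalyticAt.fun_comp_of_eq h (analyticAt_line e z l) rfl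

theorem IsSlice.mono {T : V → ℂ} {e : V} {c : ℂ} {r : ℝ} {U U' : Set V} (h : IsSlice T e c r U)
    (hU' : IsOpen U') (hsub : U' ⊆ U) : IsSlice T e c r U' :=
  ⟨h.pos, hU', fun z hz => h.analytic z (hsub hz), fun z hz => h.ne_zero z (hsub hz)⟩

/-- A slice through one point extends to nearby points. -/
theorem exists_isSlice_ball {T : V → ℂ} {e a : V} {c : ℂ} {r : ℝ} (hr : 0 < r)
    (han : ∀ l ∈ closedBall c r, AnalyticAt ℂ T (a + l • e))
    (hne : ∀ l ∈ sphere c r, T (a + l • e) ≠ 0) :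
    ∃ ε > 0, IsSlice T e c r (ball a ε) := by
  have h1 : ∀ᶠ z in 𝓝 a, ∀ l ∈ closedBall c r, AnalyticAt ℂ T (z + l • e) := by
    refine (isCompact_closedBall c r).eventually_forall_of_forall_eventually fun l hl => ?_
    exact (continuous_slice e).continuousAt.eventually (han l hl).eventually_analyticAt
  have h2 : ∀ᶠ z in 𝓝 a, ∀ l ∈ sphere c r, T (z + l • e) ≠ 0 := by
    refine (isCompact_sphere c r).eventually_forall_of_forall_eventually fun l hl => ?_
    have hc := (continuous_slice e).continuousAt (x := (a, l))
    exact hc.eventually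
      ((han l (sphere_subset_closedBall hl)).continuousAt.eventually_ne (hne l hl))
  obtain ⟨ε, hε, hsub⟩ := Metric.mem_nhds_iff.1 (h1.and h2)
  exact ⟨ε, hε, hr, isOpen_ball, fun z hz => (hsub hz).1, fun z hz => (hsub hz).2⟩

/-- Slices with arbitrarily small discs. -/
theorem exists_isSlice_of_direction {T : V → ℂ} {e a : V} (hT : AnalyticAt ℂ T a)
    (hne : ∀ᶠ l in 𝓝[≠] (0 : ℂ), T (a + l • e) ≠ 0) {r₀ : ℝ} (hr₀ : 0 < r₀) :
    ∃ r > 0, r < r₀ ∧ ∃ ε > 0, IsSlice T e 0 r (ball a ε) := by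
  have h1 : ∀ᶠ l in 𝓝 (0 : ℂ), AnalyticAt ℂ T (a + l • e) := by
    have : ContinuousAt (fun l : ℂ => a + l • e) 0 := by fun_prop
    refine this.eventually ?_
    simpa using hT.eventually_analyticAt
  rw [eventually_nhdsWithin_iff] at hne
  obtain ⟨ρ, hρ, hsub⟩ := Metric.mem_nhds_iff.1 (h1.and hne)
  set r := min ρ r₀ / 2 with hr
  have hmin : 0 < min ρ r₀ := lt_min hρ hr₀
  have hr0 : 0 < r := by positivity
  have hrρ : r < ρ := (half_lt_self hmin).trans_le (min_le_left _ _)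
  have hrr : r < r₀ := (half_lt_self hmin).trans_le (min_le_right _ _)
  refine ⟨r, hr0, hrr, exists_isSlice_ball hr0 (fun l hl => (hsub ?_).1) fun l hl => (hsub ?_).2 ?_⟩
  · exact (mem_closedBall.1 hl).trans_lt hrρ
  · exact (mem_sphere.1 hl).trans_lt hrρ
  · rintro rfl
    simp at hl
    exact hr0.ne hl

/-- A function that does not vanish identically near `a` has a direction along which it does
not vanish. -/
theorem exists_direction {T : V → ℂ} {a : V} (hT : AnalyticAt ℂ T a)
    (hne : ¬ ∀ᶠ z in 𝓝 a, T z = 0) : ∃ e : V, ∀ᶠ l in 𝓝[≠] (0 : ℂ), T (a + l • e) ≠ 0 := by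
  obtain ⟨ε, hε, hball⟩ := hT.exists_ball_analyticOnNhd
  obtain ⟨z, hz, hz0⟩ : ∃ z ∈ ball a ε, T z ≠ 0 := by
    by_contra! h
    exact hne (by filter_upwards [ball_mem_nhds a hε] with z hz using h z hz)
  refine ⟨z - a, ?_⟩
  -- The line through `a` and `z` meets the ball in a convex set containing the parameters `0` and
  -- `1`; the identity theorem carries vanishing near `0` over to `1`, where `T z ≠ 0`.
  set U : Set ℂ := {l | a + l • (z - a) ∈ ball a ε} with hU
  have hUc : IsPreconnected U := by
    have h2 : Convex ℝ U := by
      intro x hx y hy s t hs ht hst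
      have := convex_ball a ε hx hy hs ht hst
      have heq : s • (a + x • (z - a)) + t • (a + y • (z - a)) =
          a + (s • x + t • y) • (z - a) := by
        rw [add_smul, smul_add, smul_add, smul_assoc, smul_assoc]
        calc _ = (s + t) • a + (s • x • (z - a) + t • y • (z - a)) := by rw [add_smul]; abel
          _ = _ := by rw [hst, one_smul]
      rwa [heq] at this
    exact h2.isPreconnected
  have han : AnalyticOnNhd ℂ (fun l : ℂ => T (a + l • (z - a))) U := fun l hl =>
    analyticAt_comp_line (hball _ hl)
  have h0 : (0 : ℂ) ∈ U := by simpa [hU] using hε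
  have h1 : (1 : ℂ) ∈ U := by simpa [hU, dist_eq_norm] using hz
  rcases (han 0 h0).eventually_eq_zero_or_eventually_ne_zero with h | h
  · exact absurd (by simpa using han.eqOn_zero_of_preconnected_of_eventuallyEq_zero hUc h0 h h1)
      hz0
  · exact h

/-- The power sums of the zeros of `T` on a slice. -/
def slicePowerSum (T : V → ℂ) (e : V) (c : ℂ) (r : ℝ) (m : ℕ) (z : V) : ℂ :=
  (2 * Real.pi * Complex.I)⁻¹ *
    ∮ l in C(c, r), l ^ m * (fderiv ℂ T (z + l • e) e / T (z + l • e))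

variable {T : V → ℂ} {e : V} {c : ℂ} {r : ℝ} {U : Set V}

theorem two_pi_I_ne : (2 * Real.pi * Complex.I : ℂ) ≠ 0 := Complex.two_pi_I_ne_zero

theorem IsSlice.analyticAt_slicePowerSum (h : IsSlice T e c r U) (m : ℕ) {z : V} (hz : z ∈ U) :
    AnalyticAt ℂ (slicePowerSum T e c r m) z := by
  refine analyticAt_const.mul (analyticAt_circleIntegral
    (g := fun q : V × ℂ => q.2 ^ m * (fderiv ℂ T (q.1 + q.2 • e) e / T (q.1 + q.2 • e)))
    h.pos.le fun l hl => ?_)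
  have h1 := h.analytic z hz l (sphere_subset_closedBall hl)
  have h2 : AnalyticAt ℂ (fun q : V × ℂ => T (q.1 + q.2 • e)) (z, l) :=
    analyticAt_comp_slice h1
  have h3 : AnalyticAt ℂ (fun q : V × ℂ => fderiv ℂ T (q.1 + q.2 • e) e) (z, l) :=
    AnalyticAt.fun_comp (g := ContinuousLinearMap.apply ℂ ℂ e)
      (ContinuousLinearMap.analyticAt _ _) (analyticAt_comp_slice h1.fderiv)
  exact (analyticAt_snd.pow m).mul (h3.div h2 (h.ne_zero z hz l hl))

theorem hasDerivAt_slice {z : V} {l : ℂ} (h : AnalyticAt ℂ T (z + l • e)) :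
    HasDerivAt (fun l : ℂ => T (z + l • e)) (fderiv ℂ T (z + l • e) e) l := by
  have h1 : HasDerivAt (fun l : ℂ => z + l • e) e l := by
    simpa using ((hasDerivAt_id l).smul_const e).const_add z
  exact h.differentiableAt.hasFDerivAt.comp_hasDerivAt l h1

theorem IsSlice.analyticOnNhd (h : IsSlice T e c r U) {z : V} (hz : z ∈ U) :
    AnalyticOnNhd ℂ (fun l : ℂ => T (z + l • e)) (closedBall c r) :=
  fun l hl => analyticAt_comp_line (h.analytic z hz l hl)

theorem IsSlice.exists_zeros (h : IsSlice T e c r U) {z : V} (hz : z ∈ U) :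
    ∃ (S : Finset ℂ) (μ : ℂ → ℕ), (∀ s ∈ S, s ∈ ball c r ∧ 0 < μ s) ∧
      (∀ l ∈ closedBall c r, T (z + l • e) = 0 ↔ l ∈ S) ∧
      ∀ m : ℕ, slicePowerSum T e c r m z = ∑ s ∈ S, (μ s : ℂ) * s ^ m := by
  obtain ⟨S, μ, h1, h2, h3⟩ := exists_zeros_powerSums h.pos (h.analyticOnNhd hz) (h.ne_zero z hz)
  refine ⟨S, μ, h1, h2, fun m => ?_⟩
  rw [slicePowerSum, circleIntegral.integral_congr h.pos.le
    (g := fun l => l ^ m * (deriv (fun l : ℂ => T (z + l • e)) l / T (z + l • e)))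
    fun l hl => ?_, h3 m, inv_mul_cancel_left₀ two_pi_I_ne]
  simp only [(hasDerivAt_slice (h.analytic z hz l (sphere_subset_closedBall hl))).deriv]

/-- Zeros persist on nearby slices. -/
theorem IsSlice.eventually_exists_zero (h : IsSlice T e c r U) {z : V} (hz : z ∈ U) {l : ℂ}
    (hl : l ∈ ball c r) (hl0 : T (z + l • e) = 0) :
    ∀ᶠ w in 𝓝 z, ∃ l ∈ ball c r, T (w + l • e) = 0 := by
  -- The power sum of exponent `0` counts the zeros with multiplicity. It is continuous, so it stays
  -- nonzero nearby.
  have hne : slicePowerSum T e c r 0 z ≠ 0 := by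
    obtain ⟨S, μ, h1, h2, h3⟩ := h.exists_zeros hz
    have hlS := (h2 l (ball_subset_closedBall hl)).1 hl0
    rw [h3 0]
    have : (∑ s ∈ S, (μ s : ℂ) * s ^ 0) = ((∑ s ∈ S, μ s : ℕ) : ℂ) := by simp
    rw [this, Nat.cast_ne_zero]
    exact (Finset.sum_pos (fun s hs => (h1 s hs).2) ⟨l, hlS⟩).ne'
  filter_upwards [(h.analyticAt_slicePowerSum 0 hz).continuousAt.eventually_ne hne,
    h.isOpen.mem_nhds hz] with w hw hwU
  obtain ⟨S, μ, h1, h2, h3⟩ := h.exists_zeros hwU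
  rcases S.eq_empty_or_nonempty with rfl | ⟨s, hs⟩
  · exact absurd (h3 0) (by simpa using hw)
  · exact ⟨s, (h1 s hs).1, (h2 s (ball_subset_closedBall (h1 s hs).1)).2 hs⟩

/-- The number of zeros on nearby slices is bounded. -/
theorem IsSlice.eventually_card_le (h : IsSlice T e c r U) {z : V} (hz : z ∈ U) :
    ∃ K : ℕ, ∀ᶠ w in 𝓝 z, ∀ S : Finset ℂ,
      (∀ l ∈ S, l ∈ ball c r ∧ T (w + l • e) = 0) → S.card ≤ K := by
  refine ⟨⌈‖slicePowerSum T e c r 0 z‖ + 1⌉₊, ?_⟩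
  have hc := (h.analyticAt_slicePowerSum 0 hz).continuousAt.norm
  filter_upwards [hc.eventually_lt continuousAt_const
    (lt_add_one ‖slicePowerSum T e c r 0 z‖), h.isOpen.mem_nhds hz] with w hw hwU S' hS'
  obtain ⟨S, μ, h1, h2, h3⟩ := h.exists_zeros hwU
  have hsub : S' ⊆ S := fun l hl =>
    (h2 l (ball_subset_closedBall (hS' l hl).1)).1 (hS' l hl).2
  have hle : S.card ≤ ∑ s ∈ S, μ s := by
    simpa using Finset.card_nsmul_le_sum S μ 1 fun s hs => (h1 s hs).2
  have heq : ‖slicePowerSum T e c r 0 w‖ = (∑ s ∈ S, μ s : ℕ) := by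
    have : (∑ s ∈ S, (μ s : ℂ) * s ^ 0) = ((∑ s ∈ S, μ s : ℕ) : ℂ) := by simp
    rw [h3 0, this, Complex.norm_natCast]
  have : ((∑ s ∈ S, μ s : ℕ) : ℝ) ≤ ‖slicePowerSum T e c r 0 z‖ + 1 := heq ▸ hw.le
  exact (Finset.card_le_card hsub).trans (hle.trans (by
    have := this.trans (Nat.le_ceil _)
    exact_mod_cast this))

/-- The Hankel matrix of weighted power sums of `k` distinct numbers is regular. -/
theorem det_hankel_ne_zero {k : ℕ} (S : Finset ℂ) (μ : ℂ → ℕ) (hμ : ∀ s ∈ S, 0 < μ s)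
    (hk : S.card = k) :
    (Matrix.of fun i j : Fin k => ∑ s ∈ S, (μ s : ℂ) * s ^ ((i : ℕ) + j)).det ≠ 0 := by
  set enum : Fin k ≃ S := (Finset.equivFinOfCardEq hk).symm with henum
  set v : Fin k → ℂ := fun i => (enum i : ℂ) with hv
  have hvinj : Function.Injective v := Subtype.val_injective.comp enum.injective
  have hM : (Matrix.of fun i j : Fin k => ∑ s ∈ S, (μ s : ℂ) * s ^ ((i : ℕ) + j)) =
      (Matrix.vandermonde v).transpose * Matrix.diagonal (fun i => (μ (v i) : ℂ)) *
        Matrix.vandermonde v := by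
    ext i j
    rw [Matrix.mul_apply, Matrix.of_apply, ← Finset.sum_coe_sort S, ← enum.sum_comp]
    refine Finset.sum_congr rfl fun l _ => ?_
    rw [Matrix.mul_diagonal, Matrix.transpose_apply, Matrix.vandermonde_apply,
      Matrix.vandermonde_apply, pow_add]
    ring
  have hd : (Matrix.vandermonde v).det ≠ 0 := Matrix.det_vandermonde_ne_zero_iff.2 hvinj
  rw [hM, Matrix.det_mul, Matrix.det_mul, Matrix.det_transpose, Matrix.det_diagonal]
  refine mul_ne_zero (mul_ne_zero hd (Finset.prod_ne_zero_iff.2 fun i _ => ?_)) hd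
  exact_mod_cast (hμ _ (enum i).2).ne'

/-- The Hankel matrix of weighted power sums of fewer than `k` numbers is singular. -/
theorem det_hankel_eq_zero {k : ℕ} (S : Finset ℂ) (μ : ℂ → ℕ) (hk : S.card < k) :
    (Matrix.of fun i j : Fin k => ∑ s ∈ S, (μ s : ℂ) * s ^ ((i : ℕ) + j)).det = 0 := by
  -- The coefficient vector of a polynomial of degree less than `k` vanishing on `S` lies in the
  -- kernel.
  set P : Polynomial ℂ := ∏ s ∈ S, (Polynomial.X - Polynomial.C s) with hP
  have hdeg : P.natDegree = S.card := Polynomial.natDegree_finsetProd_X_sub_C_eq_card S (fun s => s)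
  have hmonic : P.Monic := Polynomial.monic_prod_of_monic _ _ fun s _ => Polynomial.monic_X_sub_C s
  refine Matrix.exists_mulVec_eq_zero_iff.1 ⟨fun j => P.coeff j, fun h0 => ?_, ?_⟩
  · have := congrFun h0 ⟨S.card, hk⟩
    simp only [Pi.zero_apply] at this
    rw [← hdeg, hmonic.coeff_natDegree] at this
    exact one_ne_zero this
  · ext i
    rw [Matrix.mulVec, dotProduct]
    simp only [Matrix.of_apply, Finset.sum_mul, Pi.zero_apply]
    rw [Finset.sum_comm]
    refine Finset.sum_eq_zero fun s hs => ?_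
    have hev : P.eval s = 0 := by
      rw [hP, Polynomial.eval_prod]
      exact Finset.prod_eq_zero hs (by simp)
    rw [Polynomial.eval_eq_sum_range' (n := k) (by rw [hdeg]; exact hk), ← Fin.sum_univ_eq_sum_range
      (fun j => P.coeff j * s ^ j)] at hev
    calc _ = ∑ j : Fin k, ((μ s : ℂ) * s ^ (i : ℕ)) * (P.coeff j * s ^ (j : ℕ)) :=
          Finset.sum_congr rfl fun j _ => by rw [pow_add]; ring
      _ = 0 := by rw [← Finset.mul_sum, hev, mul_zero]

/-- Near `z₀` the zeros of `T` on the slices are the values of finitely many holomorphic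
functions with distinct values. -/
def GoodSlice (T : V → ℂ) (e : V) (r : ℝ) (z₀ : V) : Prop :=
  ∃ (S : Finset ℂ) (root : ℂ → V → ℂ),
    (∀ s ∈ S, s ∈ ball 0 r ∧ AnalyticAt ℂ (root s) z₀ ∧ root s z₀ = s) ∧
    ∀ᶠ z in 𝓝 z₀, ∀ l ∈ ball (0 : ℂ) r, T (z + l • e) = 0 ↔ ∃ s ∈ S, root s z = l

/-- A zero can only split into several zeros on nearby slices if their number increases. When the
number at `z₀` is locally maximal, a small disc about each zero keeps exactly one distinct zero,
whose position is a quotient of two power sums. -/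
theorem IsSlice.goodSlice_of_max (h : IsSlice T e 0 r U) {z₀ : V} (hz₀ : z₀ ∈ U) (S : Finset ℂ)
    (hS : ∀ l ∈ closedBall (0 : ℂ) r, T (z₀ + l • e) = 0 ↔ l ∈ S) (hSr : ∀ s ∈ S, s ∈ ball 0 r)
    (hmax : ∀ᶠ z in 𝓝 z₀, ∀ S' : Finset ℂ,
      (∀ l ∈ S', l ∈ ball (0 : ℂ) r ∧ T (z + l • e) = 0) → S'.card ≤ S.card) :
    GoodSlice T e r z₀ := by
  -- small disjoint discs about the zeros
  obtain ⟨ρ, hρ, hρr, hρS⟩ : ∃ ρ > 0, (∀ s ∈ S, closedBall s ρ ⊆ ball 0 r) ∧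
      ∀ s ∈ S, ∀ s' ∈ S, s ≠ s' → ρ + ρ < dist s s' := by
    have h1 : ∀ᶠ ρ in 𝓝[>] (0 : ℝ), ∀ s ∈ S, closedBall s ρ ⊆ ball 0 r := by
      rw [Filter.eventually_all_finset]
      intro s hs
      have : 0 < r - dist s 0 := sub_pos.2 (hSr s hs)
      filter_upwards [nhdsWithin_le_nhds (eventually_lt_nhds this)] with ρ hρ
      exact closedBall_subset_ball' (by linarith)
    have h2 : ∀ᶠ ρ in 𝓝[>] (0 : ℝ), ∀ s ∈ S, ∀ s' ∈ S, s ≠ s' → ρ + ρ < dist s s' := by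
      rw [Filter.eventually_all_finset]
      intro s hs
      rw [Filter.eventually_all_finset]
      intro s' hs'
      by_cases hss : s = s'
      · simp [hss]
      have : 0 < dist s s' / 2 := by have := dist_pos.2 hss; positivity
      filter_upwards [nhdsWithin_le_nhds (eventually_lt_nhds this)] with ρ hρ _
      linarith
    obtain ⟨ρ, ⟨h3, h4⟩, h5⟩ := ((h1.and h2).and self_mem_nhdsWithin).exists
    exact ⟨ρ, h5, h3, h4⟩
  have hslice : ∀ s ∈ S, ∃ ε > 0, IsSlice T e s ρ (ball z₀ ε) := by
    intro s hs
    refine exists_isSlice_ball hρ (fun l hl => h.analytic z₀ hz₀ l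
      (ball_subset_closedBall (hρr s hs hl))) fun l hl h0 => ?_
    have hlS := (hS l (ball_subset_closedBall (hρr s hs (sphere_subset_closedBall hl)))).1 h0
    have hne : s ≠ l := by
      rintro rfl
      simp at hl
      exact hρ.ne hl
    have := hρS s hs l hlS hne
    rw [dist_comm, mem_sphere.1 hl] at this
    linarith
  choose! ε hε hsl using hslice
  -- This is the mean of the zeros in the small disc, weighted by multiplicity; a single distinct
  -- zero of any multiplicity equals its mean.
  set root : ℂ → V → ℂ := fun s z => slicePowerSum T e s ρ 1 z / slicePowerSum T e s ρ 0 z with hroot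
  have hsingle : ∀ s ∈ S, ∀ z ∈ ball z₀ (ε s), ∀ l ∈ ball s ρ,
      (∀ l' ∈ ball s ρ, T (z + l' • e) = 0 ↔ l' = l) →
        slicePowerSum T e s ρ 0 z ≠ 0 ∧ root s z = l := by
    intro s hs z hz l hl huniq
    obtain ⟨S', μ, h1, h2, h3⟩ := (hsl s hs).exists_zeros hz
    have hS' : S' = {l} := by
      ext l'
      rw [Finset.mem_singleton]
      constructor
      · intro hl'
        exact (huniq l' (h1 l' hl').1).1 ((h2 l' (ball_subset_closedBall (h1 l' hl').1)).2 hl')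
      · rintro rfl
        exact (h2 l' (ball_subset_closedBall hl)).1 ((huniq l' hl).2 rfl)
    have hμ : (μ l : ℂ) ≠ 0 := by
      exact_mod_cast (h1 l (by simp [hS'])).2.ne'
    simp only [hroot, h3, hS', Finset.sum_singleton, pow_zero, mul_one, pow_one]
    exact ⟨hμ, by field_simp⟩
  have hz₀s : ∀ s ∈ S, slicePowerSum T e s ρ 0 z₀ ≠ 0 ∧ root s z₀ = s := by
    intro s hs
    refine hsingle s hs z₀ (mem_ball_self (hε s hs)) s (mem_ball_self hρ) fun l' hl' => ?_
    rw [hS l' (ball_subset_closedBall (hρr s hs (ball_subset_closedBall hl')))]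
    constructor
    · intro hl'S
      by_contra hne
      have := hρS l' hl'S s hs hne
      have := mem_ball.1 hl'
      linarith
    · rintro rfl
      exact hs
  refine ⟨S, root, fun s hs => ⟨hSr s hs, ?_, (hz₀s s hs).2⟩, ?_⟩
  · exact ((hsl s hs).analyticAt_slicePowerSum 1 (mem_ball_self (hε s hs))).div
      ((hsl s hs).analyticAt_slicePowerSum 0 (mem_ball_self (hε s hs))) (hz₀s s hs).1
  have hpers : ∀ᶠ z in 𝓝 z₀, ∀ s ∈ S, ∃ l ∈ ball s ρ, T (z + l • e) = 0 := by
    rw [Filter.eventually_all_finset]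
    intro s hs
    exact (hsl s hs).eventually_exists_zero (mem_ball_self (hε s hs)) (mem_ball_self hρ)
      ((hS s (ball_subset_closedBall (hSr s hs))).2 hs)
  have hnear : ∀ᶠ z in 𝓝 z₀, ∀ s ∈ S, z ∈ ball z₀ (ε s) := by
    rw [Filter.eventually_all_finset]
    intro s hs
    exact ball_mem_nhds z₀ (hε s hs)
  filter_upwards [hmax, hpers, hnear] with z hzmax hzpers hznear
  choose! zero hzb hz0 using hzpers
  have hinj : Set.InjOn zero S := by
    intro s hs s' hs' heq
    by_contra hne
    have h1 := hρS s hs s' hs' hne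
    have h2 := mem_ball.1 (hzb s hs)
    have h3 := mem_ball.1 (hzb s' hs')
    rw [← heq] at h3
    have := dist_triangle_left s s' (zero s)
    linarith
  have hall : ∀ l ∈ ball (0 : ℂ) r, T (z + l • e) = 0 → ∃ s ∈ S, zero s = l := by
    intro l hl hl0
    by_contra! hno
    have hnot : l ∉ S.image zero := by
      simpa using hno
    -- A zero outside the small discs would make one more than the maximum.
    have := hzmax (insert l (S.image zero)) (by
      intro l' hl'
      rw [Finset.mem_insert, Finset.mem_image] at hl'
      rcases hl' with rfl | ⟨s, hs, rfl⟩
      · exact ⟨hl, hl0⟩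
      · exact ⟨hρr s hs (ball_subset_closedBall (hzb s hs)), hz0 s hs⟩)
    rw [Finset.card_insert_of_notMem hnot, Finset.card_image_of_injOn hinj] at this
    omega
  have hrootz : ∀ s ∈ S, root s z = zero s := by
    intro s hs
    refine (hsingle s hs z (hznear s hs) (zero s) (hzb s hs) fun l' hl' => ⟨fun h0 => ?_, ?_⟩).2
    · obtain ⟨s', hs', rfl⟩ := hall l' (hρr s hs (ball_subset_closedBall hl')) h0
      by_cases hss : s = s'
      · rw [hss]
      have h1 := hρS s hs s' hs' hss
      have h2 := mem_ball.1 hl'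
      have h3 := mem_ball.1 (hzb s' hs')
      have := dist_triangle_left s s' (zero s')
      linarith
    · rintro rfl
      exact hz0 s hs
  intro l hl
  constructor
  · intro h0
    obtain ⟨s, hs, rfl⟩ := hall l hl h0
    exact ⟨s, hs, hrootz s hs⟩
  · rintro ⟨s, hs, rfl⟩
    rw [hrootz s hs]
    exact hz0 s hs

/-- Off the zero set of a discriminant all slices are good. -/
theorem IsSlice.exists_discriminant {a : V} {ε : ℝ} (hε : 0 < ε)
    (h : IsSlice T e 0 r (ball a ε)) :
    ∃ ε' > 0, ε' ≤ ε ∧ ∃ δ : V → ℂ, AnalyticOnNhd ℂ δ (ball a ε') ∧ (∃ z ∈ ball a ε', δ z ≠ 0) ∧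
      (∀ z ∈ ball a ε', δ z ≠ 0 → GoodSlice T e r z) ∧
      ∃ K : ℕ, ∀ z ∈ ball a ε', ∀ S : Finset ℂ,
        (∀ l ∈ S, l ∈ ball (0 : ℂ) r ∧ T (z + l • e) = 0) → S.card ≤ K := by
  obtain ⟨K, hK⟩ := h.eventually_card_le (mem_ball_self hε)
  obtain ⟨ε₁, hε₁, hsub⟩ := Metric.mem_nhds_iff.1 hK
  set ε' := min ε ε₁ with hε'
  have hε'0 : 0 < ε' := lt_min hε hε₁
  have hK' : ∀ z ∈ ball a ε', ∀ S : Finset ℂ,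
      (∀ l ∈ S, l ∈ ball (0 : ℂ) r ∧ T (z + l • e) = 0) → S.card ≤ K :=
    fun z hz => hsub (ball_subset_ball (min_le_right _ _) hz)
  have h' : IsSlice T e 0 r (ball a ε') := h.mono isOpen_ball (ball_subset_ball (min_le_left _ _))
  set P : ℕ → Prop := fun k => ∃ z ∈ ball a ε', ∃ S : Finset ℂ, S.card = k ∧
    ∀ l ∈ S, l ∈ ball (0 : ℂ) r ∧ T (z + l • e) = 0 with hP
  classical
  -- The largest number of distinct zeros on a slice. The Hankel determinant of size `k` is nonzero
  -- exactly on the slices where it is attained.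
  set k := Nat.findGreatest P K with hk
  have hPk : P k := Nat.findGreatest_spec (P := P) (m := 0) (Nat.zero_le _)
    ⟨a, mem_ball_self hε'0, ∅, rfl, by simp⟩
  have hkmax : ∀ z ∈ ball a ε', ∀ S : Finset ℂ,
      (∀ l ∈ S, l ∈ ball (0 : ℂ) r ∧ T (z + l • e) = 0) → S.card ≤ k := fun z hz S hS =>
    Nat.le_findGreatest (hK' z hz S hS) ⟨z, hz, S, rfl, hS⟩
  set δ : V → ℂ := fun z =>
    (Matrix.of fun i j : Fin k => slicePowerSum T e 0 r ((i : ℕ) + j) z).det with hδ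
  have hδS : ∀ z ∈ ball a ε', ∃ S : Finset ℂ, (∀ s ∈ S, s ∈ ball 0 r) ∧
      (∀ l ∈ closedBall (0 : ℂ) r, T (z + l • e) = 0 ↔ l ∈ S) ∧ (δ z ≠ 0 ↔ S.card = k) := by
    intro z hz
    obtain ⟨S, μ, h1, h2, h3⟩ := h'.exists_zeros hz
    refine ⟨S, fun s hs => (h1 s hs).1, h2, ?_⟩
    simp only [hδ, h3]
    constructor
    · intro hne
      by_contra hcard
      have hle := hkmax z hz S fun l hl =>
        ⟨(h1 l hl).1, (h2 l (ball_subset_closedBall (h1 l hl).1)).2 hl⟩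
      exact hne (det_hankel_eq_zero S μ (lt_of_le_of_ne hle hcard))
    · exact det_hankel_ne_zero S μ fun s hs => (h1 s hs).2
  refine ⟨ε', hε'0, min_le_left _ _, δ, ?_, ?_, ?_, K, hK'⟩
  · intro z hz
    simp only [hδ, Matrix.det_apply']
    refine Finset.analyticAt_fun_sum _ fun σ _ => analyticAt_const.mul
      (Finset.analyticAt_fun_prod _ fun i _ => ?_)
    exact h'.analyticAt_slicePowerSum _ hz
  · obtain ⟨z, hz, S, hSk, hS⟩ := hPk
    refine ⟨z, hz, ?_⟩
    obtain ⟨S', h1, h2, h3⟩ := hδS z hz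
    rw [h3]
    refine le_antisymm (hkmax z hz S' fun l hl =>
      ⟨h1 l hl, (h2 l (ball_subset_closedBall (h1 l hl))).2 hl⟩) ?_
    rw [← hSk]
    exact Finset.card_le_card fun l hl => (h2 l (ball_subset_closedBall (hS l hl).1)).1 (hS l hl).2
  · intro z hz hne
    obtain ⟨S, h1, h2, h3⟩ := hδS z hz
    refine h'.goodSlice_of_max hz S h2 h1 ?_
    filter_upwards [isOpen_ball.mem_nhds hz] with w hw S' hS'
    rw [h3.1 hne]
    exact hkmax w hw S' hS'

end Slices

/-! ### Riemann extension across hypersurfaces -/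

section Extension

open Metric Set Filter Asymptotics

variable {V : Type*} [NormedAddCommGroup V] [NormedSpace ℂ V]

/-- Near `b` the zero set of `T` is a smooth hypersurface through `b`. -/
def IsGoodPoint (T : V → ℂ) (b : V) : Prop :=
  ∃ v : V → ℂ, AnalyticAt ℂ v b ∧ v b = 0 ∧ fderiv ℂ v b ≠ 0 ∧ ∀ᶠ y in 𝓝 b, T y = 0 ↔ v y = 0

/-- Near the point the zero set is the graph of one root over the slice parameter. The equation
`root s (y - s • e) - s` is transverse to `e`: advancing by `t` along `e` lowers the slice
coordinate of a fixed zero by `t`. -/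
theorem GoodSlice.isGoodPoint {T : V → ℂ} {e z₀ : V} {r : ℝ} (h : GoodSlice T e r z₀) {l : ℂ}
    (hl : l ∈ ball (0 : ℂ) r) (hl0 : T (z₀ + l • e) = 0) : IsGoodPoint T (z₀ + l • e) := by
  obtain ⟨S, root, hS, hev⟩ := h
  obtain ⟨s, hs, hsl⟩ := (hev.self_of_nhds l hl).1 hl0
  obtain rfl : s = l := (hS s hs).2.2.symm.trans hsl
  -- the other roots stay away from `s`
  have hsep : ∀ᶠ q : V × ℂ in 𝓝 (z₀, s), ∀ s' ∈ S, root s' q.1 = q.2 → s' = s := by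
    rw [Filter.eventually_all_finset]
    intro s' hs'
    by_cases hss : s' = s
    · simp [hss]
    have hc : ContinuousAt (fun q : V × ℂ => root s' q.1 - q.2) (z₀, s) := by
      refine ContinuousAt.sub ?_ continuousAt_snd
      exact ContinuousAt.comp (f := Prod.fst) (hS s' hs').2.1.continuousAt continuousAt_fst
    have hne : (fun q : V × ℂ => root s' q.1 - q.2) (z₀, s) ≠ 0 := by
      simpa [(hS s' hs').2.2, sub_eq_zero] using hss
    filter_upwards [hc.eventually_ne hne] with q hq heq
    exact absurd (sub_eq_zero.2 heq) hq
  set b := z₀ + s • e with hb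
  set v : V → ℂ := fun y => root s (y - s • e) - s with hv
  have hbz : b - s • e = z₀ := by simp [hb]
  have hsub : AnalyticAt ℂ (fun y : V => y - s • e) b := analyticAt_id.sub analyticAt_const
  have hvan : AnalyticAt ℂ v b :=
    (AnalyticAt.fun_comp_of_eq (hS s hs).2.1 hsub hbz).sub analyticAt_const
  refine ⟨v, hvan, by simp [hv, hbz, (hS s hs).2.2], ?_, ?_⟩
  · -- the derivative of the root along `e` is `-1`
    have hline : ∀ᶠ t : ℂ in 𝓝 0, v (b + t • e) = -t := by
      have hc1 : Tendsto (fun t : ℂ => z₀ + t • e) (𝓝 0) (𝓝 z₀) :=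
        Continuous.tendsto' (by fun_prop) _ _ (by simp)
      have hc3 : Tendsto (fun t : ℂ => s - t) (𝓝 0) (𝓝 s) :=
        Continuous.tendsto' (by fun_prop) _ _ (by simp)
      filter_upwards [hc1.eventually hev, (hc1.prodMk_nhds hc3).eventually hsep,
        hc3.eventually (isOpen_ball.mem_nhds hl)] with t h1 h2 h3
      have heq : z₀ + t • e + (s - t) • e = z₀ + s • e := by rw [sub_smul]; abel
      obtain ⟨s', hs', hs'r⟩ := (h1 (s - t) h3).1 (by rw [heq]; exact hl0)
      obtain rfl := h2 s' hs' hs'r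
      have : b + t • e - s' • e = z₀ + t • e := by simp only [hb]; abel
      simp only [hv, this, hs'r]
      ring
    intro h0
    have hb0 : AnalyticAt ℂ v (b + (0 : ℂ) • e) := by simpa using hvan
    have h1 := (hasDerivAt_slice hb0).deriv
    rw [EventuallyEq.deriv_eq hline] at h1
    simp [h0] at h1
  · have hc1 : Tendsto (fun y : V => y - s • e) (𝓝 b) (𝓝 z₀) :=
      Continuous.tendsto' (by fun_prop) _ _ hbz
    filter_upwards [hc1.eventually hev,
      (hc1.prodMk_nhds (tendsto_const_nhds (x := s))).eventually hsep] with y h1 h2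
    have hy := h1 s hl
    rw [sub_add_cancel] at hy
    rw [hy, hv]
    constructor
    · rintro ⟨s', hs', heq⟩
      obtain rfl := h2 s' hs' heq
      simp [heq]
    · intro h0
      exact ⟨s, hs, sub_eq_zero.1 h0⟩

/-- The complement of the zero set of `T` is dense near `a`. -/
theorem eventually_frequently_ne {T : V → ℂ} {a : V} (hT : AnalyticAt ℂ T a)
    (hne : ¬ ∀ᶠ z in 𝓝 a, T z = 0) : ∀ᶠ z in 𝓝 a, ∃ᶠ w in 𝓝 z, T w ≠ 0 := by
  obtain ⟨ε, hε, hball⟩ := hT.exists_ball_analyticOnNhd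
  filter_upwards [ball_mem_nhds a hε] with z hz hev
  refine hne ?_
  filter_upwards [ball_mem_nhds a hε] with w hw
  exact hball.eqOn_zero_of_preconnected_of_eventuallyEq_zero (convex_ball a ε).isPreconnected hz
    (by filter_upwards [hev] with y hy; simpa using hy) hw

/-- Functions which agree off the zero set of `T` agree. -/
theorem eventually_eq_of_eq_off {T F G : V → ℂ} {a : V} (hT : AnalyticAt ℂ T a)
    (hne : ¬ ∀ᶠ z in 𝓝 a, T z = 0) (hF : AnalyticAt ℂ F a) (hG : AnalyticAt ℂ G a)
    (h : ∀ᶠ z in 𝓝 a, T z ≠ 0 → F z = G z) : ∀ᶠ z in 𝓝 a, F z = G z := by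
  filter_upwards [eventually_frequently_ne hT hne, hF.eventually_analyticAt,
    hG.eventually_analyticAt, h.eventually_nhds] with z h1 h2 h3 h4
  refine tendsto_nhds_unique_of_frequently_eq h2.continuousAt h3.continuousAt ?_
  exact (h1.and_eventually h4).mono fun w hw => hw.2 hw.1

/-- Extension of functions across hypersurfaces, on the slices. -/
theorem IsSlice.exists_extension {T s : V → ℂ} {e : V} {r : ℝ} {U G : Set V}
    (h : IsSlice T e 0 r U)
    (hs : ∀ z ∈ U, ∀ l ∈ closedBall (0 : ℂ) r, T (z + l • e) ≠ 0 → AnalyticAt ℂ s (z + l • e))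
    (hG : ∀ z ∈ U, ∃ᶠ w in 𝓝 z, w ∈ G ∧ T w ≠ 0)
    (hb : ∀ z ∈ U, z ∈ G → ∀ l ∈ ball (0 : ℂ) r, T (z + l • e) = 0 →
      s =O[𝓝[{y | T y ≠ 0}] (z + l • e)] fun _ => (1 : ℂ)) :
    ∃ s' : V → ℂ, AnalyticOnNhd ℂ s' U ∧ ∀ z ∈ U, T z ≠ 0 → s' z = s z := by
  -- Only the values of `s` on the boundary circle enter, where `T` does not vanish, so this is
  -- holomorphic whatever happens inside the disc.
  set s' : V → ℂ := fun z => (2 * Real.pi * Complex.I)⁻¹ *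
    ∮ l in C(0, r), (l - 0)⁻¹ * s (z + l • e) with hs'
  have han : AnalyticOnNhd ℂ s' U := by
    intro z hz
    refine analyticAt_const.mul (analyticAt_circleIntegral
      (g := fun q : V × ℂ => (q.2 - 0)⁻¹ * s (q.1 + q.2 • e)) h.pos.le fun l hl => ?_)
    have hl0 : l - 0 ≠ 0 := by
      intro h0
      rw [sub_zero] at h0
      rw [h0, mem_sphere, dist_self] at hl
      exact h.pos.ne hl
    have h2 : AnalyticAt ℂ (fun q : V × ℂ => (q.2 - 0)⁻¹) (z, l) :=
      (analyticAt_snd.sub analyticAt_const).inv hl0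
    exact h2.mul (analyticAt_comp_slice
      (hs z hz l (sphere_subset_closedBall hl) (h.ne_zero z hz l hl)))
  refine ⟨s', han, fun z hz hTz => ?_⟩
  -- For `w ∈ G` the singularities of `s` on the slice are bounded, hence removable, and Cauchy's
  -- formula holds at the centre. The other `z` follow by density.
  have hkey : ∀ w ∈ U, w ∈ G → T w ≠ 0 → s' w = s w := by
    intro w hw hwG hTw
    obtain ⟨S, μ, h1, h2, -⟩ := h.exists_zeros hw
    set Ω : Set ℂ := {l | l ∉ S → AnalyticAt ℂ s (w + l • e)} with hΩ
    have hlc : ∀ l : ℂ, ContinuousAt (fun l : ℂ => w + l • e) l := fun l => by fun_prop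
    have hTl : ∀ l ∈ closedBall (0 : ℂ) r, ∀ᶠ m in 𝓝[≠] l, T (w + m • e) ≠ 0 := by
      intro l hl
      rcases (h.analyticOnNhd hw l hl).eventually_eq_zero_or_eventually_ne_zero with h' | h'
      · refine absurd ((h.analyticOnNhd hw).eqOn_zero_of_preconnected_of_eventuallyEq_zero
          (convex_closedBall _ _).isPreconnected hl h' (mem_closedBall_self h.pos.le)) ?_
        simpa using hTw
      · exact h'
    have hsub : closedBall (0 : ℂ) r ⊆ interior Ω := by
      intro l hl
      rw [mem_interior_iff_mem_nhds]
      by_cases hlS : l ∈ S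
      · filter_upwards [isOpen_ball.mem_nhds (h1 l hlS).1] with m hm hmS
        exact hs w hw m (ball_subset_closedBall hm)
          (fun h0 => hmS ((h2 m (ball_subset_closedBall hm)).1 h0))
      · have hTl0 : T (w + l • e) ≠ 0 := fun h0 => hlS ((h2 l hl).1 h0)
        filter_upwards [(hlc l).eventually (hs w hw l hl hTl0).eventually_analyticAt] with m hm _
        exact hm
    have hint := circleIntegral_div_eq_of_removable h.pos isOpen_interior hsub S
      (fun l hl hsph => h.ne_zero w hw l hsph
        ((h2 l (sphere_subset_closedBall hsph)).2 hl))
      (φ := fun l : ℂ => s (w + l • e))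
      (fun l hl hlS => (analyticAt_comp_line (interior_subset hl hlS)).differentiableAt)
      (fun l hlS _ => by
        have hlb := (h1 l hlS).1
        have hlc' := ball_subset_closedBall hlb
        refine (hb w hw hwG l hlb ((h2 l hlc').2 hlS)).comp_tendsto ?_
        exact tendsto_nhdsWithin_iff.2 ⟨(hlc l).tendsto.mono_left nhdsWithin_le_nhds, hTl l hlc'⟩)
      (w := 0) (mem_ball_self h.pos)
      (fun h0 => hTw (by simpa using (h2 0 (mem_closedBall_self h.pos.le)).2 h0))
    simp only [hs', hint, zero_smul, add_zero, inv_mul_cancel_left₀ two_pi_I_ne]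
  have hsz : AnalyticAt ℂ s z := by
    simpa using hs z hz 0 (mem_closedBall_self h.pos.le) (by simpa using hTz)
  refine tendsto_nhds_unique_of_frequently_eq (han z hz).continuousAt hsz.continuousAt ?_
  exact ((hG z hz).and_eventually (h.isOpen.mem_nhds hz)).mono fun w hw =>
    hkey w hw.2 hw.1.1 hw.1.2

/-- Small slices of a function that does not vanish identically, with a dense set of good
slices. -/
theorem exists_slice_discriminant {T : V → ℂ} {a e : V} (hT : AnalyticAt ℂ T a)
    (he : ∀ᶠ l in 𝓝[≠] (0 : ℂ), T (a + l • e) ≠ 0) {N : Set V} (hN : N ∈ 𝓝 a) :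
    ∃ r > 0, ∃ ε > 0, IsSlice T e 0 r (ball a ε) ∧
      (∀ z ∈ ball a ε, ∀ l ∈ closedBall (0 : ℂ) r, z + l • e ∈ N) ∧
      ∃ δ : V → ℂ, AnalyticOnNhd ℂ δ (ball a ε) ∧
        (∀ z ∈ ball a ε, ∃ᶠ w in 𝓝 z, δ w ≠ 0) ∧
        (∀ z ∈ ball a ε, δ z ≠ 0 → GoodSlice T e r z) ∧
        ∃ K : ℕ, ∀ z ∈ ball a ε, ∀ S : Finset ℂ,
          (∀ l ∈ S, l ∈ ball (0 : ℂ) r ∧ T (z + l • e) = 0) → S.card ≤ K := by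
  obtain ⟨η, hη, hηN⟩ := Metric.mem_nhds_iff.1 hN
  have hr₀ : 0 < η / 2 / (‖e‖ + 1) := by positivity
  obtain ⟨r, hr, hrr₀, ε₁, hε₁, hsl⟩ := exists_isSlice_of_direction hT he hr₀
  have hε₂ : 0 < min ε₁ (η / 2) := lt_min hε₁ (by positivity)
  obtain ⟨ε, hε, hεle, δ, hδ, hδne, hgood, K, hK⟩ := (hsl.mono (U' := ball a (min ε₁ (η / 2)))
    isOpen_ball (ball_subset_ball (min_le_left _ _))).exists_discriminant hε₂
  refine ⟨r, hr, ε, hε, hsl.mono isOpen_ball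
    (ball_subset_ball (hεle.trans (min_le_left _ _))), fun z hz l hl => hηN ?_, δ, hδ, ?_, hgood,
    K, hK⟩
  · rw [mem_ball, dist_eq_norm]
    have h1 : ‖z - a‖ < η / 2 := by
      rw [← dist_eq_norm]
      exact (mem_ball.1 hz).trans_le (hεle.trans (min_le_right _ _))
    have h2 : ‖l • e‖ ≤ η / 2 := by
      rw [norm_smul]
      have hl' : ‖l‖ ≤ η / 2 / (‖e‖ + 1) := by
        rw [mem_closedBall, dist_zero_right] at hl
        exact hl.trans hrr₀.le
      calc ‖l‖ * ‖e‖ ≤ η / 2 / (‖e‖ + 1) * (‖e‖ + 1) := by gcongr; linarith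
        _ = η / 2 := by field_simp
    calc ‖z + l • e - a‖ = ‖(z - a) + l • e‖ := by congr 1; abel
      _ ≤ ‖z - a‖ + ‖l • e‖ := norm_add_le _ _
      _ < η := by linarith
  · intro z hz hev
    obtain ⟨w, hw, hw0⟩ := hδne
    exact hw0 (hδ.eqOn_zero_of_preconnected_of_eventuallyEq_zero (convex_ball a ε).isPreconnected
      hz (by filter_upwards [hev] with y hy; simpa using hy) hw)

theorem frequently_and_ne {T δ : V → ℂ} {z : V} (hδ : AnalyticAt ℂ δ z)
    (hTne : ∀ᶠ y in 𝓝 z, ∃ᶠ w in 𝓝 y, T w ≠ 0) (hδne : ∃ᶠ w in 𝓝 z, δ w ≠ 0) :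
    ∃ᶠ w in 𝓝 z, δ w ≠ 0 ∧ T w ≠ 0 := by
  have h1 : ∃ᶠ y in 𝓝 z, ∃ᶠ w in 𝓝 y, δ w ≠ 0 ∧ T w ≠ 0 := by
    refine ((hδne.and_eventually hTne).and_eventually hδ.eventually_analyticAt).mono
      fun y hy => ?_
    exact (hy.1.2.and_eventually (hy.2.continuousAt.eventually_ne hy.1.1)).mono fun w hw =>
      ⟨hw.2, hw.1⟩
  exact frequently_frequently_nhds.1 h1

/-- A function which is holomorphic off a hypersurface and locally bounded near the smooth
points of the hypersurface extends. -/
theorem exists_analytic_extension {T s : V → ℂ} {a : V} (hT : AnalyticAt ℂ T a)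
    (hne : ¬ ∀ᶠ z in 𝓝 a, T z = 0) (hs : ∀ᶠ z in 𝓝 a, T z ≠ 0 → AnalyticAt ℂ s z)
    (hb : ∀ᶠ z in 𝓝 a, T z = 0 → IsGoodPoint T z →
      s =O[𝓝[{y | T y ≠ 0}] z] fun _ => (1 : ℂ)) :
    ∃ s' : V → ℂ, AnalyticAt ℂ s' a ∧ ∀ᶠ z in 𝓝 a, T z ≠ 0 → s' z = s z := by
  obtain ⟨e, he⟩ := exists_direction hT hne
  obtain ⟨r, hr, ε, hε, hsl, hN, δ, hδ, hδne, hgood, -⟩ :=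
    exists_slice_discriminant hT he
      (hs.and (hb.and (eventually_frequently_ne hT hne).eventually_nhds))
  have hz0 : ∀ z ∈ ball a ε, z + (0 : ℂ) • e = z := fun z _ => by simp
  -- Slices with `δ ≠ 0` meet the zero set only in smooth points, where boundedness is assumed;
  -- singular points can occur only on slices with `δ = 0`.
  obtain ⟨s', h1, h2⟩ := hsl.exists_extension (s := s) (G := {z | δ z ≠ 0})
    (fun z hz l hl => (hN z hz l hl).1)
    (fun z hz => by
      have h0 := (hN z hz 0 (mem_closedBall_self hr.le)).2.2
      rw [hz0 z hz] at h0
      exact frequently_and_ne (hδ z hz) h0 (hδne z hz))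
    (fun z hz hzG l hl hl0 => (hN z hz l (ball_subset_closedBall hl)).2.1 hl0
      ((hgood z hz hzG).isGoodPoint hl hl0))
  exact ⟨s', h1 a (mem_ball_self hε), by filter_upwards [ball_mem_nhds a hε] with z hz using h2 z hz⟩

/-- Divisibility of germs may be tested at the smooth points of a hypersurface containing the
zeros of the divisor. -/
theorem exists_eq_mul_of_isBigO {T F G : V → ℂ} {a : V} (hT : AnalyticAt ℂ T a)
    (hne : ¬ ∀ᶠ z in 𝓝 a, T z = 0) (hF : AnalyticAt ℂ F a) (hG : AnalyticAt ℂ G a)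
    (hFT : ∀ᶠ z in 𝓝 a, F z = 0 → T z = 0)
    (hb : ∀ᶠ z in 𝓝 a, T z = 0 → IsGoodPoint T z → G =O[𝓝 z] F) :
    ∃ Q : V → ℂ, AnalyticAt ℂ Q a ∧ ∀ᶠ z in 𝓝 a, G z = Q z * F z := by
  obtain ⟨Q, hQ, hQe⟩ := exists_analytic_extension (s := fun z => G z / F z) hT hne
    (by
      filter_upwards [hF.eventually_analyticAt, hG.eventually_analyticAt, hFT] with z h1 h2 h3 h4
      exact h2.div h1 fun h => h4 (h3 h))
    (by
      filter_upwards [hb, hFT.eventually_nhds] with z h1 h2 h3 h4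
      have h5 := (h1 h3 h4).mono (nhdsWithin_le_nhds (s := {y | T y ≠ 0}))
      obtain ⟨C, hC⟩ := h5.bound
      refine IsBigO.of_bound C ?_
      filter_upwards [hC, nhdsWithin_le_nhds h2, self_mem_nhdsWithin] with w hw hw2 hw3
      have hFw : F w ≠ 0 := fun h => hw3 (hw2 h)
      rw [norm_div, norm_one, mul_one, div_le_iff₀ (norm_pos_iff.2 hFw)]
      exact hw)
  refine ⟨Q, hQ, eventually_eq_of_eq_off hT hne hG (hQ.mul hF) ?_⟩
  filter_upwards [hQe, hFT] with z h1 h2 h3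
  have hF0 : F z ≠ 0 := fun h => h3 (h2 h)
  change G z = Q z * F z
  rw [h1 h3, div_mul_cancel₀ _ hF0]

end Extension

/-! ### Orders of vanishing along a coordinate hyperplane -/

section Coordinates

open Metric Set Filter Asymptotics

variable {n : ℕ}

theorem analyticAt_coord (i : Fin n) (b : Model n) : AnalyticAt ℂ (fun z : Model n => z i) b :=
  (ContinuousLinearMap.proj (R := ℂ) (φ := fun _ : Fin n => ℂ) i).analyticAt b

theorem not_eventually_coord_eq_zero (i : Fin n) (b : Model n) :
    ¬ ∀ᶠ z : Model n in 𝓝 b, z i = 0 := by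
  intro h
  have hc : Tendsto (fun t : ℂ => b + t • Pi.single i (1 : ℂ)) (𝓝 0) (𝓝 b) :=
    Continuous.tendsto' (by fun_prop) _ _ (by simp)
  have h1 := hc.eventually h
  have h2 : ∀ᶠ t : ℂ in 𝓝[≠] 0, b i + t = 0 := by
    filter_upwards [nhdsWithin_le_nhds h1] with t ht
    simpa using ht
  have h3 : ∀ᶠ t : ℂ in 𝓝[≠] 0, t ≠ 0 := self_mem_nhdsWithin
  have h0 : b i = 0 := by simpa using h1.self_of_nhds
  obtain ⟨t, ht, ht0⟩ := (h2.and h3).exists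
  exact ht0 (by simpa [h0] using ht)

/-- A function vanishing on a coordinate hyperplane is bounded by the coordinate. -/
theorem isBigO_coord {g : Model n → ℂ} {b : Model n} {i : Fin n} (hg : AnalyticAt ℂ g b)
    (hbi : b i = 0) (h0 : ∀ᶠ z in 𝓝 b, z i = 0 → g z = 0) : g =O[𝓝 b] fun z => z i := by
  -- Compare `y` with its projection to the hyperplane: `g` vanishes there, and the distance is `‖y
  -- i‖`.
  obtain ⟨K, s, hs, hK⟩ := (hg.contDiffAt (n := 1)).exists_lipschitzOnWith
  have hc : Tendsto (fun y : Model n => Function.update y i 0) (𝓝 b) (𝓝 b) := by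
    refine Continuous.tendsto' (continuous_id.update i continuous_const) _ _ ?_
    rw [← hbi]
    exact Function.update_eq_self i b
  refine IsBigO.of_bound K ?_
  filter_upwards [hs, hc.eventually hs, hc.eventually h0] with y h1 h2 h3
  have h4 := hK.dist_le_mul y h1 _ h2
  rw [h3 (by simp), dist_zero_right] at h4
  refine h4.trans ?_
  gcongr
  rw [dist_pi_le_iff (norm_nonneg _)]
  intro j
  rcases eq_or_ne j i with rfl | hj
  · simp
  · simp [Function.update_of_ne hj]

/-- A function vanishing on a coordinate hyperplane is divisible by the coordinate. -/
theorem exists_eq_coord_mul {g : Model n → ℂ} {b : Model n} {i : Fin n} (hg : AnalyticAt ℂ g b)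
    (h0 : ∀ᶠ z in 𝓝 b, z i = 0 → g z = 0) :
    ∃ q : Model n → ℂ, AnalyticAt ℂ q b ∧ ∀ᶠ z in 𝓝 b, g z = q z * z i := by
  refine exists_eq_mul_of_isBigO (analyticAt_coord i b) (not_eventually_coord_eq_zero i b)
    (analyticAt_coord i b) hg (Eventually.of_forall fun _ h => h) ?_
  filter_upwards [h0.eventually_nhds, hg.eventually_analyticAt] with z h1 h2 h3 _
  exact isBigO_coord h2 h3 h1

/-- Take the largest power of `z i` dividing `h`. It exists because the order of `h` along a line
through `b` on which `h` is not identically zero bounds the exponents; if the cofactor vanished on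
the hyperplane, one more factor could be split off. -/
theorem exists_eq_coord_pow_mul {h : Model n → ℂ} {b : Model n} {i : Fin n}
    (hh : AnalyticAt ℂ h b) (hne : ¬ ∀ᶠ z in 𝓝 b, h z = 0) (hbi : b i = 0) :
    ∃ (s : ℕ) (c : Model n → ℂ), AnalyticAt ℂ c b ∧ (∀ᶠ z in 𝓝 b, h z = z i ^ s * c z) ∧
      ∃ᶠ z in 𝓝 b, z i = 0 ∧ c z ≠ 0 := by
  classical
  obtain ⟨e, he⟩ := exists_direction hh hne
  have hb0 : AnalyticAt ℂ h (b + (0 : ℂ) • e) := by simpa using hh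
  have hne0 : ¬ ∀ᶠ l : ℂ in 𝓝 0, h (b + l • e) = 0 := fun hev => by
    obtain ⟨l, h1, h2⟩ := (he.and (nhdsWithin_le_nhds hev)).exists
    exact h1 h2
  obtain ⟨d, u, hu, hu0, hue⟩ :=
    (analyticAt_comp_line hb0).exists_eventuallyEq_pow_smul_nonzero_iff.2 hne0
  set P : ℕ → Prop := fun s => ∃ c : Model n → ℂ, AnalyticAt ℂ c b ∧
    ∀ᶠ z in 𝓝 b, h z = z i ^ s * c z with hP
  have hPd : ∀ s, P s → s ≤ d := by
    rintro s ⟨c, hc, hce⟩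
    by_contra! hlt
    have hline : Tendsto (fun l : ℂ => b + l • e) (𝓝 0) (𝓝 b) :=
      Continuous.tendsto' (by fun_prop) _ _ (by simp)
    have h1 : ∀ᶠ l : ℂ in 𝓝[≠] 0, u l = l ^ (s - d) * (e i ^ s * c (b + l • e)) := by
      filter_upwards [nhdsWithin_le_nhds hue, nhdsWithin_le_nhds (hline.eventually hce),
        self_mem_nhdsWithin] with l h1 h2 h3
      have hl : (l : ℂ) ≠ 0 := h3
      have h4 : l ^ s = l ^ d * l ^ (s - d) := by rw [← pow_add]; congr 1; omega
      rw [h1, sub_zero, smul_eq_mul] at h2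
      simp only [Pi.add_apply, Pi.smul_apply, hbi, zero_add, smul_eq_mul, mul_pow] at h2
      rw [h4] at h2
      have hd : l ^ d ≠ 0 := pow_ne_zero _ hl
      apply mul_left_cancel₀ hd
      rw [h2]
      ring
    have hlim1 : Tendsto u (𝓝[≠] 0) (𝓝 (u 0)) :=
      hu.continuousAt.tendsto.mono_left nhdsWithin_le_nhds
    have hlim2 : Tendsto (fun l : ℂ => l ^ (s - d) * (e i ^ s * c (b + l • e))) (𝓝[≠] 0)
        (𝓝 (0 ^ (s - d) * (e i ^ s * c b))) := by
      refine Tendsto.mul ?_ ((hc.continuousAt.tendsto.comp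
        (hline.mono_left nhdsWithin_le_nhds)).const_mul _)
      exact ((continuous_pow (s - d)).tendsto 0).mono_left nhdsWithin_le_nhds
    rw [zero_pow (by omega), zero_mul] at hlim2
    exact hu0 (tendsto_nhds_unique (hlim1.congr' h1) hlim2)
  set s := Nat.findGreatest P d with hs
  obtain ⟨c, hc, hce⟩ : P s := Nat.findGreatest_spec (P := P) (m := 0) (Nat.zero_le _)
    ⟨h, hh, Eventually.of_forall fun z => by simp⟩
  refine ⟨s, c, hc, hce, ?_⟩
  by_contra hfr
  rw [not_frequently] at hfr
  obtain ⟨q, hq, hqe⟩ := exists_eq_coord_mul (i := i) hc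
    (by filter_upwards [hfr] with z hz hzi; by_contra h; exact hz ⟨hzi, h⟩)
  have hPs : P (s + 1) := ⟨q, hq, by
    filter_upwards [hce, hqe] with z h1 h2
    rw [h1, h2, pow_succ]; ring⟩
  have := Nat.le_findGreatest (hPd _ hPs) hPs
  omega

/-- A function whose zeros lie on a coordinate hyperplane, but not all of it, has no zeros. -/
theorem ne_zero_of_zeros_subset_coord {c : Model n → ℂ} {b : Model n} {i : Fin n}
    (hc : AnalyticAt ℂ c b) (hzero : ∀ᶠ z in 𝓝 b, c z = 0 → z i = 0)
    (hfr : ∃ᶠ z in 𝓝 b, z i = 0 ∧ c z ≠ 0) : c b ≠ 0 := by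
  intro hcb
  set e : Model n := Pi.single i 1 with he
  have hbi : b i = 0 := hzero.self_of_nhds hcb
  have hline : Tendsto (fun l : ℂ => b + l • e) (𝓝 0) (𝓝 b) :=
    Continuous.tendsto' (by fun_prop) _ _ (by simp)
  have hdir : ∀ᶠ l : ℂ in 𝓝[≠] 0, c (b + l • e) ≠ 0 := by
    filter_upwards [nhdsWithin_le_nhds (hline.eventually hzero), self_mem_nhdsWithin]
      with l h1 h2 h3
    have := h1 h3
    simp [he, hbi] at this
    exact h2 this
  obtain ⟨r, hr, ε, hε, hsl, hN, -⟩ := exists_slice_discriminant hc hdir hzero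
  -- By Hurwitz, a zero at `b` persists on every line parallel to the `i`-th axis near `b`. If the
  -- line starts at a point of the hyperplane, the zero can only be that point, contrary to the
  -- choice of a point with `c z ≠ 0`.
  have hpers := hsl.eventually_exists_zero (mem_ball_self hε) (mem_ball_self hr) (by simpa using hcb)
  obtain ⟨z, ⟨hzi, hcz⟩, ⟨l, hl, hl0⟩, hz⟩ :=
    (hfr.and_eventually (hpers.and (ball_mem_nhds b hε))).exists
  have h1 := hN z hz l (ball_subset_closedBall hl) hl0
  simp [he, hzi] at h1
  rw [h1] at hl0
  exact hcz (by simpa using hl0)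

end Coordinates

/-! ### Passing between a manifold and its charts -/

section ChartNeighbourhoods

open Filter

variable {n : ℕ} {X : Type*} [TopologicalSpace X] {φ : OpenPartialHomeomorph X (Model n)} {a : X}

theorem eventually_chart_iff (ha : a ∈ φ.source) {p : X → Prop} :
    (∀ᶠ z in 𝓝 (φ a), p (φ.symm z)) ↔ ∀ᶠ x in 𝓝 a, p x := by
  rw [← φ.map_nhds_eq ha, eventually_map]
  refine eventually_congr ?_
  filter_upwards [φ.open_source.mem_nhds ha] with x hx
  rw [φ.left_inv hx]

theorem eventually_comp_chart_iff (ha : a ∈ φ.source) {p : Model n → Prop} :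
    (∀ᶠ x in 𝓝 a, p (φ x)) ↔ ∀ᶠ z in 𝓝 (φ a), p z := by
  rw [← φ.map_nhds_eq ha, eventually_map]

end ChartNeighbourhoods

section Charts

open Set Filter

variable {n : ℕ} {X : Type*} [TopologicalSpace X] [ChartedSpace (Model n) X]

variable {φ : OpenPartialHomeomorph X (Model n)} {a : X}

theorem contMDiffAt_chart [IsManifold 𝓘(ℂ, Model n) ω X] (hφ : φ ∈ holCharts n X)
    (ha : a ∈ φ.source) : ContMDiffAt 𝓘(ℂ, Model n) 𝓘(ℂ, Model n) ω φ a :=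
  contMDiffAt_of_mem_maximalAtlas hφ ha

theorem contMDiffAt_chart_symm [IsManifold 𝓘(ℂ, Model n) ω X] (hφ : φ ∈ holCharts n X)
    {b : Model n} (hb : b ∈ φ.target) :
    ContMDiffAt 𝓘(ℂ, Model n) 𝓘(ℂ, Model n) ω φ.symm b :=
  contMDiffAt_symm_of_mem_maximalAtlas hφ hb

theorem contMDiffAt_model_iff {k : ℕ} {h : Model k → Model n} {b : Model k} :
    ContMDiffAt 𝓘(ℂ, Model k) 𝓘(ℂ, Model n) ω h b ↔ AnalyticAt ℂ h b := by
  rw [contMDiffAt_iff_contDiffAt]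
  exact ⟨fun h => h.analyticAt, fun h => h.contDiffAt⟩

theorem holAt_model_iff {h : Model n → ℂ} {b : Model n} :
    HolAt n h b ↔ AnalyticAt ℂ h b := by
  rw [HolAt, contMDiffAt_iff_contDiffAt]
  exact ⟨fun h => h.analyticAt, fun h => h.contDiffAt⟩

variable [IsManifold 𝓘(ℂ, Model n) ω X]

theorem HolAt.comp_chart_symm {h : X → ℂ} (hφ : φ ∈ holCharts n X) {b : Model n}
    (hb : b ∈ φ.target) (hh : HolAt n h (φ.symm b)) :
    AnalyticAt ℂ (h ∘ φ.symm) b :=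
  holAt_model_iff.1 (ContMDiffAt.comp b hh (contMDiffAt_chart_symm hφ hb))

theorem HolAt.analyticAt {h : X → ℂ} (hh : HolAt n h a) (hφ : φ ∈ holCharts n X)
    (ha : a ∈ φ.source) : AnalyticAt ℂ (h ∘ φ.symm) (φ a) :=
  HolAt.comp_chart_symm hφ (φ.map_source ha) (by rwa [φ.left_inv ha])

theorem holAt_comp_chart {g : Model n → ℂ} (hφ : φ ∈ holCharts n X) (ha : a ∈ φ.source)
    (hg : AnalyticAt ℂ g (φ a)) : HolAt n (g ∘ φ) a :=
  ContMDiffAt.comp a (holAt_model_iff.2 hg) (contMDiffAt_chart hφ ha)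

theorem holAt_iff (hφ : φ ∈ holCharts n X) (ha : a ∈ φ.source) {h : X → ℂ} :
    HolAt n h a ↔ AnalyticAt ℂ (h ∘ φ.symm) (φ a) := by
  refine ⟨fun hh => hh.analyticAt hφ ha, fun hh => ?_⟩
  refine (holAt_comp_chart hφ ha hh).congr_of_eventuallyEq ?_
  filter_upwards [φ.open_source.mem_nhds ha] with x hx
  simp [φ.left_inv hx]

theorem holAt_coord (hφ : φ ∈ holCharts n X) (ha : a ∈ φ.source) (i : Fin n) :
    HolAt n (fun x => φ x i) a :=
  holAt_comp_chart (g := fun z => z i) hφ ha (analyticAt_coord i _)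

end Charts

section ChartNonvanishing

open Filter

variable {n : ℕ} {X : Type*} [TopologicalSpace X] {a : X} {φ : OpenPartialHomeomorph X (Model n)}

theorem not_eventually_comp_chart_symm (ha : a ∈ φ.source)
    {h : X → ℂ} (hne : ¬ ∀ᶠ z in 𝓝 a, h z = 0) : ¬ ∀ᶠ z in 𝓝 (φ a), (h ∘ φ.symm) z = 0 :=
  fun hev => hne ((eventually_chart_iff (p := fun x => h x = 0) ha).1 hev)

theorem not_eventually_chart_coord_eq_zero (ha : a ∈ φ.source) (i : Fin n) :
    ¬ ∀ᶠ z in 𝓝 a, φ z i = 0 := fun h =>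
  not_eventually_coord_eq_zero i (φ a) ((eventually_comp_chart_iff (p := fun z => z i = 0) ha).1 h)

theorem eventually_zero_iff_chart {A : Set X} {h : X → ℂ} (ha : a ∈ φ.source)
    (hz : ∀ᶠ z in 𝓝 a, (z ∈ A ↔ h z = 0)) :
    ∀ᶠ y in 𝓝 (φ a), y ∈ φ.target ∧ ∀ᶠ w in 𝓝 y, φ.symm w ∈ A ↔ (h ∘ φ.symm) w = 0 :=
  (φ.open_target.eventually_mem (φ.map_source ha)).and
    ((eventually_chart_iff (p := fun x => x ∈ A ↔ h x = 0) ha).2 hz).eventually_nhds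

end ChartNonvanishing

/-! ### Germs of holomorphic functions on manifolds -/

section HolomorphicFunctions

open Metric Set Filter

variable {n : ℕ} {X : Type*} [TopologicalSpace X] [ChartedSpace (Model n) X]
  {a : X}

theorem restr_mem_holCharts {φ : OpenPartialHomeomorph X (Model n)} (hφ : φ ∈ holCharts n X)
    {s : Set X} (hs : IsOpen s) : φ.restr s ∈ holCharts n X :=
  restr_mem_maximalAtlas _ hφ hs

theorem HolAt.continuousAt {h : X → ℂ} (hh : HolAt n h a) : ContinuousAt h a :=
  ContMDiffAt.continuousAt hh

variable [IsManifold 𝓘(ℂ, Model n) ω X]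

theorem chartAt_mem_holCharts (a : X) : chartAt (Model n) a ∈ holCharts n X :=
  IsManifold.chart_mem_maximalAtlas a

theorem holAt_iff_chartAt {h : X → ℂ} :
    HolAt n h a ↔ AnalyticAt ℂ (h ∘ (chartAt (Model n) a).symm) (chartAt (Model n) a a) :=
  holAt_iff (chartAt_mem_holCharts a) (mem_chart_source _ a)

theorem holAt_const (c : ℂ) : HolAt n (fun _ : X => c) a :=
  holAt_iff_chartAt.2 analyticAt_const

theorem HolAt.mul {h g : X → ℂ} (hh : HolAt n h a) (hg : HolAt n g a) :
    HolAt n (fun z => h z * g z) a :=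
  holAt_iff_chartAt.2 ((holAt_iff_chartAt.1 hh).mul (holAt_iff_chartAt.1 hg))

theorem HolAt.add {h g : X → ℂ} (hh : HolAt n h a) (hg : HolAt n g a) :
    HolAt n (fun z => h z + g z) a :=
  holAt_iff_chartAt.2 ((holAt_iff_chartAt.1 hh).add (holAt_iff_chartAt.1 hg))

theorem HolAt.pow {h : X → ℂ} (hh : HolAt n h a) (k : ℕ) : HolAt n (fun z => h z ^ k) a :=
  holAt_iff_chartAt.2 ((holAt_iff_chartAt.1 hh).pow k)

theorem holAt_finset_prod {ι : Type*} (s : Finset ι) {h : ι → X → ℂ}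
    (hh : ∀ k ∈ s, HolAt n (h k) a) : HolAt n (fun z => ∏ k ∈ s, h k z) a :=
  holAt_iff_chartAt.2 (Finset.analyticAt_fun_prod s fun k hk => holAt_iff_chartAt.1 (hh k hk))

theorem holAt_finset_sum {ι : Type*} (s : Finset ι) {h : ι → X → ℂ}
    (hh : ∀ k ∈ s, HolAt n (h k) a) : HolAt n (fun z => ∑ k ∈ s, h k z) a :=
  holAt_iff_chartAt.2 (Finset.analyticAt_fun_sum s fun k hk => holAt_iff_chartAt.1 (hh k hk))

theorem HolAt.eventually {h : X → ℂ} (hh : HolAt n h a) : ∀ᶠ z in 𝓝 a, HolAt n h z := by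
  have hφ := chartAt_mem_holCharts (n := n) a
  have ha := mem_chart_source (Model n) a
  have h1 := (hh.analyticAt hφ ha).eventually_analyticAt
  rw [← eventually_comp_chart_iff ha] at h1
  filter_upwards [h1, (chartAt (Model n) a).open_source.mem_nhds ha] with z hz hzs
  exact (holAt_iff hφ hzs).2 hz

theorem HolAt.eventually_frequently_ne {h : X → ℂ} (hh : HolAt n h a)
    (hne : ¬ ∀ᶠ z in 𝓝 a, h z = 0) : ∀ᶠ z in 𝓝 a, ∃ᶠ w in 𝓝 z, h w ≠ 0 := by
  have hφ := chartAt_mem_holCharts (n := n) a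
  have ha := mem_chart_source (Model n) a
  have h1 := GeomOrbifold.eventually_frequently_ne (hh.analyticAt hφ ha)
    (not_eventually_comp_chart_symm ha hne)
  rw [← eventually_comp_chart_iff ha] at h1
  filter_upwards [h1, (chartAt (Model n) a).open_source.mem_nhds ha] with z hz hzs hev
  refine hz ?_
  have := (eventually_chart_iff (p := fun x => ¬ h x ≠ 0) hzs).2 hev
  exact this

theorem HolAt.eventually_eq_zero_of_mul {h g : X → ℂ} (hh : HolAt n h a) (hg : HolAt n g a)
    (hne : ¬ ∀ᶠ z in 𝓝 a, h z = 0) (hmul : ∀ᶠ z in 𝓝 a, h z * g z = 0) :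
    ∀ᶠ z in 𝓝 a, g z = 0 := by
  have hφ := chartAt_mem_holCharts (n := n) a
  have ha := mem_chart_source (Model n) a
  have h1 := eventually_eq_of_eq_off (hh.analyticAt hφ ha)
    (not_eventually_comp_chart_symm ha hne) (hg.analyticAt hφ ha) (analyticAt_const (v := (0 : ℂ)))
    ((eventually_chart_iff (p := fun x => h x ≠ 0 → g x = 0) ha).2
      (by filter_upwards [hmul] with z hz hz0 using (mul_eq_zero.1 hz).resolve_left hz0))
  exact (eventually_chart_iff (p := fun x => g x = 0) ha).1 h1

theorem not_eventually_prod_eq_zero {ι : Type*} (s : Finset ι) {h : ι → X → ℂ}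
    (hh : ∀ k ∈ s, HolAt n (h k) a) (hne : ∀ k ∈ s, ¬ ∀ᶠ z in 𝓝 a, h k z = 0) :
    ¬ ∀ᶠ z in 𝓝 a, ∏ k ∈ s, h k z = 0 := by
  classical
  induction s using Finset.induction_on with
  | empty =>
    intro hev
    simpa using hev.self_of_nhds
  | insert k s hk ih =>
    intro hev
    refine ih (fun j hj => hh j (Finset.mem_insert_of_mem hj))
      (fun j hj => hne j (Finset.mem_insert_of_mem hj)) ?_
    refine (hh k (Finset.mem_insert_self _ _)).eventually_eq_zero_of_mul
      (holAt_finset_prod s fun j hj => hh j (Finset.mem_insert_of_mem hj))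
      (hne k (Finset.mem_insert_self _ _)) ?_
    filter_upwards [hev] with z hz
    rwa [Finset.prod_insert hk] at hz

variable {φ : OpenPartialHomeomorph X (Model n)} {i : Fin n}

theorem HolAt.exists_eq_mul_coord {g : X → ℂ} (hg : HolAt n g a) (hφ : φ ∈ holCharts n X)
    (ha : a ∈ φ.source) (h0 : ∀ᶠ z in 𝓝 a, φ z i = 0 → g z = 0) :
    ∃ q : X → ℂ, HolAt n q a ∧ ∀ᶠ z in 𝓝 a, g z = q z * φ z i := by
  obtain ⟨q, hq, hqe⟩ := exists_eq_coord_mul (i := i) (hg.analyticAt hφ ha) (by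
    filter_upwards [(eventually_chart_iff (p := fun x => φ x i = 0 → g x = 0) ha).2 h0,
      φ.open_target.mem_nhds (φ.map_source ha)] with z hz hzt
    rw [φ.right_inv hzt] at hz
    exact hz)
  refine ⟨q ∘ φ, holAt_comp_chart hφ ha hq, ?_⟩
  filter_upwards [(eventually_comp_chart_iff ha).2 hqe, φ.open_source.mem_nhds ha] with z hz hzs
  simpa [φ.left_inv hzs] using hz

theorem HolAt.exists_eq_coord_pow_mul {h : X → ℂ} (hh : HolAt n h a) (hφ : φ ∈ holCharts n X)
    (ha : a ∈ φ.source) (hai : φ a i = 0) (hne : ¬ ∀ᶠ z in 𝓝 a, h z = 0) :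
    ∃ (s : ℕ) (c : X → ℂ), HolAt n c a ∧ (∀ᶠ z in 𝓝 a, h z = φ z i ^ s * c z) ∧
      ∃ᶠ z in 𝓝 a, φ z i = 0 ∧ c z ≠ 0 := by
  obtain ⟨s, c, hc, hce, hfr⟩ := GeomOrbifold.exists_eq_coord_pow_mul (i := i)
    (hh.analyticAt hφ ha) (not_eventually_comp_chart_symm ha hne) hai
  refine ⟨s, c ∘ φ, holAt_comp_chart hφ ha hc, ?_, fun hev => hfr ?_⟩
  · filter_upwards [(eventually_comp_chart_iff ha).2 hce, φ.open_source.mem_nhds ha] with z hz hzs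
    simpa [φ.left_inv hzs] using hz
  · exact (eventually_comp_chart_iff (p := fun z => ¬ (z i = 0 ∧ c z ≠ 0)) ha).1 hev

theorem HolAt.ne_zero_of_zeros_subset_coord {c : X → ℂ} (hc : HolAt n c a)
    (hφ : φ ∈ holCharts n X) (ha : a ∈ φ.source) (hzero : ∀ᶠ z in 𝓝 a, c z = 0 → φ z i = 0)
    (hfr : ∃ᶠ z in 𝓝 a, φ z i = 0 ∧ c z ≠ 0) : c a ≠ 0 := by
  have := GeomOrbifold.ne_zero_of_zeros_subset_coord (i := i) (hc.analyticAt hφ ha) (by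
      filter_upwards [(eventually_chart_iff (p := fun x => c x = 0 → φ x i = 0) ha).2 hzero,
        φ.open_target.mem_nhds (φ.map_source ha)] with z hz hzt
      rw [φ.right_inv hzt] at hz
      exact hz)
    (fun hev => hfr (by
      filter_upwards [(eventually_comp_chart_iff ha).2 hev, φ.open_source.mem_nhds ha] with z hz hzs
      simpa [φ.left_inv hzs] using hz))
  simpa [φ.left_inv ha] using this

/-- A function whose zeros lie on a coordinate hyperplane is a power of the coordinate times a
unit. -/
theorem HolAt.exists_eq_coord_pow_mul_unit {h : X → ℂ} (hh : HolAt n h a)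
    (hφ : φ ∈ holCharts n X) (ha : a ∈ φ.source) (hai : φ a i = 0)
    (hzero : ∀ᶠ z in 𝓝 a, h z = 0 → φ z i = 0) :
    ∃ (s : ℕ) (c : X → ℂ), HolAt n c a ∧ c a ≠ 0 ∧ ∀ᶠ z in 𝓝 a, h z = φ z i ^ s * c z := by
  have hne : ¬ ∀ᶠ z in 𝓝 a, h z = 0 := fun hev =>
    not_eventually_chart_coord_eq_zero ha i
      (by filter_upwards [hev, hzero] with z h1 h2 using h2 h1)
  obtain ⟨s, c, hc, hce, hfr⟩ := hh.exists_eq_coord_pow_mul hφ ha hai hne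
  refine ⟨s, c, hc, hc.ne_zero_of_zeros_subset_coord hφ ha ?_ hfr, hce⟩
  filter_upwards [hce, hzero] with z h1 h2 h3
  exact h2 (by rw [h1, h3, mul_zero])

/-- Finitely many functions, none of which vanishes identically on a coordinate hyperplane, are
simultaneously nonzero at points of the hyperplane. -/
theorem frequently_coord_eq_zero_and_forall_ne {ι : Type*} (s : Finset ι) {c : ι → X → ℂ}
    (hφ : φ ∈ holCharts n X) (ha : a ∈ φ.source) (hai : φ a i = 0)
    (hc : ∀ k ∈ s, HolAt n (c k) a) (hfr : ∀ k ∈ s, ∃ᶠ z in 𝓝 a, φ z i = 0 ∧ c k z ≠ 0) :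
    ∃ᶠ z in 𝓝 a, φ z i = 0 ∧ ∀ k ∈ s, c k z ≠ 0 := by
  -- Composing with the projection to the hyperplane turns the claim into one about functions on the
  -- whole space: a finite product of germs that are not identically zero is not identically zero.
  set π : Model n → Model n := fun z => Function.update z i 0 with hπ
  have hπa : π (φ a) = φ a := by
    rw [hπ, ← hai]
    exact Function.update_eq_self i (φ a)
  have hπc : Continuous π := continuous_id.update i continuous_const
  have hπt : Tendsto π (𝓝 (φ a)) (𝓝 (φ a)) := hπc.tendsto' _ _ hπa
  have hπan : AnalyticAt ℂ π (φ a) := by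
    rw [analyticAt_pi_iff]
    intro j
    rcases eq_or_ne j i with rfl | hj
    · simpa [hπ] using analyticAt_const
    · simpa [hπ, Function.update_of_ne hj] using analyticAt_coord j (φ a)
  have hprod := not_eventually_prod_eq_zero (X := Model n) (n := n) (a := φ a) s
    (h := fun k z => c k (φ.symm (π z)))
    (fun k hk => holAt_model_iff.2 (AnalyticAt.fun_comp_of_eq
      (g := c k ∘ φ.symm) ((hc k hk).analyticAt hφ ha) hπan hπa))
    (fun k hk hev => hfr k hk (by
      filter_upwards [(eventually_comp_chart_iff ha).2 hev, φ.open_source.mem_nhds ha]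
        with z hz hzs hzc
      have : π (φ z) = φ z := by
        rw [hπ, ← hzc.1]
        exact Function.update_eq_self i (φ z)
      rw [this, φ.left_inv hzs] at hz
      exact hzc.2 hz))
  intro hev
  refine hprod ?_
  have h1 := hπt.eventually ((eventually_chart_iff ha).2 hev)
  filter_upwards [h1, hπt.eventually (φ.open_target.mem_nhds (φ.map_source ha))] with z hz hzt
  by_contra hne
  refine hz ⟨by rw [φ.right_inv hzt]; simp [hπ], fun k hk h0 => hne (Finset.prod_eq_zero hk h0)⟩

/-- A function with nonzero differential is a coordinate of a chart. -/
theorem exists_chart_of_fderiv_ne_zero (hφ : φ ∈ holCharts n X) (ha : a ∈ φ.source)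
    {v : Model n → ℂ} (hv : AnalyticAt ℂ v (φ a)) (hv' : fderiv ℂ v (φ a) ≠ 0) :
    ∃ φ' ∈ holCharts n X, ∃ i : Fin n, a ∈ φ'.source ∧ φ'.source ⊆ φ.source ∧
      ∀ z ∈ φ'.source, φ' z i = v (φ z) := by
  set b := φ a with hb
  obtain ⟨i, hi⟩ : ∃ i, fderiv ℂ v b (Pi.single i 1) ≠ 0 := by
    by_contra! h
    refine hv' (ContinuousLinearMap.coe_injective ((Pi.basisFun ℂ (Fin n)).ext fun j => ?_))
    simpa using h j
  -- Replacing by `v` a coordinate along which `v` has nonzero derivative gives a local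
  -- biholomorphism, by the inverse function theorem.
  set Φ : Model n → Model n := fun z => Function.update z i (v z) with hΦ
  set L : Model n →L[ℂ] Model n := ContinuousLinearMap.pi fun j =>
    if j = i then fderiv ℂ v b else ContinuousLinearMap.proj j with hL
  have hΦan : AnalyticAt ℂ Φ b := by
    rw [analyticAt_pi_iff]
    intro j
    rcases eq_or_ne j i with rfl | hj
    · simpa [hΦ] using hv
    · simpa [hΦ, Function.update_of_ne hj] using analyticAt_coord j b
  have hΦd : HasFDerivAt Φ L b := by
    rw [hasFDerivAt_pi']
    intro j
    rcases eq_or_ne j i with rfl | hj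
    · have := hv.differentiableAt.hasFDerivAt
      simpa [hΦ, hL] using this
    · have := (ContinuousLinearMap.proj (R := ℂ) (φ := fun _ : Fin n => ℂ) j).hasFDerivAt (x := b)
      have h2 : (ContinuousLinearMap.proj j).comp L = ContinuousLinearMap.proj (R := ℂ)
          (φ := fun _ : Fin n => ℂ) j := by
        ext x; simp [hL, hj]
      rw [h2]
      refine this.congr_of_eventuallyEq (Eventually.of_forall fun z => ?_)
      simp [hΦ, Function.update_of_ne hj]
  have hLinj : Function.Injective L := by
    rw [injective_iff_map_eq_zero]
    intro x hx
    have hxj : ∀ j, j ≠ i → x j = 0 := fun j hj => by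
      have := congrFun hx j
      simpa [hL, hj] using this
    have hxs : x = x i • Pi.single i 1 := by
      ext j
      rcases eq_or_ne j i with rfl | hj
      · simp
      · simp [hj, hxj j hj]
    have hxi := congrFun hx i
    simp only [hL, ContinuousLinearMap.coe_pi', if_true, Pi.zero_apply] at hxi
    rw [hxs, map_smul, smul_eq_mul, mul_eq_zero] at hxi
    rw [hxs, hxi.resolve_right hi, zero_smul]
  set L' : Model n ≃L[ℂ] Model n :=
    (LinearEquiv.ofInjectiveEndo L.toLinearMap hLinj).toContinuousLinearEquiv with hL'
  have hΦd' : HasFDerivAt Φ (L' : Model n →L[ℂ] Model n) b := by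
    convert! hΦd using 1
  have hcd : ContDiffAt ℂ ω Φ b := hΦan.contDiffAt
  set Ψ := hcd.toOpenPartialHomeomorph Φ hΦd' (by simp) with hΨ
  have hΨc : ∀ z, Ψ z = Φ z := fun z => rfl
  have hbΨ : b ∈ Ψ.source := hcd.mem_toOpenPartialHomeomorph_source hΦd' (by simp)
  have hsymm : AnalyticAt ℂ Ψ.symm (Ψ b) :=
    (hcd.to_localInverse hΦd' (by simp)).analyticAt
  -- shrink the source so that both maps are analytic
  obtain ⟨W, hW, hWo, hbW⟩ := _root_.mem_nhds_iff.1 (inter_mem hΦan.eventually_analyticAt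
    ((Ψ.continuousAt hbΨ).eventually hsymm.eventually_analyticAt))
  set Ψ' := Ψ.restr W with hΨ'
  have hΨ's : Ψ'.source = Ψ.source ∩ W := Ψ.restr_source' W hWo
  have hΨ'mem : ∀ z ∈ Ψ'.source, AnalyticAt ℂ Φ z := fun z hz => (hW (hΨ's ▸ hz).2).1
  have hΨ'symm : ∀ y ∈ Ψ'.target, AnalyticAt ℂ Ψ'.symm y := fun y hy => by
    have h1 := Ψ'.map_target hy
    have h2 := (hW (hΨ's ▸ h1).2).2
    have h3 : Ψ (Ψ'.symm y) = y := Ψ'.right_inv hy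
    rw [mem_ofPred_eq, h3] at h2
    exact h2
  set φ' := φ.trans Ψ' with hφ'
  have hsrc : ∀ z ∈ φ'.source, z ∈ φ.source ∧ φ z ∈ Ψ'.source := fun z hz => by
    rw [hφ', OpenPartialHomeomorph.trans_source] at hz
    exact hz
  have htgt : ∀ y ∈ φ'.target, y ∈ Ψ'.target ∧ Ψ'.symm y ∈ φ.target := fun y hy => by
    rw [hφ', OpenPartialHomeomorph.trans_target] at hy
    exact hy
  refine ⟨φ', ?_, i, ?_, fun z hz => (hsrc z hz).1, fun z hz => ?_⟩
  · refine OpenPartialHomeomorph.mem_maximalAtlas_of_contMDiffOn _ ?_ ?_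
    · intro z hz
      obtain ⟨h1, h2⟩ := hsrc z hz
      exact (ContMDiffAt.comp z (contMDiffAt_model_iff.2 (hΨ'mem _ h2))
        (contMDiffAt_chart hφ h1)).contMDiffWithinAt
    · intro y hy
      obtain ⟨h1, h2⟩ := htgt y hy
      exact (ContMDiffAt.comp y (contMDiffAt_chart_symm hφ h2)
        (contMDiffAt_model_iff.2 (hΨ'symm y h1))).contMDiffWithinAt
  · rw [hφ', OpenPartialHomeomorph.trans_source]
    exact ⟨ha, by rw [mem_preimage, hΨ's]; exact ⟨hbΨ, hbW⟩⟩
  · change Φ (φ z) i = v (φ z)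
    simp [hΦ]

end HolomorphicFunctions

/-! ### Regular points and irreducible components -/

section Hypersurfaces

open Metric Set Filter

variable {n : ℕ} {X : Type*} [TopologicalSpace X] [ChartedSpace (Model n) X]

theorem IsHypersurface.isClosed {A : Set X} (hA : IsHypersurface n A) : IsClosed A := by
  rw [← isOpen_compl_iff, isOpen_iff_mem_nhds]
  intro a ha
  obtain ⟨h, hh, -, hz⟩ := hA a
  have h0 : h a ≠ 0 := fun h0 => ha (hz.self_of_nhds.2 h0)
  filter_upwards [hz, hh.continuousAt.eventually_ne h0] with z h1 h2 h3
  exact h2 (h1.1 h3)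

theorem regularLocus_subset (A : Set X) : regularLocus n A ⊆ A :=
  fun _ ⟨_, _, h⟩ => h.2.2.1

theorem IsStraightenedBy.mem_regularLocus {A : Set X} {a : X}
    {φ : OpenPartialHomeomorph X (Model n)} {i : Fin n} (h : IsStraightenedBy n A a φ i) {z : X}
    (hz : z ∈ φ.source) (hzA : z ∈ A) : z ∈ regularLocus n A :=
  ⟨φ, i, h.1, hz, hzA, h.2.2.2⟩

theorem isStraightenedBy_restr {A : Set X} {a : X} {φ : OpenPartialHomeomorph X (Model n)}
    {i : Fin n} (hφ : φ ∈ holCharts n X) (ha : a ∈ φ.source) (hai : φ a i = 0)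
    (hev : ∀ᶠ z in 𝓝 a, z ∈ A ↔ φ z i = 0) :
    ∃ U : Set X, IsOpen U ∧ a ∈ U ∧ IsStraightenedBy n A a (φ.restr U) i := by
  obtain ⟨U, hU, hUo, haU⟩ := _root_.mem_nhds_iff.1 hev
  have hsrc : (φ.restr U).source = φ.source ∩ U := φ.restr_source' U hUo
  refine ⟨U, hUo, haU, restr_mem_holCharts hφ hUo, by rw [hsrc]; exact ⟨ha, haU⟩,
    (hU haU).2 hai, fun z hz => ?_⟩
  rw [hsrc] at hz
  exact hU hz.2

theorem mem_regularLocus_congr {A B : Set X} {a : X} (ha : a ∈ regularLocus n A)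
    (hev : ∀ᶠ z in 𝓝 a, z ∈ A ↔ z ∈ B) : a ∈ regularLocus n B := by
  obtain ⟨φ, i, hφ, hs, haA, hz⟩ := ha
  obtain ⟨U, -, -, hU⟩ := isStraightenedBy_restr (A := B) hφ hs ((hz a hs).1 haA) (by
    filter_upwards [hev, φ.open_source.mem_nhds hs] with z h1 h2
    rw [← h1, hz z h2])
  exact ⟨_, i, hU⟩

/-- Near a regular point of `A`, the points of `A` lie in one component of the regular locus. -/
theorem eventually_mem_connectedComponentIn_iff {A : Set X} {b c : X}
    (hc : c ∈ regularLocus n A) :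
    ∀ᶠ z in 𝓝 c, z ∈ A → (z ∈ connectedComponentIn (regularLocus n A) b ↔
      c ∈ connectedComponentIn (regularLocus n A) b) := by
  obtain ⟨φ, i, hst⟩ := hc
  obtain ⟨hφ, hs, hcA, hz⟩ := id hst
  have hci : φ c i = 0 := (hz c hs).1 hcA
  obtain ⟨ε, hε, hball⟩ := Metric.mem_nhds_iff.1 (φ.open_target.mem_nhds (φ.map_source hs))
  -- In the chart, `A` near `c` is a hyperplane section of a ball, which is convex and thus
  -- connected.
  set Q : Set (Model n) := ball (φ c) ε ∩ {z | z i = 0} with hQ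
  have hQc : IsPreconnected Q := by
    refine Convex.isPreconnected ((convex_ball _ _).inter ?_)
    intro x hx y hy s t _ _ _
    have hx' : x i = 0 := hx
    have hy' : y i = 0 := hy
    simp [hx', hy']
  have hPc : IsPreconnected (φ.symm '' Q) :=
    hQc.image _ (φ.continuousOn_symm.mono fun z hz => hball hz.1)
  have hPsub : φ.symm '' Q ⊆ regularLocus n A := by
    rintro _ ⟨z, hzQ, rfl⟩
    have h1 := φ.map_target (hball hzQ.1)
    refine hst.mem_regularLocus h1 ((hz _ h1).2 ?_)
    rw [φ.right_inv (hball hzQ.1)]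
    exact hzQ.2
  have hcP : c ∈ φ.symm '' Q := ⟨φ c, ⟨mem_ball_self hε, hci⟩, φ.left_inv hs⟩
  filter_upwards [φ.open_source.mem_nhds hs,
    (φ.continuousAt hs).preimage_mem_nhds (ball_mem_nhds _ hε)] with z h1 h2 hzA
  have hzP : z ∈ φ.symm '' Q := ⟨φ z, ⟨h2, (hz z h1).1 hzA⟩, φ.left_inv h1⟩
  constructor
  · intro h
    rw [connectedComponentIn_eq h]
    exact hPc.subset_connectedComponentIn hzP hPsub hcP
  · intro h
    rw [connectedComponentIn_eq h]
    exact hPc.subset_connectedComponentIn hcP hPsub hzP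

variable [IsManifold 𝓘(ℂ, Model n) ω X]

theorem IsGoodPoint.mem_regularLocus {A : Set X} {φ : OpenPartialHomeomorph X (Model n)}
    (hφ : φ ∈ holCharts n X) {T : Model n → ℂ} {z : Model n} (hz : z ∈ φ.target)
    (h : IsGoodPoint T z) (hA : ∀ᶠ y in 𝓝 z, φ.symm y ∈ A ↔ T y = 0) :
    φ.symm z ∈ regularLocus n A := by
  obtain ⟨v, hv, hv0, hvd, hvT⟩ := h
  have ha := φ.map_target hz
  have haz : φ (φ.symm z) = z := φ.right_inv hz
  obtain ⟨φ', hφ', i, ha', hsub, hcoord⟩ := exists_chart_of_fderiv_ne_zero hφ ha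
    (by rwa [haz]) (by rwa [haz])
  obtain ⟨U, -, -, hU⟩ := isStraightenedBy_restr (A := A) hφ' ha'
    (by rw [hcoord _ ha', haz, hv0]) (by
    have h1 : ∀ᶠ y in 𝓝 (φ (φ.symm z)), φ.symm y ∈ A ↔ v y = 0 := by
      rw [haz]
      filter_upwards [hA, hvT] with y h1 h2
      rw [h1, h2]
    rw [← eventually_comp_chart_iff ha] at h1
    filter_upwards [h1, φ'.open_source.mem_nhds ha'] with x hx hxs
    rwa [φ.left_inv (hsub hxs), ← hcoord x hxs] at hx)
  exact ⟨_, i, hU⟩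

/-- The regular points of a hypersurface are dense in it. -/
theorem IsHypersurface.subset_closure_regularLocus {A : Set X} (hA : IsHypersurface n A) :
    A ⊆ closure (regularLocus n A) := by
  intro a haA
  rw [mem_closure_iff_nhds]
  intro N hN
  obtain ⟨h, hh, hne, hz⟩ := hA a
  have hφ := chartAt_mem_holCharts (n := n) a
  have ha := mem_chart_source (Model n) a
  set φ := chartAt (Model n) a with hφdef
  have hT := hh.analyticAt hφ ha
  obtain ⟨e, he⟩ := exists_direction hT (not_eventually_comp_chart_symm ha hne)
  obtain ⟨r, hr, ε, hε, hsl, hNr, δ, hδ, hδne, hgood, -⟩ := exists_slice_discriminant hT he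
    ((eventually_zero_iff_chart ha hz).and
      ((eventually_chart_iff (p := fun x => x ∈ N) ha).2 hN))
  have hT0 : (h ∘ φ.symm) (φ a + (0 : ℂ) • e) = 0 := by
    simpa [φ.left_inv ha] using hz.self_of_nhds.1 haA
  -- The zero at `a` persists on all nearby slices, among them slices with `δ ≠ 0`, whose zeros are
  -- regular points.
  have hpers := hsl.eventually_exists_zero (mem_ball_self hε) (mem_ball_self hr) hT0
  obtain ⟨w, hw0, ⟨l, hl, hl0⟩, hw⟩ := ((hδne _ (mem_ball_self hε)).and_eventually
    (hpers.and (ball_mem_nhds _ hε))).exists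
  obtain ⟨⟨h1, h2⟩, h3⟩ := hNr w hw l (ball_subset_closedBall hl)
  exact ⟨_, h3, ((hgood w hw hw0).isGoodPoint hl hl0).mem_regularLocus hφ h1 h2⟩

/-- The closure of a component of the regular locus of a hypersurface is a hypersurface. -/
theorem IsHypersurface.closure_component {A : Set X} (hA : IsHypersurface n A) (b : X) :
    IsHypersurface n (closure (connectedComponentIn (regularLocus n A) b)) := by
  classical
  set C := connectedComponentIn (regularLocus n A) b with hC
  have hCA : C ⊆ A := (connectedComponentIn_subset _ _).trans (regularLocus_subset A)
  have hEA : closure C ⊆ A := hA.isClosed.closure_subset_iff.2 hCA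
  intro a
  by_cases haA : a ∉ A
  · refine ⟨fun _ => 1, holAt_const 1, fun h => one_ne_zero h.self_of_nhds, ?_⟩
    filter_upwards [hA.isClosed.isOpen_compl.mem_nhds haA] with z hz
    exact ⟨fun h => absurd (hEA h) hz, fun h => absurd h one_ne_zero⟩
  obtain ⟨h, hh, hne, hz⟩ := hA a
  have hφ := chartAt_mem_holCharts (n := n) a
  have ha := mem_chart_source (Model n) a
  set φ := chartAt (Model n) a with hφdef
  set T := h ∘ φ.symm with hTdef
  have hT : AnalyticAt ℂ T (φ a) := hh.analyticAt hφ ha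
  have hTne := not_eventually_comp_chart_symm ha hne
  obtain ⟨e, he⟩ := exists_direction hT hTne
  obtain ⟨r, hr, ε, hε, hsl, hNr, δ, hδ, hδne, hgood, K, hK⟩ := exists_slice_discriminant hT he
    (eventually_zero_iff_chart ha hz)
  -- the points of the component on the slices
  set Z : Model n → Set ℂ := fun z => {l | l ∈ ball (0 : ℂ) r ∧ φ.symm (z + l • e) ∈ C} with hZ
  have hZT : ∀ z ∈ ball (φ a) ε, ∀ l ∈ Z z, T (z + l • e) = 0 := fun z hz l hl =>
    ((hNr z hz l (ball_subset_closedBall hl.1)).2.self_of_nhds).1 (hCA hl.2)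
  have hZfin : ∀ z ∈ ball (φ a) ε, ∃ F : Finset ℂ, (F : Set ℂ) = Z z ∧ F.card ≤ K := by
    intro z hz
    obtain ⟨S, μ, h1, h2, -⟩ := hsl.exists_zeros hz
    have hfin : (Z z).Finite := S.finite_toSet.subset fun l hl =>
      (h2 l (ball_subset_closedBall hl.1)).1 (hZT z hz l hl)
    refine ⟨hfin.toFinset, hfin.coe_toFinset, hK z hz _ fun l hl => ?_⟩
    rw [hfin.mem_toFinset] at hl
    exact ⟨hl.1, hZT z hz l hl⟩
  -- This is the value at `0` of the monic polynomial whose roots are the points of `C` on the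
  -- slice; a root `0` means that the base point itself lies in `C`.
  set P : Model n → ℂ := fun z => ∏ᶠ l ∈ Z z, -l with hP
  have hPF : ∀ (z) (F : Finset ℂ), (F : Set ℂ) = Z z → P z = ∏ l ∈ F, -l := fun z F hF => by
    rw [hP]
    simp only [← hF]
    exact finprod_mem_coe_finset _ F
  set M : ℝ := max 1 r with hM
  have hM1 : 1 ≤ M := le_max_left _ _
  have hMr : ∀ l ∈ ball (0 : ℂ) r, ‖-l‖ ≤ M := fun l hl => by
    rw [norm_neg]
    exact ((mem_ball_zero_iff.1 hl).le).trans (le_max_right _ _)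
  have hprodle : ∀ (F : Finset ℂ), (∀ l ∈ F, l ∈ ball (0 : ℂ) r) → F.card ≤ K →
      ‖∏ l ∈ F, -l‖ ≤ M ^ K := fun F hF hFK => by
    rw [norm_prod]
    calc ∏ l ∈ F, ‖-l‖ ≤ ∏ _l ∈ F, M :=
          Finset.prod_le_prod (fun _ _ => norm_nonneg _) fun l hl => hMr l (hF l hl)
      _ = M ^ F.card := by rw [Finset.prod_const]
      _ ≤ M ^ K := pow_le_pow_right₀ hM1 hFK
  -- On a good slice the zeros move holomorphically through regular points, so whether one lies in
  -- `C` is locally constant and the same roots are selected nearby.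
  have hPan : ∀ z ∈ ball (φ a) ε, δ z ≠ 0 → AnalyticAt ℂ P z := by
    intro z₀ hz₀ hδ₀
    have hgz := hgood z₀ hz₀ hδ₀
    obtain ⟨S, root, hS, hev⟩ := id hgz
    have hroot : ∀ s ∈ S, Tendsto (fun z => z + root s z • e) (𝓝 z₀) (𝓝 (z₀ + s • e)) := by
      intro s hs
      have h1 : ContinuousAt (fun z => z + root s z • e) z₀ :=
        continuousAt_id.add ((hS s hs).2.1.continuousAt.smul continuousAt_const)
      simpa [ContinuousAt, (hS s hs).2.2] using h1
    have hzero : ∀ s ∈ S, T (z₀ + s • e) = 0 := fun s hs =>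
      (hev.self_of_nhds s (hS s hs).1).2 ⟨s, hs, (hS s hs).2.2⟩
    have hcomp : ∀ᶠ z in 𝓝 z₀, ∀ s ∈ S, φ.symm (z + root s z • e) ∈ A →
        (φ.symm (z + root s z • e) ∈ C ↔ φ.symm (z₀ + s • e) ∈ C) := by
      rw [Filter.eventually_all_finset]
      intro s hs
      obtain ⟨h1, h2⟩ := hNr z₀ hz₀ s (ball_subset_closedBall (hS s hs).1)
      have hreg := (hgz.isGoodPoint (hS s hs).1 (hzero s hs)).mem_regularLocus hφ h1 h2
      exact (hroot s hs).eventually ((φ.symm.continuousAt h1).eventually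
        (eventually_mem_connectedComponentIn_iff hreg))
    have hinj : ∀ᶠ z in 𝓝 z₀, ∀ s ∈ S, ∀ s' ∈ S, root s z = root s' z → s = s' := by
      rw [Filter.eventually_all_finset]
      intro s hs
      rw [Filter.eventually_all_finset]
      intro s' hs'
      by_cases hss : s = s'
      · simp [hss]
      have hc := (hS s hs).2.1.continuousAt.sub (hS s' hs').2.1.continuousAt
      have hne0 : (root s - root s') z₀ ≠ 0 := by
        simpa [(hS s hs).2.2, (hS s' hs').2.2, sub_eq_zero] using hss
      filter_upwards [hc.eventually_ne hne0] with z hz heq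
      exact absurd (sub_eq_zero.2 heq) hz
    have hrb : ∀ᶠ z in 𝓝 z₀, ∀ s ∈ S, root s z ∈ ball (0 : ℂ) r := by
      rw [Filter.eventually_all_finset]
      intro s hs
      exact (hS s hs).2.1.continuousAt.eventually
        (isOpen_ball.mem_nhds (by rw [(hS s hs).2.2]; exact (hS s hs).1))
    set S₁ := S.filter fun s => φ.symm (z₀ + s • e) ∈ C with hS₁
    have hprod : AnalyticAt ℂ (fun z => ∏ s ∈ S₁, -root s z) z₀ :=
      Finset.analyticAt_fun_prod _ fun s hs => (hS s (Finset.mem_filter.1 hs).1).2.1.neg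
    refine hprod.congr ?_
    filter_upwards [hev, hcomp, hinj, hrb, isOpen_ball.mem_nhds hz₀] with z h1 h2 h3 h4 hz
    have hrz : ∀ s ∈ S, φ.symm (z + root s z • e) ∈ A := fun s hs =>
      ((hNr z hz _ (ball_subset_closedBall (h4 s hs))).2.self_of_nhds).2
        ((h1 _ (h4 s hs)).2 ⟨s, hs, rfl⟩)
    rw [hPF z (S₁.image fun s => root s z) ?_, Finset.prod_image]
    · intro s hs s' hs' heq
      exact h3 s (Finset.mem_filter.1 hs).1 s' (Finset.mem_filter.1 hs').1 heq
    · ext l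
      simp only [Finset.coe_image, mem_image, Finset.mem_coe, hS₁, Finset.mem_filter]
      constructor
      · rintro ⟨s, ⟨hs, hsC⟩, rfl⟩
        exact ⟨h4 s hs, (h2 s hs (hrz s hs)).2 hsC⟩
      · intro hl
        obtain ⟨s, hs, rfl⟩ := (h1 l hl.1).1 (hZT z hz l hl)
        exact ⟨s, ⟨hs, (h2 s hs (hrz s hs)).1 hl.2⟩, rfl⟩
  -- the local equation of the closure
  obtain ⟨P', hP'an, hP'e⟩ := exists_analytic_extension (s := P) (hδ _ (mem_ball_self hε))
    (fun hev => hδne _ (mem_ball_self hε) (by filter_upwards [hev] with z hz h; exact h hz))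
    (by filter_upwards [ball_mem_nhds _ hε] with z hz using hPan z hz)
    (by
      filter_upwards [isOpen_ball.eventually_mem (mem_ball_self (x := φ a) hε)] with z hz _ _
      refine Asymptotics.IsBigO.of_bound (M ^ K) ?_
      filter_upwards [nhdsWithin_le_nhds (isOpen_ball.mem_nhds hz)] with w hw
      obtain ⟨F, hF, hFK⟩ := hZfin w hw
      rw [hPF w F hF, norm_one, mul_one]
      exact hprodle F (fun l hl => ((hF ▸ (Finset.mem_coe.2 hl) : l ∈ Z w)).1) hFK)
  have hgoodz : ∀ᶠ z in 𝓝 (φ a), z ∈ ball (φ a) ε ∧ AnalyticAt ℂ P' z ∧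
      ∀ᶠ w in 𝓝 z, δ w ≠ 0 → P' w = P w :=
    (isOpen_ball.eventually_mem (mem_ball_self hε)).and (hP'an.eventually_analyticAt.and hP'e.eventually_nhds)
  have hiff : ∀ᶠ x in 𝓝 a, (x ∈ closure C ↔ P' (φ x) = 0) := by
    have hCzero : ∀ᶠ x in 𝓝 a, x ∈ C → P' (φ x) = 0 := by
      filter_upwards [(eventually_comp_chart_iff ha).2 hgoodz, φ.open_source.mem_nhds ha]
        with c hc hcs hcC
      set z₀ := φ c with hz₀
      obtain ⟨hz₀b, hP'z, hP'w⟩ := hc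
      have hc0 : φ.symm (z₀ + (0 : ℂ) • e) = c := by
        rw [zero_smul, add_zero]; exact φ.left_inv hcs
      have hTz₀ : T (z₀ + (0 : ℂ) • e) = 0 :=
        hZT z₀ hz₀b 0 ⟨mem_ball_self hr, by rw [hc0]; exact hcC⟩
      by_contra hne0
      have hm : 0 < ‖P' z₀‖ := norm_pos_iff.2 hne0
      have hcreg : c ∈ regularLocus n A := connectedComponentIn_subset _ _ hcC
      -- points of `A` near `c` lie in `C`
      have hnear : ∀ᶠ w in 𝓝 z₀, w ∈ ball (φ a) ε → T w = 0 → φ.symm w ∈ C := by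
        filter_upwards [(eventually_chart_iff hcs).2
          (eventually_mem_connectedComponentIn_iff (b := b) hcreg)] with w hw hwb hwT
        have hwN := hNr w hwb 0 (mem_closedBall_self hr.le)
        simp only [zero_smul, add_zero] at hwN
        exact (hw (hwN.2.self_of_nhds.2 hwT)).2 hcC
      obtain ⟨η, hη, hηsub⟩ := Metric.mem_nhds_iff.1
        (hnear.and (isOpen_ball.mem_nhds hz₀b))
      have hTz₀' : AnalyticAt ℂ T z₀ := by
        simpa using hsl.analytic z₀ hz₀b 0 (mem_closedBall_self hr.le)
      have hdir : ∀ᶠ l in 𝓝[≠] (0 : ℂ), T (z₀ + l • e) ≠ 0 := by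
        have hon := hsl.analyticOnNhd hz₀b
        rcases (hon 0 (mem_closedBall_self hr.le)).eventually_eq_zero_or_eventually_ne_zero
          with h' | h'
        · obtain ⟨l, hl⟩ : (sphere (0 : ℂ) r).Nonempty := NormedSpace.sphere_nonempty.2 hr.le
          exact absurd (hon.eqOn_zero_of_preconnected_of_eventuallyEq_zero
            (convex_closedBall _ _).isPreconnected (mem_closedBall_self hr.le) h'
            (sphere_subset_closedBall hl)) (hsl.ne_zero z₀ hz₀b l hl)
        · exact h'
      -- Good slices near `z₀` have a zero of size less than `ρ` lying in `C`, whence `‖P w‖ ≤ ρ * M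
      -- ^ K`. The radius is chosen so that this contradicts `‖P' w‖ > ‖P' z₀‖ / 2`.
      have hr₀ : 0 < min r (‖P' z₀‖ / 2 / M ^ K) := lt_min hr (by positivity)
      have hNη : {w | w ∈ ball z₀ η} ∈ 𝓝 z₀ := ball_mem_nhds z₀ hη
      obtain ⟨ρ', hρ', ε₀, hε₀, hsl₀, hNr₀, -⟩ := exists_slice_discriminant hTz₀' hdir hNη
      have hρdir : ∃ ρ > 0, ρ < min ρ' (min r (‖P' z₀‖ / 2 / M ^ K)) ∧ ∃ ε₁ > 0,
          IsSlice T e 0 ρ (ball z₀ ε₁) :=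
        exists_isSlice_of_direction hTz₀' hdir (lt_min hρ' hr₀)
      obtain ⟨ρ, hρ, hρlt, ε₁, hε₁, hsl₁⟩ := hρdir
      have hρρ' : ρ < ρ' := hρlt.trans_le (min_le_left _ _)
      have hρr : ρ < r := hρlt.trans_le ((min_le_right _ _).trans (min_le_left _ _))
      have hρm : ρ < ‖P' z₀‖ / 2 / M ^ K :=
        hρlt.trans_le ((min_le_right _ _).trans (min_le_right _ _))
      have hpers := hsl₁.eventually_exists_zero (mem_ball_self hε₁) (mem_ball_self hρ) hTz₀
      obtain ⟨w, hwδ, hw⟩ := ((hδne z₀ hz₀b).and_eventually (hpers.and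
        ((isOpen_ball.eventually_mem (mem_ball_self hε₀)).and ((isOpen_ball.eventually_mem hz₀b).and (hP'w.and
          (hP'z.continuousAt.norm.eventually_const_lt (half_lt_self hm))))))).exists
      obtain ⟨⟨l, hl, hl0⟩, hwε₀, hwε, hwP, hwlt⟩ := hw
      have hlr : l ∈ ball (0 : ℂ) r := ball_subset_ball hρr.le hl
      have hwl := hηsub (hNr₀ w hwε₀ l (ball_subset_closedBall (ball_subset_ball hρρ'.le hl)))
      have hlZ : l ∈ Z w := ⟨hlr, hwl.1 hwl.2 hl0⟩
      obtain ⟨F, hF, hFK⟩ := hZfin w hwε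
      have hlF : l ∈ F := Finset.mem_coe.1 (hF ▸ hlZ)
      have hbound : ‖P w‖ ≤ ρ * M ^ K := by
        rw [hPF w F hF, ← Finset.mul_prod_erase F _ hlF, norm_mul, norm_neg]
        refine mul_le_mul (mem_ball_zero_iff.1 hl).le (hprodle _ (fun l' hl' => ?_) ?_)
          (norm_nonneg _) hρ.le
        · exact ((hF ▸ (Finset.mem_coe.2 (Finset.mem_of_mem_erase hl')) : l' ∈ Z w)).1
        · exact (Finset.card_erase_le).trans hFK
      rw [hwP hwδ] at hwlt
      have : ρ * M ^ K < ‖P' z₀‖ / 2 := by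
        rwa [lt_div_iff₀ (by positivity)] at hρm
      linarith
    filter_upwards [(eventually_comp_chart_iff ha).2 hgoodz, hCzero.eventually_nhds,
      φ.open_source.mem_nhds ha] with x hx hxC hxs
    obtain ⟨hxb, hP'x, hP'w⟩ := hx
    have hcont : ContinuousAt (fun y => P' (φ y)) x :=
      ContinuousAt.comp (g := P') hP'x.continuousAt (φ.continuousAt hxs)
    constructor
    · intro hxcl
      by_contra hne0
      have hev := hcont.eventually_ne hne0
      rw [mem_closure_iff_frequently] at hxcl
      obtain ⟨y, hyC, hy1, hy2⟩ := (hxcl.and_eventually (hxC.and hev)).exists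
      exact hy2 (hy1 hyC)
    · intro h0
      by_contra hxcl
      -- near `x` there are no points of `C`
      have hno : ∀ᶠ z in 𝓝 (φ x), φ.symm z ∉ C := by
        refine (eventually_chart_iff (p := fun y => y ∉ C) hxs).2 ?_
        filter_upwards [isClosed_closure.isOpen_compl.mem_nhds hxcl] with y hy hyC
        exact hy (subset_closure hyC)
      have hslice : Tendsto (fun q : Model n × ℂ => q.1 + q.2 • e) (𝓝 (φ x, 0)) (𝓝 (φ x)) :=
        (continuous_slice e).tendsto' _ _ (by simp)
      obtain ⟨N₁, hN₁, N₂, hN₂, hN⟩ := mem_nhds_prod_iff.1 (hslice.eventually hno)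
      obtain ⟨ρ, hρ, hρN⟩ := Metric.mem_nhds_iff.1 hN₂
      -- No point of `C` is near `x`, so all factors of `P w` have size at least `m`. The minimum
      -- with `1` makes `m ^ K` a lower bound for any number of factors up to `K`.
      set m : ℝ := min 1 ρ with hm
      have hm0 : 0 < m := lt_min one_pos hρ
      have hlow : ∃ᶠ w in 𝓝 (φ x), m ^ K ≤ ‖P' w‖ := by
        refine ((hδne _ hxb).and_eventually ((isOpen_ball.eventually_mem hxb).and
          (hP'w.and hN₁))).mono fun w hw => ?_
        obtain ⟨hwδ, hwb, hwP, hwN⟩ := hw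
        obtain ⟨F, hF, hFK⟩ := hZfin w hwb
        rw [hwP hwδ, hPF w F hF, norm_prod]
        have h1 : ∀ l ∈ F, m ≤ ‖-l‖ := fun l hl => by
          rw [norm_neg]
          by_contra! hlt
          have hlN : l ∈ N₂ := hρN (mem_ball_zero_iff.2 (hlt.trans_le (min_le_right _ _)))
          have : (w, l) ∈ N₁ ×ˢ N₂ := ⟨hwN, hlN⟩
          exact hN this ((hF ▸ (Finset.mem_coe.2 hl) : l ∈ Z w)).2
        calc m ^ K ≤ m ^ F.card := pow_le_pow_of_le_one hm0.le (min_le_left _ _) hFK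
          _ = ∏ _l ∈ F, m := by rw [Finset.prod_const]
          _ ≤ _ := Finset.prod_le_prod (fun _ _ => hm0.le) h1
      have hlt := hP'x.continuousAt.norm.eventually_lt_const
        (show ‖P' (φ x)‖ < m ^ K by rw [h0, norm_zero]; positivity)
      obtain ⟨w, hw1, hw2⟩ := (hlow.and_eventually hlt).exists
      linarith
  refine ⟨P' ∘ φ, holAt_comp_chart hφ ha hP'an, fun hev => hne ?_, hiff⟩
  filter_upwards [hev, hiff, hz] with x h1 h2 h3
  exact h3.1 (hEA (h2.2 h1))

/-- Through every regular point of a hypersurface there passes an irreducible component. -/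
theorem IsHypersurface.exists_primeDivisor {A : Set X} (hA : IsHypersurface n A) {b : X}
    (hb : b ∈ regularLocus n A) :
    ∃ E : PrimeDivisor n X, ∀ᶠ z in 𝓝 b, z ∈ E.carrier ↔ z ∈ A := by
  set C := connectedComponentIn (regularLocus n A) b with hC
  have hCR : C ⊆ regularLocus n A := connectedComponentIn_subset _ _
  have hEA : closure C ⊆ A :=
    hA.isClosed.closure_subset_iff.2 (hCR.trans (regularLocus_subset A))
  have hbC : b ∈ C := mem_connectedComponentIn hb
  have hloc : ∀ c ∈ C, ∀ᶠ z in 𝓝 c, z ∈ A ↔ z ∈ closure C := by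
    intro c hc
    filter_upwards [eventually_mem_connectedComponentIn_iff (b := b) (hCR hc)] with z hz
    exact ⟨fun h => subset_closure ((hz h).2 hc), fun h => hEA h⟩
  have hCE : C ⊆ regularLocus n (closure C) := fun c hc =>
    mem_regularLocus_congr (hCR hc) (hloc c hc)
  refine ⟨⟨closure C, hA.closure_component b, ⟨b, hCE hbC⟩, ?_⟩, ?_⟩
  -- The regular locus of the closure lies between the connected set `C` and its closure.
  · exact isPreconnected_connectedComponentIn.subset_closure hCE (regularLocus_subset _)
  · filter_upwards [hloc b hbC] with z hz using hz.symm

/-- An irreducible hypersurface that is locally contained in a hypersurface is contained in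
it. -/
theorem PrimeDivisor.subset_of_eventually (E : PrimeDivisor n X) {A : Set X}
    (hA : IsHypersurface n A) {b : X} (hb : b ∈ regularLocus n E.carrier)
    (hev : ∀ᶠ z in 𝓝 b, z ∈ E.carrier → z ∈ A) : E.carrier ⊆ A := by
  classical
  -- The regular locus is connected, so it suffices that local containment is an open condition on
  -- it, and failure of it too.
  set g : X → Bool := fun c => decide (∀ᶠ z in 𝓝 c, z ∈ E.carrier → z ∈ A) with hg
  have hcont : ContinuousOn g (regularLocus n E.carrier) := by
    intro c hc
    have hkey : ∀ᶠ c' in 𝓝[regularLocus n E.carrier] c, g c' = g c := by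
      by_cases hcA : ∀ᶠ z in 𝓝 c, z ∈ E.carrier → z ∈ A
      · filter_upwards [nhdsWithin_le_nhds hcA.eventually_nhds] with c' hc'
        simp [hg, hcA, hc']
      obtain ⟨φ, i, hφ, hs, hcE, hz⟩ := hc
      have hci : φ c i = 0 := (hz c hs).1 hcE
      obtain ⟨h, hh, -, hhz⟩ := hA c
      set π : Model n → Model n := fun z => Function.update z i 0 with hπ
      have hπid : ∀ z : Model n, z i = 0 → π z = z := fun z hz => by
        rw [hπ, ← hz]
        exact Function.update_eq_self i z
      have hπan : AnalyticAt ℂ π (φ c) := by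
        rw [analyticAt_pi_iff]
        intro j
        rcases eq_or_ne j i with rfl | hj
        · simpa [hπ] using analyticAt_const
        · simpa [hπ, Function.update_of_ne hj] using analyticAt_coord j (φ c)
      have hπt : ∀ y : Model n, y i = 0 → Tendsto π (𝓝 y) (𝓝 y) := fun y hy =>
        (continuous_id.update i continuous_const).tendsto' _ _ (hπid y hy)
      have hT : AnalyticAt ℂ (fun z => (h ∘ φ.symm) (π z)) (φ c) :=
        AnalyticAt.fun_comp_of_eq (hh.analyticAt hφ hs) hπan (hπid _ hci)
      have hT0 : ¬ ∀ᶠ z in 𝓝 (φ c), (h ∘ φ.symm) (π z) = 0 := by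
        intro h0
        refine hcA ?_
        filter_upwards [(eventually_comp_chart_iff hs).2 h0, hhz, φ.open_source.mem_nhds hs]
          with z h1 h2 h3 h4
        rw [hπid _ ((hz z h3).1 h4), Function.comp_apply, φ.left_inv h3] at h1
        exact h2.2 h1
      -- Failure means that an equation of `A`, restricted to the hyperplane `E`, is not identically
      -- zero near `c`; the identity theorem transports this to nearby points of `E`.
      have hfr := GeomOrbifold.eventually_frequently_ne hT hT0
      filter_upwards [nhdsWithin_le_nhds ((eventually_comp_chart_iff hs).2 hfr),
        nhdsWithin_le_nhds hhz.eventually_nhds, nhdsWithin_le_nhds (φ.open_source.mem_nhds hs),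
        self_mem_nhdsWithin] with c' h1 h2 h3 h4
      have hc'i : φ c' i = 0 := (hz c' h3).1 (regularLocus_subset _ h4)
      have : ¬ ∀ᶠ z in 𝓝 c', z ∈ E.carrier → z ∈ A := by
        intro hev'
        refine h1 ?_
        have h5 : ∀ᶠ y in 𝓝 c', (y ∈ E.carrier → y ∈ A) ∧ (y ∈ A ↔ h y = 0) ∧ y ∈ φ.source :=
          hev'.and (h2.and (φ.open_source.mem_nhds h3))
        filter_upwards [(hπt _ hc'i).eventually ((eventually_chart_iff h3).2 h5),
          (hπt _ hc'i).eventually (φ.open_target.mem_nhds (φ.map_source h3))] with z hz1 hz2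
        obtain ⟨h6, h7, h8⟩ := hz1
        rw [not_not]
        refine h7.1 (h6 ((hz _ h8).2 ?_))
        rw [φ.right_inv hz2]
        simp [hπ]
      simp [hg, hcA, this]
    exact (tendsto_pure.2 hkey).mono_right (pure_le_nhds _)
  have hconst : ∀ c ∈ regularLocus n E.carrier, ∀ᶠ z in 𝓝 c, z ∈ E.carrier → z ∈ A := by
    intro c hc
    have := E.irreducible.isPreconnected.constant hcont hc hb
    simpa [hg, hev] using this
  have hRA : regularLocus n E.carrier ⊆ A := fun c hc =>
    (hconst c hc).self_of_nhds (regularLocus_subset _ hc)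
  exact E.isHypersurface.subset_closure_regularLocus.trans
    (hA.isClosed.closure_subset_iff.2 hRA)

/-- Irreducible hypersurfaces which agree near a regular point are equal. -/
theorem PrimeDivisor.eq_of_eventually {E E' : PrimeDivisor n X} {b : X}
    (hb : b ∈ regularLocus n E.carrier) (hev : ∀ᶠ z in 𝓝 b, z ∈ E.carrier ↔ z ∈ E'.carrier) :
    E = E' := by
  have hb' : b ∈ regularLocus n E'.carrier := mem_regularLocus_congr hb hev
  have h1 := E.subset_of_eventually E'.isHypersurface hb
    (by filter_upwards [hev] with z hz using hz.1)
  have h2 := E'.subset_of_eventually E.isHypersurface hb'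
    (by filter_upwards [hev] with z hz using hz.2)
  have := h1.antisymm h2
  cases E; cases E'
  congr

end Hypersurfaces

/-! ### Arithmetic of rounded quotients -/

section Multiplicities

theorem ceilDiv_coe (k : ℕ) (r : ℚ≥0) : ceilDiv k (r : WithTop ℚ≥0) = ⌈(k : ℚ≥0) / r⌉₊ := rfl

theorem ceilDiv_top (k : ℕ) : ceilDiv k ⊤ = 0 := rfl

theorem ceilDiv_one (k : ℕ) : ceilDiv k 1 = k := by
  change ⌈(k : ℚ≥0) / 1⌉₊ = k
  simp

theorem ceilDiv_add_le {m : WithTop ℚ≥0} (hm : 1 ≤ m) (k d : ℕ) :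
    ceilDiv (k + d) m ≤ ceilDiv k m + d := by
  induction m using WithTop.recTopCoe with
  | top => simp [ceilDiv_top]
  | coe r =>
    have hr : 1 ≤ r := by exact_mod_cast hm
    rw [ceilDiv_coe, ceilDiv_coe, Nat.ceil_le]
    push_cast
    rw [add_div]
    refine add_le_add (Nat.le_ceil _) ?_
    exact div_le_self (by positivity) hr

theorem ceilDiv_le {m : WithTop ℚ≥0} (hm : 1 ≤ m) (k : ℕ) : ceilDiv k m ≤ k := by
  have := ceilDiv_add_le hm 0 k
  have h0 : ceilDiv 0 m = 0 := by
    induction m using WithTop.recTopCoe with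
    | top => rfl
    | coe r => simp [ceilDiv_coe]
  simpa [h0] using this

/-- Since `m j ≤ t j * mE`, each `t j * ⌈k j / m j⌉ * mE` is at least `k j`; summing bounds `ε / mE`
by an integer, which therefore also bounds the rounded quotient. An infinite `m j` with `t j > 0`
would force `mE` to be infinite. -/
theorem ceilDiv_le_sum {ι : Type*} [Fintype ι] {m : ι → WithTop ℚ≥0} {mE : WithTop ℚ≥0}
    (hm : ∀ j, 1 ≤ m j) (hmE : 1 ≤ mE) (t k : ι → ℕ)
    (hmt : ∀ j, 0 < t j → m j ≤ (t j : WithTop ℚ≥0) * mE) {ε : ℕ}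
    (hε : ε ≤ ∑ j, if 0 < t j then k j else 0) :
    ceilDiv ε mE ≤ ∑ j, t j * ceilDiv (k j) (m j) := by
  induction mE using WithTop.recTopCoe with
  | top => simp [ceilDiv_top]
  | coe r =>
    have hr : 1 ≤ r := by exact_mod_cast hmE
    have hr0 : 0 < r := one_pos.trans_le hr
    rw [ceilDiv_coe, Nat.ceil_le, div_le_iff₀ hr0]
    have h1 : (ε : ℚ≥0) ≤ ∑ j, if 0 < t j then (k j : ℚ≥0) else 0 := by exact_mod_cast hε
    refine h1.trans ?_
    push_cast
    rw [Finset.sum_mul]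
    refine Finset.sum_le_sum fun j _ => ?_
    split_ifs with hj
    swap
    · exact zero_le
    have h2 := hmt j hj
    have hmj := hm j
    induction hmm : m j using WithTop.recTopCoe with
    | top =>
      rw [hmm] at h2
      have : ((t j : WithTop ℚ≥0) * (r : WithTop ℚ≥0)) = (((t j : ℚ≥0) * r : ℚ≥0) : WithTop ℚ≥0) := by
        push_cast; rfl
      rw [this] at h2
      exact absurd (WithTop.coe_lt_top _) h2.not_gt
    | coe s =>
      rw [hmm] at h2 hmj
      have h3 : s ≤ (t j : ℚ≥0) * r := by
        have : ((t j : WithTop ℚ≥0) * (r : WithTop ℚ≥0)) = (((t j : ℚ≥0) * r : ℚ≥0) : WithTop ℚ≥0) := by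
          push_cast; rfl
        rw [this] at h2
        exact_mod_cast h2
      have hs : 0 < s := one_pos.trans_le (by exact_mod_cast hmj)
      rw [ceilDiv_coe]
      calc (k j : ℚ≥0) = (k j : ℚ≥0) / s * s := by field_simp
        _ ≤ (⌈(k j : ℚ≥0) / s⌉₊ : ℚ≥0) * ((t j : ℚ≥0) * r) :=
          mul_le_mul (Nat.le_ceil _) h3 zero_le zero_le
        _ = _ := by ring

end Multiplicities

/-! ### Minors of the Jacobian matrix -/

section Minors

open Matrix

variable {n p q : ℕ}

theorem alternatingMap_sum_apply {ι κ M : Type*} [AddCommGroup M] [Module ℂ M] (s : Finset κ)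
    (g : κ → M [⋀^ι]→ₗ[ℂ] ℂ) (v : ι → M) : (∑ k ∈ s, g k) v = ∑ k ∈ s, g k v :=
  map_sum (⟨⟨fun f => f v, rfl⟩, fun _ _ => rfl⟩ : (M [⋀^ι]→ₗ[ℂ] ℂ) →+ ℂ) g s

/-- The expansion of the determinant of `q` linear forms in `n` variables in the `q`-fold exterior
products of the variables. -/
theorem detRowAlternating_comp_eq_sum (G : (Fin n → ℂ) →ₗ[ℂ] (Fin q → ℂ)) :
    (detRowAlternating (n := Fin q) (R := ℂ)).compLinearMap G =
      ∑ I : Idx n q, (Matrix.of fun r s => G (Pi.single (I.1.orderEmbOfFin I.2 s) 1) r).det •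
        (detRowAlternating (n := Fin q) (R := ℂ)).compLinearMap
          (LinearMap.pi fun s => LinearMap.proj (I.1.orderEmbOfFin I.2 s)) := by
  classical
  refine Module.Basis.ext_alternating (Pi.basisFun ℂ (Fin n)) fun v hv => ?_
  -- On basis vectors with distinct indices `v`, only the summand whose index set consists of these
  -- indices survives.
  set I₀ : Idx n q := ⟨Finset.univ.image v, by
    rw [Finset.card_image_of_injective _ hv, Finset.card_univ, Fintype.card_fin]⟩ with hI₀
  rw [alternatingMap_sum_apply, Finset.sum_eq_single I₀]
  · -- the rows are a permutation of `I₀`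
    have hmem : ∀ l, ∃ s, I₀.1.orderEmbOfFin I₀.2 s = v l := fun l => by
      have : v l ∈ (I₀.1 : Set (Fin n)) := by simp [hI₀]
      rw [← Finset.range_orderEmbOfFin I₀.1 I₀.2] at this
      exact this
    choose σ hσ using hmem
    have hσinj : Function.Injective σ := fun l l' h => hv (by rw [← hσ l, ← hσ l', h])
    set τ : Equiv.Perm (Fin q) := Equiv.ofBijective σ (Finite.injective_iff_bijective.1 hσinj)
      with hτ
    have hτσ : ∀ l, τ l = σ l := fun _ => rfl
    simp only [AlternatingMap.smul_apply, AlternatingMap.compLinearMap_apply, smul_eq_mul]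
    have h1 : (fun l => G ((Pi.basisFun ℂ (Fin n)) (v l))) =
        ((Matrix.of fun r s => G (Pi.single (I₀.1.orderEmbOfFin I₀.2 s) 1) r)ᵀ).submatrix τ id := by
      ext l r
      simp [hτσ, hσ]
    have h2 : (fun l => (LinearMap.pi fun s => LinearMap.proj (R := ℂ) (φ := fun _ : Fin n => ℂ)
        (I₀.1.orderEmbOfFin I₀.2 s)) ((Pi.basisFun ℂ (Fin n)) (v l))) =
        (1 : Matrix (Fin q) (Fin q) ℂ).submatrix τ id := by
      ext l s
      simp only [Pi.basisFun_apply, LinearMap.pi_apply, LinearMap.proj_apply, submatrix_apply, id,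
        Matrix.one_apply, Pi.single_apply, hτσ, ← hσ l]
      simp [eq_comm]
    have h3 := det_permute τ
      (Matrix.of fun r s => G (Pi.single (I₀.1.orderEmbOfFin I₀.2 s) 1) r)ᵀ
    have h4 := det_permute τ (1 : Matrix (Fin q) (Fin q) ℂ)
    rw [← h1, det_transpose] at h3
    rw [← h2, det_one, mul_one] at h4
    change (detRowAlternating fun l => G ((Pi.basisFun ℂ (Fin n)) (v l))) = _ at h3
    refine h3.trans ?_
    rw [mul_comm]
    congr 1
    exact h4.symm
  · intro I _ hI
    -- some column vanishes
    obtain ⟨x, hxI, hx⟩ : ∃ x ∈ I.1, x ∉ I₀.1 := by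
      by_contra! hsub
      exact hI (Subtype.ext (Finset.eq_of_subset_of_card_le hsub (by rw [I.2, I₀.2])))
    obtain ⟨s, hs⟩ : ∃ s, I.1.orderEmbOfFin I.2 s = x := by
      have : x ∈ (I.1 : Set (Fin n)) := hxI
      rw [← Finset.range_orderEmbOfFin I.1 I.2] at this
      exact this
    rw [AlternatingMap.smul_apply, AlternatingMap.compLinearMap_apply]
    refine smul_eq_zero_of_right _ (det_eq_zero_of_column_eq_zero s fun l => ?_)
    have hne : v l ≠ x := fun h => hx (by simp [hI₀, ← h])
    simp [hs, hne.symm]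
  · simp

/-- The minors of the Jacobian matrix of `F`. -/
def minor (F : Fin p → Model n → ℂ) (J : Idx p q) (I : Idx n q) (w : Model n) : ℂ :=
  (Matrix.of fun r s : Fin q =>
    fderiv ℂ (F (J.1.orderEmbOfFin J.2 r)) w (Pi.single (I.1.orderEmbOfFin I.2 s) 1)).det

theorem analyticAt_minor {F : Fin p → Model n → ℂ} {b : Model n} (hF : ∀ j, AnalyticAt ℂ (F j) b)
    (J : Idx p q) (I : Idx n q) : AnalyticAt ℂ (minor F J I) b := by
  have h : minor F J I = fun w => ∑ σ : Equiv.Perm (Fin q), (Equiv.Perm.sign σ : ℂ) *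
      ∏ r, fderiv ℂ (F (J.1.orderEmbOfFin J.2 (σ r))) w
        (Pi.single (I.1.orderEmbOfFin I.2 r) 1) := by
    funext w
    rw [minor, Matrix.det_apply']
    rfl
  rw [h]
  refine Finset.analyticAt_fun_sum _ fun σ _ => analyticAt_const.mul
    (Finset.analyticAt_fun_prod _ fun i _ => ?_)
  exact AnalyticAt.fun_comp (g := ContinuousLinearMap.apply ℂ ℂ (Pi.single _ (1 : ℂ) : Model n))
    (ContinuousLinearMap.analyticAt _ _) (hF _).fderiv

end Minors

/-! ### Orders of vanishing of the minors -/

section Estimates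

open Matrix Filter Asymptotics

variable {n p q : ℕ}

/-- Every Leibniz term takes exactly one entry from each row, so the row orders add up. -/
theorem isBigO_det {α : Type*} {l : Filter α} {M : α → Matrix (Fin q) (Fin q) ℂ} {v : α → ℂ}
    {d : Fin q → ℕ} (h : ∀ r s, (fun x => M x r s) =O[l] fun x => v x ^ d r) :
    (fun x => (M x).det) =O[l] fun x => v x ^ ∑ r, d r := by
  simp only [Matrix.det_apply']
  refine IsBigO.fun_sum fun σ _ => IsBigO.const_mul_left ?_ _
  have h2 : (fun x => v x ^ ∑ r, d r) = fun x => ∏ i, v x ^ d (σ i) := by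
    ext x
    rw [Finset.prod_pow_eq_pow_sum, Equiv.sum_comp σ d]
  rw [h2]
  exact IsBigO.finsetProd fun i _ => h (σ i) i

theorem det_eq_zero_of_rows_smul {A : Matrix (Fin q) (Fin q) ℂ} {r₀ r₁ : Fin q} (hr : r₀ ≠ r₁)
    {x : Fin q → ℂ} {c₀ c₁ : ℂ} (h₀ : A r₀ = c₀ • x) (h₁ : A r₁ = c₁ • x) : A.det = 0 := by
  have e₁ : A = A.updateRow r₁ (c₁ • x) := by rw [← h₁, updateRow_eq_self]
  have e₀ : A.updateRow r₁ x = (A.updateRow r₁ x).updateRow r₀ (c₀ • x) := by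
    rw [← h₀, ← updateRow_ne (M := A) (b := x) hr, updateRow_eq_self]
  rw [e₁, det_updateRow_smul, e₀, det_updateRow_smul, det_zero_of_row_eq hr, mul_zero, mul_zero]
  rw [updateRow_self, updateRow_ne hr.symm, updateRow_self]

/-- Determinants of matrices whose rows are a multiple of a common row plus a small row. -/
theorem isBigO_det_add_smul {α : Type*} {l : Filter α} {M : α → Matrix (Fin q) (Fin q) ℂ}
    {v : α → ℂ} {t : Fin q → ℕ} {c : Fin q → α → ℂ} {x : Fin q → α → ℂ}
    {β : Fin q → Fin q → α → ℂ} (hv : v =O[l] fun _ => (1 : ℂ))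
    (hM : ∀ᶠ w in l, ∀ r s, M w r s = c r w * x s w + β r s w)
    (hc0 : ∀ r, t r = 0 → c r = 0) (hc : ∀ r, c r =O[l] fun w => v w ^ (t r - 1))
    (hx : ∀ s, x s =O[l] fun _ => (1 : ℂ)) (hβ : ∀ r s, β r s =O[l] fun w => v w ^ t r)
    {ε : ℕ} (hε : ε = 0 ∧ ((∀ s, x s = 0) ∨ ∀ r, t r = 0) ∨ ε = 1) :
    (fun w => (M w).det) =O[l] fun w => v w ^ (∑ r, t r - ε) := by
  classical
  have hcx : ∀ r s, (fun w => c r w * x s w) =O[l] fun w => v w ^ (t r - 1) := fun r s => by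
    simpa using (hc r).mul (hx s)
  set A : Finset (Fin q) → α → Matrix (Fin q) (Fin q) ℂ := fun S w =>
    Matrix.of fun r s => if r ∈ S then c r w * x s w else β r s w with hA
  -- Expand by multilinearity, `S` being the rows taken from the common direction. Two such rows are
  -- proportional and give determinant zero, so at most one power of `v` is lost in total.
  have hexp : ∀ᶠ w in l, (M w).det = ∑ S : Finset (Fin q), (A S w).det := by
    filter_upwards [hM] with w hw
    have h1 : M w = (fun r s => c r w * x s w) + fun r s => β r s w := by
      ext r s
      exact hw r s
    have h2 := (detRowAlternating (n := Fin q) (R := ℂ)).toMultilinearMap.map_add_univ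
      (fun r s => c r w * x s w) (fun r s => β r s w)
    rw [h1]
    refine h2.trans (Finset.sum_congr rfl fun S _ => ?_)
    change Matrix.det _ = Matrix.det _
    congr 1
    ext r s
    by_cases hr : r ∈ S <;> simp [hr, hA]
  refine IsBigO.congr' ?_ (hexp.mono fun w hw => hw.symm) EventuallyEq.rfl
  refine IsBigO.fun_sum fun S _ => ?_
  have hzero : (∀ w, (A S w).det = 0) →
      (fun w => (A S w).det) =O[l] fun w => v w ^ (∑ r, t r - ε) := fun h =>
    (isBigO_zero (E' := ℂ) (fun w => v w ^ (∑ r, t r - ε)) l).congr_left fun w => (h w).symm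
  have hmem : ∀ r ∈ S, ∀ w, A S w r = c r w • fun s => x s w := fun r hr w => by
    ext s
    simp [hA, hr]
  rcases S.eq_empty_or_nonempty with rfl | ⟨r₀, hr₀⟩
  · have h1 : (fun w => (A ∅ w).det) =O[l] fun w => v w ^ ∑ r, t r :=
      isBigO_det fun r s => by simpa [hA] using hβ r s
    rcases hε with ⟨rfl, -⟩ | rfl
    · simpa using h1
    rcases Nat.eq_zero_or_pos (∑ r, t r) with h0 | h0
    · simpa [h0] using h1
    refine h1.trans ?_
    have h2 : (fun w => v w ^ ∑ r, t r) = fun w => v w ^ (∑ r, t r - 1) * v w := by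
      ext w
      rw [← pow_succ, Nat.sub_add_cancel h0]
    rw [h2]
    simpa using (isBigO_refl (fun w => v w ^ (∑ r, t r - 1)) l).mul hv
  by_cases ht : t r₀ = 0
  · refine hzero fun w => det_eq_zero_of_row_eq_zero r₀ fun s => ?_
    rw [hmem r₀ hr₀, hc0 r₀ ht]
    simp
  rcases hε with ⟨rfl, hx0 | ht0⟩ | rfl
  · refine hzero fun w => det_eq_zero_of_row_eq_zero r₀ fun s => ?_
    rw [hmem r₀ hr₀]
    simp [hx0 s]
  · exact absurd (ht0 r₀) ht
  by_cases h2 : ∃ r₁ ∈ S, r₀ ≠ r₁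
  · obtain ⟨r₁, hr₁, hne⟩ := h2
    exact hzero fun w => det_eq_zero_of_rows_smul hne (hmem r₀ hr₀ w) (hmem r₁ hr₁ w)
  push Not at h2
  have h3 : (fun w => (A S w).det) =O[l]
      fun w => v w ^ ∑ r, if r = r₀ then t r - 1 else t r := by
    refine isBigO_det fun r s => ?_
    by_cases hr : r = r₀
    · subst hr
      simpa [hA, hr₀] using hcx r s
    · have hrS : r ∉ S := fun h => hr (h2 r h).symm
      simpa [hA, hrS, hr] using hβ r s
  have h4 : ∑ r, (if r = r₀ then t r - 1 else t r) = ∑ r, t r - 1 := by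
    rw [← Finset.add_sum_erase _ _ (Finset.mem_univ r₀),
      ← Finset.add_sum_erase _ t (Finset.mem_univ r₀), if_pos rfl,
      Finset.sum_congr rfl fun r hr => if_neg (Finset.ne_of_mem_erase hr)]
    have := Nat.pos_of_ne_zero ht
    lia
  rwa [h4] at h3

/-- The order of vanishing of a minor of the Jacobian matrix of functions `v ^ t j * u j`. -/
theorem isBigO_minor {F u : Fin p → Model n → ℂ} {v : Model n → ℂ} {b : Model n} {t : Fin p → ℕ}
    (hv : AnalyticAt ℂ v b) (hu : ∀ j, AnalyticAt ℂ (u j) b)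
    (hF : ∀ j, ∀ᶠ w in 𝓝 b, F j w = v w ^ t j * u j w) (J : Idx p q) (I : Idx n q) {ε : ℕ}
    (hε : ε = 0 ∧ ((∀ i ∈ I.1, ∀ w, fderiv ℂ v w (Pi.single i 1) = 0) ∨ ∀ j ∈ J.1, t j = 0) ∨
      ε = 1) :
    minor F J I =O[𝓝 b] fun w => v w ^ (∑ j ∈ J.1, t j - ε) := by
  set e := J.1.orderEmbOfFin J.2
  have hsum : ∑ j ∈ J.1, t j = ∑ r, t (e r) := by
    rw [← Finset.sum_coe_sort J.1 t]
    exact (Fintype.sum_equiv (J.1.orderIsoOfFin J.2).toEquiv _ _ fun r => rfl).symm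
  have hO : ∀ g : Model n → ℂ, AnalyticAt ℂ g b → g =O[𝓝 b] fun _ => (1 : ℂ) := fun g hg =>
    hg.continuousAt.isBigO_one ℂ
  have hd : ∀ g : Model n → ℂ, AnalyticAt ℂ g b → ∀ i,
      AnalyticAt ℂ (fun w => fderiv ℂ g w (Pi.single i 1)) b := fun g hg i =>
    AnalyticAt.fun_comp (g := ContinuousLinearMap.apply ℂ ℂ (Pi.single i (1 : ℂ) : Model n))
      (ContinuousLinearMap.analyticAt _ _) hg.fderiv
  rw [hsum]
  -- The splitting is the product rule for `v ^ t * u`: the common row is the gradient of `v`, the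
  -- small row comes from that of `u`.
  refine isBigO_det_add_smul (c := fun r w => t (e r) * v w ^ (t (e r) - 1) * u (e r) w)
    (x := fun s w => fderiv ℂ v w (Pi.single (I.1.orderEmbOfFin I.2 s) 1))
    (β := fun r s w => v w ^ t (e r) *
      fderiv ℂ (u (e r)) w (Pi.single (I.1.orderEmbOfFin I.2 s) 1)) (hO v hv) ?_ ?_ ?_ ?_ ?_ ?_
  · have h1 : ∀ᶠ w in 𝓝 b, ∀ j, F j =ᶠ[𝓝 w] fun w => v w ^ t j * u j w :=
      Filter.eventually_all.2 fun j => (hF j).eventually_nhds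
    have h2 : ∀ᶠ w in 𝓝 b, ∀ j, AnalyticAt ℂ (u j) w :=
      Filter.eventually_all.2 fun j => (hu j).eventually_analyticAt
    filter_upwards [h1, h2, hv.eventually_analyticAt] with w hw1 hw2 hw3 r s
    have hvd := hw3.differentiableAt
    have hder := (hvd.hasFDerivAt.pow (t (e r))).mul (hw2 (e r)).differentiableAt.hasFDerivAt
    rw [Matrix.of_apply, (hw1 (e r)).fderiv_eq]
    change fderiv ℂ ((fun x => v x ^ t (e r)) * u (e r)) w _ = _
    rw [hder.fderiv]
    simp
    ring
  · intro r hr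
    ext w
    simp [hr]
  · intro r
    have := ((isBigO_refl (fun w => v w ^ (t (e r) - 1)) (𝓝 b)).mul
      (hO _ (hu (e r)))).const_mul_left (t (e r) : ℂ)
    simpa [mul_assoc] using this
  · exact fun s => hO _ (hd v hv _)
  · intro r s
    simpa using (isBigO_refl (fun w => v w ^ (t (e r))) (𝓝 b)).mul (hO _ (hd _ (hu (e r)) _))
  · refine hε.imp_left (And.imp_right (Or.imp (fun h s => ?_) fun h r => ?_))
    · ext w
      exact h _ (Finset.orderEmbOfFin_mem _ _ _) w
    · exact h _ (Finset.orderEmbOfFin_mem _ _ _)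

/-- The number of `l` with `j ∈ J l`. -/
def occFun {N : ℕ} (J : Fin N → Idx n q) (j : Fin n) : ℕ :=
  (Finset.univ.filter fun l => j ∈ (J l).1).card

theorem sum_sum_eq_sum_mul_occFun {N : ℕ} (J : Fin N → Idx p q) (t : Fin p → ℕ) :
    ∑ l, ∑ j ∈ (J l).1, t j = ∑ j, t j * occFun J j := by
  have h : ∀ l, ∑ j ∈ (J l).1, t j = ∑ j, if j ∈ (J l).1 then t j else 0 := fun l => by
    rw [Finset.sum_ite_mem, Finset.univ_inter]
  simp only [h]
  rw [Finset.sum_comm]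
  refine Finset.sum_congr rfl fun j _ => ?_
  rw [occFun, Finset.sum_ite, Finset.sum_const_zero, add_zero, Finset.sum_const, smul_eq_mul,
    mul_comm]

/-- The minors have order at least `∑ t j * k j - ∑ ε l`. The coordinate factor contributes a
further `k - ⌈k / mE⌉` if `v` is the `i₀`-th coordinate and `i₀` occurs `k` times in `I`. This is
enough because `⌈k / mE⌉ ≤ ⌈∑ ε / mE⌉ + (k - ∑ ε)` and `⌈∑ ε / mE⌉ ≤ ∑ t j * ⌈k j / m j⌉`. The
cofactors need to be units only for `m j ≠ 1`, as the exponent of `F j` is zero otherwise. -/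
theorem isBigO_prod_minor {N : ℕ} {F u : Fin p → Model n → ℂ} {v : Model n → ℂ} {b : Model n}
    {t : Fin p → ℕ} (hv : AnalyticAt ℂ v b) (hu : ∀ j, AnalyticAt ℂ (u j) b)
    (hF : ∀ j, ∀ᶠ w in 𝓝 b, F j w = v w ^ t j * u j w) {m : Fin p → WithTop ℚ≥0}
    (hm : ∀ j, 1 ≤ m j) (hu0 : ∀ j, m j ≠ 1 → u j b ≠ 0) {mY : Fin n → WithTop ℚ≥0}
    {mE : WithTop ℚ≥0} (hmE : 1 ≤ mE)
    (hmult : ∀ j, 0 < t j → m j ≤ (t j : WithTop ℚ≥0) * mE)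
    (hcase : (∃ i₀, (v = fun w => w i₀) ∧ mY i₀ = mE) ∨ mE = 1)
    (J : Fin N → Idx p q) (I : Fin N → Idx n q) :
    (fun w => (∏ l, minor F (J l) (I l) w) *
        ∏ i, w i ^ (occFun I i - ceilDiv (occFun I i) (mY i))) =O[𝓝 b]
      fun w => ∏ j, F j w ^ (occFun J j - ceilDiv (occFun J j) (m j)) := by
  classical
  -- a power of `v` of exponent at most `d` is bounded below by the right hand side
  set B : ℕ := ∑ j, t j * (occFun J j - ceilDiv (occFun J j) (m j)) with hB
  have hright : ∀ d, B ≤ d → (fun w => v w ^ d) =O[𝓝 b]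
      fun w => ∏ j, F j w ^ (occFun J j - ceilDiv (occFun J j) (m j)) := by
    intro d hd
    set U : Model n → ℂ := fun w => ∏ j, u j w ^ (occFun J j - ceilDiv (occFun J j) (m j)) with hU
    have hUa : ContinuousAt U b :=
      (Finset.analyticAt_fun_prod _ fun j _ => (hu j).fun_pow _).continuousAt
    have hUb : U b ≠ 0 := by
      refine Finset.prod_ne_zero_iff.2 fun j _ => ?_
      by_cases hj : m j = 1
      · simp [hj, ceilDiv_one]
      · exact pow_ne_zero _ (hu0 j hj)
    have h1 : ∀ᶠ w in 𝓝 b, ∏ j, F j w ^ (occFun J j - ceilDiv (occFun J j) (m j)) =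
        v w ^ B * U w := by
      filter_upwards [Filter.eventually_all.2 hF] with w hw
      simp only [hw, mul_pow, Finset.prod_mul_distrib, hB, hU]
      rw [← Finset.prod_pow_eq_pow_sum]
      simp only [pow_mul]
    refine IsBigO.congr' (f₁ := fun w => v w ^ B * U w * (v w ^ (d - B) * (U w)⁻¹))
      (g₁ := fun w => v w ^ B * U w) ?_ ?_ (h1.mono fun w hw => hw.symm)
    · have h2 : (fun w => v w ^ (d - B) * (U w)⁻¹) =O[𝓝 b] fun _ => (1 : ℂ) :=
        ((hv.continuousAt.pow _).mul (hUa.inv₀ hUb)).isBigO_one ℂ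
      simpa using (isBigO_refl (fun w => v w ^ B * U w) (𝓝 b)).mul h2
    · filter_upwards [hUa.eventually_ne hUb] with w hw
      rw [show d = B + (d - B) by lia, pow_add]
      field_simp
      simp
  -- The `l`-th minor loses a power only if one of its rows has `t j > 0` and `dv` is seen by its
  -- columns; when `v` is the coordinate `i₀`, the latter requires `i₀ ∈ I l`.
  set P : Fin N → Prop := fun l => (∃ j ∈ (J l).1, 0 < t j) ∧
    ∀ i₀, (v = fun w => w i₀) → i₀ ∈ (I l).1 with hP
  set ε : Fin N → ℕ := fun l => if P l then 1 else 0 with hε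
  have hminor : ∀ l, minor F (J l) (I l) =O[𝓝 b]
      fun w => v w ^ (∑ j ∈ (J l).1, t j - ε l) := by
    intro l
    refine isBigO_minor hv hu hF (J l) (I l) ?_
    by_cases hl : P l
    · exact Or.inr (if_pos hl)
    · refine Or.inl ⟨if_neg hl, ?_⟩
      simp only [hP, not_and_or, not_exists, not_forall] at hl
      rcases hl with hl | ⟨i₀, hi₀, hl⟩
      · exact Or.inr fun j hj => by simpa using (hl j).resolve_left (not_not.2 hj)
      · refine Or.inl fun i hi w => ?_
        have hne : i₀ ≠ i := fun h => hl (h ▸ hi)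
        rw [hi₀]
        have := (ContinuousLinearMap.proj (R := ℂ) (φ := fun _ : Fin n => ℂ) i₀).fderiv (x := w)
        change fderiv ℂ (fun w : Model n => w i₀) w = _ at this
        rw [this]
        simp [hne]
  have hεle : ∀ l, ε l ≤ ∑ j ∈ (J l).1, if 0 < t j then 1 else 0 := by
    intro l
    by_cases hl : P l
    · obtain ⟨j, hj, htj⟩ := hl.1
      simp only [hε, if_pos hl]
      refine le_trans ?_ (Finset.single_le_sum (fun _ _ => Nat.zero_le _) hj)
      simp [htj]
    · simp [hε, if_neg hl]
  have hεt : ∀ l, ε l ≤ ∑ j ∈ (J l).1, t j := fun l =>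
    (hεle l).trans (Finset.sum_le_sum fun j _ => by split_ifs <;> lia)
  have hprod : (fun w => ∏ l, minor F (J l) (I l) w) =O[𝓝 b]
      fun w => v w ^ (∑ j, t j * occFun J j - ∑ l, ε l) := by
    have h1 : ∑ l, (∑ j ∈ (J l).1, t j - ε l) = ∑ j, t j * occFun J j - ∑ l, ε l := by
      rw [← sum_sum_eq_sum_mul_occFun, ← Finset.sum_tsub_distrib _ fun l _ => hεt l]
    rw [← h1]
    simp only [← Finset.prod_pow_eq_pow_sum]
    exact IsBigO.finsetProd fun l _ => hminor l
  have hεtot : ∑ l, ε l ≤ ∑ j, t j * occFun J j := by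
    rw [← sum_sum_eq_sum_mul_occFun]
    exact Finset.sum_le_sum fun l _ => hεt l
  have hεK : ∑ l, ε l ≤ ∑ j, if 0 < t j then occFun J j else 0 := by
    refine (Finset.sum_le_sum fun l _ => hεle l).trans ?_
    rw [sum_sum_eq_sum_mul_occFun J fun j => if 0 < t j then 1 else 0]
    simp
  have hceil := ceilDiv_le_sum hm hmE t (occFun J) hmult hεK
  have hBsum : B + ∑ j, t j * ceilDiv (occFun J j) (m j) = ∑ j, t j * occFun J j := by
    rw [hB, ← Finset.sum_add_distrib]
    refine Finset.sum_congr rfl fun j _ => ?_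
    rw [← mul_add, Nat.sub_add_cancel (ceilDiv_le (hm j) _)]
  have hone : ∀ s : Finset (Fin n), (fun w : Model n => ∏ i ∈ s,
      w i ^ (occFun I i - ceilDiv (occFun I i) (mY i))) =O[𝓝 b] fun _ => (1 : ℂ) := fun s =>
    (Finset.analyticAt_fun_prod _ fun i _ => (analyticAt_coord i b).fun_pow _).continuousAt.isBigO_one ℂ
  by_cases h1 : ∃ i₀, (v = fun w => w i₀) ∧ mY i₀ = mE
  · obtain ⟨i₀, hi₀, hmi⟩ := h1
    have hεk : ∑ l, ε l ≤ occFun I i₀ := by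
      rw [occFun, Finset.card_filter]
      refine Finset.sum_le_sum fun l _ => ?_
      by_cases hl : P l
      · simp [hε, hl, hl.2 i₀ hi₀]
      · simp [hε, hl]
    set k := occFun I i₀ with hk
    have h2 := ceilDiv_add_le hmE (∑ l, ε l) (k - ∑ l, ε l)
    rw [Nat.add_sub_cancel' hεk] at h2
    have h3 := ceilDiv_le hmE k
    have h4 : (fun w => (∏ l, minor F (J l) (I l) w) *
        ∏ i, w i ^ (occFun I i - ceilDiv (occFun I i) (mY i))) =O[𝓝 b]
        fun w => v w ^ (∑ j, t j * occFun J j - ∑ l, ε l + (k - ceilDiv k mE)) := by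
      have h5 : (fun w : Model n => ∏ i, w i ^ (occFun I i - ceilDiv (occFun I i) (mY i)))
          =O[𝓝 b] fun w => v w ^ (k - ceilDiv k mE) := by
        have h6 := (isBigO_refl (fun w : Model n => w i₀ ^ (k - ceilDiv k mE)) (𝓝 b)).mul
          (hone (Finset.univ.erase i₀))
        rw [hi₀]
        simpa [← hmi, hk, Finset.mul_prod_erase Finset.univ
          (fun i => _ ^ (occFun I i - ceilDiv (occFun I i) (mY i))) (Finset.mem_univ i₀)] using h6
      simp only [pow_add]
      exact hprod.mul h5
    exact h4.trans (hright _ (by lia))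
  · have hm1 : mE = 1 := hcase.resolve_left h1
    rw [hm1, ceilDiv_one] at hceil
    have h4 := hprod.mul (hone Finset.univ)
    simp only [mul_one] at h4
    exact h4.trans (hright _ (by lia))

end Estimates

/-! ### Pullbacks of generators in coordinates -/

section Expansion

open Filter

variable {n p q N : ℕ} {Y X : Type*} [TopologicalSpace Y] [ChartedSpace (Model n) Y]
  [TopologicalSpace X] [ChartedSpace (Model p) X]

/-- The components of `f` in the charts `ψ` and `φ`. -/
def components (f : Y → X) (φ : OpenPartialHomeomorph X (Model p))
    (ψ : OpenPartialHomeomorph Y (Model n)) (j : Fin p) (w : Model n) : ℂ :=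
  φ (f (ψ.symm w)) j

theorem analyticAt_components [IsManifold 𝓘(ℂ, Model n) ω Y] [IsManifold 𝓘(ℂ, Model p) ω X]
    {f : Y → X} (hf : ContMDiff 𝓘(ℂ, Model n) 𝓘(ℂ, Model p) ω f)
    {φ : OpenPartialHomeomorph X (Model p)} (hφ : φ ∈ holCharts p X)
    {ψ : OpenPartialHomeomorph Y (Model n)} (hψ : ψ ∈ holCharts n Y) {y : Y} (hy : y ∈ ψ.source)
    (hfy : f y ∈ φ.source) (j : Fin p) : AnalyticAt ℂ (components f φ ψ j) (ψ y) := by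
  have h : HolAt n (fun z => φ (f z) j) y := (holAt_coord hφ hfy j).comp y hf.contMDiffAt
  exact h.analyticAt hψ hy

theorem coordDifferentials_apply [IsManifold 𝓘(ℂ, Model p) ω X]
    {φ : OpenPartialHomeomorph X (Model p)} (hφ : φ ∈ holCharts p X)
    (e : Fin q → Fin p) {x : X} (hx : x ∈ φ.source) (v : TangentSpace 𝓘(ℂ, Model p) x)
    (r : Fin q) : coordDifferentials φ e x v r =
      mfderiv 𝓘(ℂ, Model p) 𝓘(ℂ, Model p) φ x v (e r) := by
  have h1 : MDifferentiableAt 𝓘(ℂ, Model p) 𝓘(ℂ, Model p) φ x :=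
    (contMDiffAt_chart hφ hx).mdifferentiableAt (by simp)
  have h2 : HasMFDerivAt 𝓘(ℂ, Model p) 𝓘(ℂ, ℂ) (fun z : Model p => z (e r)) (φ x)
      (ContinuousLinearMap.proj (R := ℂ) (φ := fun _ : Fin p => ℂ) (e r)) :=
    (ContinuousLinearMap.proj (R := ℂ) (φ := fun _ : Fin p => ℂ) (e r)).hasMFDerivAt
  have h3 := (h2.comp x h1.hasMFDerivAt).mfderiv
  change mfderiv 𝓘(ℂ, Model p) 𝓘(ℂ, ℂ) (fun z => φ z (e r)) x v = _
  change mfderiv 𝓘(ℂ, Model p) 𝓘(ℂ, ℂ) (fun z => φ z (e r)) x = _ at h3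
  rw [h3]
  rfl

theorem coordDifferentials_mfderiv [IsManifold 𝓘(ℂ, Model n) ω Y]
    [IsManifold 𝓘(ℂ, Model p) ω X]
    {f : Y → X} (hf : ContMDiff 𝓘(ℂ, Model n) 𝓘(ℂ, Model p) ω f)
    {φ : OpenPartialHomeomorph X (Model p)} (hφ : φ ∈ holCharts p X)
    {ψ : OpenPartialHomeomorph Y (Model n)} (hψ : ψ ∈ holCharts n Y) {y : Y} (hy : y ∈ ψ.source)
    (hfy : f y ∈ φ.source) (e : Fin q → Fin p) (v : TangentSpace 𝓘(ℂ, Model n) y) (r : Fin q) :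
    coordDifferentials φ e (f y) (mfderiv 𝓘(ℂ, Model n) 𝓘(ℂ, Model p) f y v) r =
      fderiv ℂ (components f φ ψ (e r)) (ψ y)
        (mfderiv 𝓘(ℂ, Model n) 𝓘(ℂ, Model n) ψ y v) := by
  have hx : MDifferentiableAt 𝓘(ℂ, Model p) 𝓘(ℂ, ℂ) (fun z => φ z (e r)) (f y) :=
    (holAt_coord hφ hfy (e r)).mdifferentiableAt (by simp)
  have hf' : MDifferentiableAt 𝓘(ℂ, Model n) 𝓘(ℂ, Model p) f y :=
    hf.contMDiffAt.mdifferentiableAt (by simp)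
  have hψ' : MDifferentiableAt 𝓘(ℂ, Model n) 𝓘(ℂ, Model n) ψ y :=
    (contMDiffAt_chart hψ hy).mdifferentiableAt (by simp)
  have hF : HasMFDerivAt 𝓘(ℂ, Model n) 𝓘(ℂ, ℂ) (components f φ ψ (e r)) (ψ y)
      (fderiv ℂ (components f φ ψ (e r)) (ψ y)) :=
    (analyticAt_components hf hφ hψ hy hfy (e r)).differentiableAt.hasFDerivAt.hasMFDerivAt
  have h1 := (hx.hasMFDerivAt.comp y hf'.hasMFDerivAt).mfderiv
  have h2 := (hF.comp y hψ'.hasMFDerivAt).mfderiv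
  have heq : (fun z => φ z (e r)) ∘ f =ᶠ[𝓝 y] components f φ ψ (e r) ∘ ψ := by
    filter_upwards [ψ.open_source.eventually_mem hy] with z hz
    simp [components, ψ.left_inv hz]
  rw [heq.mfderiv_eq, h2] at h1
  exact (DFunLike.congr_fun h1 v).symm

/-- By the chain rule the pulled back form is a determinant of linear forms composed with the
differential of `ψ`; expanding it in exterior products of the coordinates produces the minors. -/
theorem pullbackForm_dForm [IsManifold 𝓘(ℂ, Model n) ω Y]
    [IsManifold 𝓘(ℂ, Model p) ω X]
    {f : Y → X} (hf : ContMDiff 𝓘(ℂ, Model n) 𝓘(ℂ, Model p) ω f)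
    {φ : OpenPartialHomeomorph X (Model p)} (hφ : φ ∈ holCharts p X)
    {ψ : OpenPartialHomeomorph Y (Model n)} (hψ : ψ ∈ holCharts n Y) {y : Y} (hy : y ∈ ψ.source)
    (hfy : f y ∈ φ.source) (J : Idx p q) :
    pullbackForm f q y (dForm φ J (f y)) =
      ∑ I : Idx n q, minor (components f φ ψ) J I (ψ y) • dForm ψ I y := by
  set L : TangentSpace 𝓘(ℂ, Model n) y →ₗ[ℂ] (Fin n → ℂ) :=
    (mfderiv 𝓘(ℂ, Model n) 𝓘(ℂ, Model n) ψ y).toLinearMap with hL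
  set G : (Fin n → ℂ) →ₗ[ℂ] (Fin q → ℂ) := LinearMap.pi fun r =>
    (fderiv ℂ (components f φ ψ (J.1.orderEmbOfFin J.2 r)) (ψ y)).toLinearMap with hG
  have hexp := detRowAlternating_comp_eq_sum G
  ext v
  rw [alternatingMap_sum_apply]
  have h1 : pullbackForm f q y (dForm φ J (f y)) v =
      Matrix.detRowAlternating.compLinearMap G fun l => L (v l) := by
    change Matrix.detRowAlternating _ = Matrix.detRowAlternating _
    congr 1
    ext l r
    exact coordDifferentials_mfderiv hf hφ hψ hy hfy _ (v l) r
  rw [h1, hexp, alternatingMap_sum_apply]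
  refine Finset.sum_congr rfl fun I _ => ?_
  rw [AlternatingMap.smul_apply, AlternatingMap.smul_apply]
  congr 1
  change Matrix.detRowAlternating _ = Matrix.detRowAlternating _
  congr 1
  ext l r
  exact (coordDifferentials_apply hψ _ hy (v l) r).symm

/-- The unordered tuple of the values of `J`. -/
def symOf (J : Fin N → Idx n q) : Sym (Idx n q) N :=
  ⟨Finset.univ.val.map J, by simp⟩

theorem exists_symOf_eq (s : Sym (Idx n q) N) : ∃ J : Fin N → Idx n q, symOf J = s := by
  obtain ⟨s, hs⟩ := s
  induction s using Quotient.inductionOn with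
  | h l =>
    have hl : l.length = N := hs
    subst hl
    refine ⟨l.get, Subtype.ext ?_⟩
    simp [symOf, Fin.univ_val_map]

theorem occ_symOf (J : Fin N → Idx n q) (j : Fin n) : occ (symOf J) j = occFun J j := by
  change ((Finset.univ.val.map J).filter fun I => j ∈ I.1).card = _
  rw [Multiset.filter_map, Multiset.card_map]
  rfl

theorem generator_symOf {Δ : OrbifoldDivisor n Y} (φ : AdaptedChart Δ) (J : Fin N → Idx n q)
    (y : Y) : generator φ (symOf J) y =
      (∏ j, φ.chart y j ^ ((ceilDiv (occFun J j) (φ.m j) : ℤ) - (occFun J j : ℤ))) •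
        ∏ l, SymmetricAlgebra.ι ℂ (FormFibre n q y) (dForm φ.chart (J l) y) := by
  rw [generator]
  simp only [occ_symOf]
  congr 1
  change ((Finset.univ.val.map J).map _).prod = _
  rw [Multiset.map_map]
  rfl

theorem lift_generator [IsManifold 𝓘(ℂ, Model n) ω Y] [IsManifold 𝓘(ℂ, Model p) ω X]
    {f : Y → X} (hf : ContMDiff 𝓘(ℂ, Model n) 𝓘(ℂ, Model p) ω f)
    {Δ : OrbifoldDivisor p X} (φ : AdaptedChart Δ)
    {ψ : OpenPartialHomeomorph Y (Model n)} (hψ : ψ ∈ holCharts n Y) {y : Y} (hy : y ∈ ψ.source)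
    (hfy : f y ∈ φ.chart.source) (J : Fin N → Idx p q) :
    SymmetricAlgebra.lift (SymmetricAlgebra.ι ℂ (FormFibre n q y) ∘ₗ pullbackForm f q y)
        (generator φ (symOf J) (f y)) =
      ∑ I : Fin N → Idx n q,
        ((∏ j, φ.chart (f y) j ^ ((ceilDiv (occFun J j) (φ.m j) : ℤ) - (occFun J j : ℤ))) *
          ∏ l, minor (components f φ.chart ψ) (J l) (I l) (ψ y)) •
        ∏ l, SymmetricAlgebra.ι ℂ (FormFibre n q y) (dForm ψ (I l) y) := by
  rw [generator_symOf, map_smul, map_prod]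
  simp only [SymmetricAlgebra.lift_ι_apply, LinearMap.comp_apply,
    pullbackForm_dForm hf φ.chart_mem hψ hy hfy, map_sum, map_smul]
  rw [Finset.prod_univ_sum, Fintype.piFinset_univ, Finset.smul_sum]
  refine Finset.sum_congr rfl fun I _ => ?_
  rw [mul_smul]
  congr 1
  simp only [Algebra.smul_def, Finset.prod_mul_distrib, map_prod]

end Expansion

/-! ### From divisibility of coefficients to sections -/

section Assembly

open Filter

variable {n p q N : ℕ} {Y X : Type*} [TopologicalSpace Y] [ChartedSpace (Model n) Y]
  [TopologicalSpace X] [ChartedSpace (Model p) X]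

theorem AdaptedChart.one_le_m {Δ : OrbifoldDivisor p X} (φ : AdaptedChart Δ) (j : Fin p) :
    1 ≤ φ.m j := by
  unfold AdaptedChart.m
  split
  · exact le_rfl
  · exact Δ.one_le_mult _

theorem AdaptedChart.exists_label {Δ : OrbifoldDivisor p X} (φ : AdaptedChart Δ) {j : Fin p}
    (hj : φ.m j ≠ 1) : ∃ D, φ.label j = some D ∧ φ.m j = Δ.mult D ∧ 1 < Δ.mult D := by
  have h := φ.one_le_m j
  unfold AdaptedChart.m at hj h ⊢
  split at hj
  · exact absurd rfl hj
  · next D hD =>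
    simp only [hD] at h ⊢
    exact ⟨D, rfl, rfl, lt_of_le_of_ne h hj.symm⟩

theorem AdaptedChart.ne_zero_of_notMem_support {Δ : OrbifoldDivisor p X} (φ : AdaptedChart Δ)
    {j : Fin p} (hj : φ.m j ≠ 1) {x : X} (hx : x ∈ φ.chart.source) (hxs : x ∉ Δ.support) :
    φ.chart x j ≠ 0 := by
  obtain ⟨D, hD, -, hlt⟩ := φ.exists_label hj
  intro h0
  exact hxs (Set.mem_biUnion hlt ((φ.mem_iff D hlt x hx).2 ⟨j, hD, h0⟩))

/-- Off the support the negative powers in a generator are inverted by genuine powers, so the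
coefficients can be compared without poles. Coordinates with `m j = 1` may vanish, but their
exponent is zero. -/
theorem prod_zpow_mul_prod_pow {m : Fin p → WithTop ℚ≥0} (hm : ∀ j, 1 ≤ m j) {x : Fin p → ℂ}
    (hx : ∀ j, m j ≠ 1 → x j ≠ 0) (k : Fin p → ℕ) :
    (∏ j, x j ^ ((ceilDiv (k j) (m j) : ℤ) - (k j : ℤ))) *
      ∏ j, x j ^ (k j - ceilDiv (k j) (m j)) = 1 := by
  rw [← Finset.prod_mul_distrib]
  refine Finset.prod_eq_one fun j _ => ?_
  by_cases hj : m j = 1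
  · simp [hj, ceilDiv_one]
  · rw [← zpow_natCast, ← zpow_add₀ (hx j hj), Nat.cast_sub (ceilDiv_le (hm j) _)]
    simp

/-- Pullbacks of sections are sections, if the coefficients of the pullbacks of the generators
are divisible as required. -/
theorem exists_coeff_pullbackSym [IsManifold 𝓘(ℂ, Model n) ω Y] [IsManifold 𝓘(ℂ, Model p) ω X]
    {f : Y → X} (hf : ContMDiff 𝓘(ℂ, Model n) 𝓘(ℂ, Model p) ω f)
    {ΔY : OrbifoldDivisor n Y} {ΔX : OrbifoldDivisor p X} (φ : AdaptedChart ΔX)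
    (ψ : AdaptedChart ΔY) {a : Y} (ha : a ∈ ψ.chart.source) (hfa : f a ∈ φ.chart.source)
    (hdiv : ∀ (J : Fin N → Idx p q) (I : Fin N → Idx n q), ∃ Q : Model n → ℂ,
      AnalyticAt ℂ Q (ψ.chart a) ∧ ∀ᶠ w in 𝓝 (ψ.chart a),
        (∏ l, minor (components f φ.chart ψ.chart) (J l) (I l) w) *
            ∏ i, w i ^ (occFun I i - ceilDiv (occFun I i) (ψ.m i)) =
          Q w * ∏ j, components f φ.chart ψ.chart j w ^
            (occFun J j - ceilDiv (occFun J j) (φ.m j)))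
    {σ : (x : X) → SymFibre p q x} {A : Sym (Idx p q) N → X → ℂ} (hA : ∀ s, HolAt p (A s) (f a))
    (hσ : ∀ᶠ x in 𝓝 (f a), x ∉ ΔX.support → σ x = ∑ s, A s x • generator φ s x) :
    ∃ B : Sym (Idx n q) N → Y → ℂ, (∀ s, HolAt n (B s) a) ∧
      ∀ᶠ y in 𝓝 a, y ∉ ΔY.support ∪ f ⁻¹' ΔX.support →
        pullbackSym f q σ y = ∑ s, B s y • generator ψ s y := by
  classical
  choose Q hQ hQeq using hdiv
  choose J hJ using fun s : Sym (Idx p q) N => exists_symOf_eq s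
  have hQhol : ∀ J I, HolAt n (fun y => Q J I (ψ.chart y)) a := fun J I =>
    holAt_comp_chart ψ.chart_mem ha (hQ J I)
  -- The expansion runs over ordered tuples, the generators over unordered ones, so the coefficients
  -- of all orderings are collected.
  refine ⟨fun s' y => ∑ s, ∑ I, if symOf I = s' then A s (f y) * Q (J s) I (ψ.chart y) else 0,
    fun s' => ?_, ?_⟩
  · refine holAt_finset_sum _ fun s _ => holAt_finset_sum _ fun I _ => ?_
    split_ifs
    · exact HolAt.mul ((hA s).comp a hf.contMDiffAt) (hQhol _ _)
    · exact holAt_const _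
  have h1 : ∀ᶠ y in 𝓝 a, ∀ J I, _ := eventually_all.2 fun J => eventually_all.2 fun I =>
    (eventually_comp_chart_iff ha).2 (hQeq J I)
  filter_upwards [h1, ψ.chart.open_source.eventually_mem ha,
    hf.continuous.continuousAt.eventually hσ,
    hf.continuous.continuousAt.eventually (φ.chart.open_source.eventually_mem hfa)]
    with y hy hyψ hyσ hyφ hyZ
  have hyY : y ∉ ΔY.support := fun h => hyZ (Or.inl h)
  have hyX : f y ∉ ΔX.support := fun h => hyZ (Or.inr h)
  have hcomp : ∀ j, components f φ.chart ψ.chart j (ψ.chart y) = φ.chart (f y) j := fun j => by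
    simp [components, ψ.chart.left_inv hyψ]
  have hterm : ∀ s, SymmetricAlgebra.lift
      (SymmetricAlgebra.ι ℂ (FormFibre n q y) ∘ₗ pullbackForm f q y) (generator φ s (f y)) =
      ∑ I, Q (J s) I (ψ.chart y) • generator ψ (symOf I) y := by
    intro s
    conv_lhs => rw [← hJ s]
    rw [lift_generator hf φ ψ.chart_mem hyψ hyφ]
    refine Finset.sum_congr rfl fun I _ => ?_
    rw [generator_symOf, smul_smul]
    congr 1
    have e1 := hy (J s) I
    simp only [hcomp] at e1
    have e2 := prod_zpow_mul_prod_pow φ.one_le_m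
      (fun j hj => φ.ne_zero_of_notMem_support hj hyφ hyX) (occFun (J s))
    have e3 := prod_zpow_mul_prod_pow ψ.one_le_m
      (fun j hj => ψ.ne_zero_of_notMem_support hj hyψ hyY) (occFun I)
    set a1 := ∏ j, φ.chart (f y) j ^
      ((ceilDiv (occFun (J s) j) (φ.m j) : ℤ) - (occFun (J s) j : ℤ))
    set a2 := ∏ j, ψ.chart y j ^ ((ceilDiv (occFun I j) (ψ.m j) : ℤ) - (occFun I j : ℤ))
    set M := ∏ l, minor (components f φ.chart ψ.chart) (J s l) (I l) (ψ.chart y)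
    linear_combination (-a1 * M) * e3 + a1 * a2 * e1 + Q (J s) I (ψ.chart y) * a2 * e2
  rw [pullbackSym, hyσ hyX, map_sum]
  simp only [map_smul, hterm, Finset.sum_smul, ite_smul, zero_smul]
  rw [Finset.sum_comm]
  refine Finset.sum_congr rfl fun s _ => ?_
  rw [Finset.sum_comm, Finset.smul_sum]
  refine Finset.sum_congr rfl fun I _ => ?_
  rw [Finset.sum_ite_eq, if_pos (Finset.mem_univ _), mul_smul]

end Assembly

/-! ### Preimages of the support -/

section Preimages

open Filter

variable {n p : ℕ} {Y X : Type*} [TopologicalSpace Y] [ChartedSpace (Model n) Y]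
  [TopologicalSpace X] [ChartedSpace (Model p) X] [IsManifold 𝓘(ℂ, Model n) ω Y] {f : Y → X}
  {ΔX : OrbifoldDivisor p X}

/-- By the identity theorem, the set of points near which `f` maps into `D` is closed as well as
open. If nonempty, it contains a component of `Y`, which is then mapped into the support. -/
theorem NotIntoSupport.not_eventually_mem (hns : NotIntoSupport f ΔX)
    (hf : ContMDiff 𝓘(ℂ, Model n) 𝓘(ℂ, Model p) ω f) {D : PrimeDivisor p X}
    (hD : 1 < ΔX.mult D) (a : Y) : ¬ ∀ᶠ z in 𝓝 a, f z ∈ D.carrier := by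
  intro ha
  have hclopen : IsClopen {y | ∀ᶠ z in 𝓝 y, f z ∈ D.carrier} := by
    refine ⟨?_, isOpen_setOfPred_eventually_nhds⟩
    refine isClosed_of_closure_subset fun y hy => ?_
    obtain ⟨h, hh, -, hz⟩ := D.isHypersurface (f y)
    have hhf : HolAt n (fun z => h (f z)) y := ContMDiffAt.comp y hh hf.contMDiffAt
    have hz' := hf.continuous.continuousAt.eventually hz
    by_contra hne
    have hne' : ¬ ∀ᶠ z in 𝓝 y, h (f z) = 0 := fun h0 => hne (by
      filter_upwards [h0, hz'] with z h1 h2 using h2.2 h1)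
    obtain ⟨z, hz1, hz2, hz3⟩ := (mem_closure_iff_frequently.1 hy).and_eventually
      ((hhf.eventually_frequently_ne hne').and hz'.eventually_nhds) |>.exists
    obtain ⟨w, hw1, hw2, hw3⟩ := (hz2.and_eventually (hz3.and hz1)).exists
    exact hw1 (hw2.1 hw3)
  refine hns a ?_
  rintro _ ⟨y, hy, rfl⟩
  exact Set.mem_biUnion hD (hclopen.connectedComponent_subset ha hy).self_of_nhds

theorem NotIntoSupport.isHypersurface_preimage (hns : NotIntoSupport f ΔX)
    (hf : ContMDiff 𝓘(ℂ, Model n) 𝓘(ℂ, Model p) ω f) {D : PrimeDivisor p X}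
    (hD : 1 < ΔX.mult D) : IsHypersurface n (f ⁻¹' D.carrier) := by
  intro a
  obtain ⟨h, hh, -, hz⟩ := D.isHypersurface (f a)
  have hz' := hf.continuous.continuousAt.eventually hz
  refine ⟨fun z => h (f z), ContMDiffAt.comp a hh hf.contMDiffAt, fun h0 => ?_, hz'⟩
  refine hns.not_eventually_mem hf hD a ?_
  filter_upwards [h0, hz'] with z h1 h2 using h2.2 h1

theorem NotIntoSupport.not_eventually_coord_eq_zero (hns : NotIntoSupport f ΔX)
    (hf : ContMDiff 𝓘(ℂ, Model n) 𝓘(ℂ, Model p) ω f) (φ : AdaptedChart ΔX) {j : Fin p}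
    (hj : φ.m j ≠ 1) {a : Y} (ha : f a ∈ φ.chart.source) :
    ¬ ∀ᶠ z in 𝓝 a, φ.chart (f z) j = 0 := by
  obtain ⟨D, hD, -, hlt⟩ := φ.exists_label hj
  intro h0
  refine hns.not_eventually_mem hf hlt a ?_
  filter_upwards [h0, hf.continuous.continuousAt.eventually
    (φ.chart.open_source.eventually_mem ha)] with z h1 h2
  exact (φ.mem_iff D hlt _ h2).2 ⟨j, hD, h1⟩

end Preimages

/-! ### Reduced local equations of smooth components -/

section LocalEquations

open Filter

variable {p : ℕ} {X : Type*} [TopologicalSpace X] [ChartedSpace (Model p) X]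
  [IsManifold 𝓘(ℂ, Model p) ω X]

theorem IsStraightenedBy.isLocalEquation {D : Set X} {x : X}
    {η : OpenPartialHomeomorph X (Model p)} {k : Fin p} (h : IsStraightenedBy p D x η k) :
    IsLocalEquation p D x fun z => η z k := by
  obtain ⟨hη, hx, hxD, hiff⟩ := h
  have hev := η.open_source.eventually_mem hx
  refine ⟨holAt_coord hη hx k, ?_, fun g hg hgD => hg.exists_eq_mul_coord hη hx ?_⟩
  · filter_upwards [hev] with z hz hzD using (hiff z hz).1 hzD
  · filter_upwards [hev, hgD] with z hz hzD h0 using hzD ((hiff z hz).2 h0)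

/-- A coordinate is not a product of two functions that vanish at the same point. -/
theorem ne_zero_of_coord_eq_mul {x : X} {η : OpenPartialHomeomorph X (Model p)}
    (hη : η ∈ holCharts p X) (hx : x ∈ η.source) {k : Fin p} {g h : X → ℂ} (hg : HolAt p g x)
    (hh : HolAt p h x) (heq : ∀ᶠ z in 𝓝 x, η z k = g z * h z) (hx0 : h x = 0) : g x ≠ 0 := by
  intro hgx
  have h1 := (hg.analyticAt hη hx).differentiableAt.hasFDerivAt.mul
    (hh.analyticAt hη hx).differentiableAt.hasFDerivAt
  have h2 : (fun w : Model p => w k) =ᶠ[𝓝 (η x)] (g ∘ η.symm) * (h ∘ η.symm) := by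
    filter_upwards [(eventually_chart_iff (p := fun z => η z k = g z * h z) hx).2 heq,
      η.open_target.eventually_mem (η.map_source hx)] with w hw hwt
    rw [η.right_inv hwt] at hw
    exact hw
  have h3 := h1.congr_of_eventuallyEq h2
  have h4 := (ContinuousLinearMap.proj (R := ℂ) (φ := fun _ : Fin p => ℂ) k).hasFDerivAt
    (x := η x)
  have h5 := h4.unique h3
  have h6 := DFunLike.congr_fun h5 (Pi.single k 1)
  simp [η.left_inv hx, hgx, hx0] at h6

/-- As `D` is smooth at `x`, it has a reduced equation `η_k` with nonzero differential. This
vanishes on `x_j = 0`, so it is divisible by `x_j`, and the quotient is a unit because a product of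
two functions vanishing at `x` has zero differential there. -/
theorem AdaptedChart.exists_straightening {Δ : OrbifoldDivisor p X} (φ : AdaptedChart Δ)
    {D : PrimeDivisor p X} (hlt : 1 < Δ.mult D) (hreg : D.carrier ⊆ regularLocus p D.carrier)
    {j : Fin p} (hj : φ.label j = some D) {x : X} (hx : x ∈ φ.chart.source)
    (hx0 : φ.chart x j = 0) :
    ∃ h g : X → ℂ, IsLocalEquation p D.carrier x h ∧ HolAt p g x ∧ g x ≠ 0 ∧
      ∀ᶠ z in 𝓝 x, h z = g z * φ.chart z j := by
  obtain ⟨η, k, hη⟩ := hreg ((φ.mem_iff D hlt x hx).2 ⟨j, hj, hx0⟩)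
  obtain ⟨g, hg, heq⟩ := (holAt_coord hη.1 hη.2.1 k).exists_eq_mul_coord (i := j) φ.chart_mem hx (by
    filter_upwards [η.open_source.eventually_mem hη.2.1, φ.chart.open_source.eventually_mem hx]
      with z h1 h2 h3
    exact (hη.2.2.2 z h1).1 ((φ.mem_iff D hlt z h2).2 ⟨j, hj, h3⟩))
  exact ⟨_, g, hη.isLocalEquation, hg,
    ne_zero_of_coord_eq_mul hη.1 hη.2.1 hg (holAt_coord φ.chart_mem hx j) heq hx0, heq⟩

end LocalEquations

/-! ### The hypersurface of possible poles -/

section Wall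

open Filter

variable {n p : ℕ} {Y X : Type*} [TopologicalSpace Y] [ChartedSpace (Model n) Y]
  [TopologicalSpace X] [ChartedSpace (Model p) X] {f : Y → X} {ΔY : OrbifoldDivisor n Y}
  {ΔX : OrbifoldDivisor p X}

/-- An equation of the union of the supports of `Δ_Y` and of the preimage of `Δ_X`, in adapted
charts. -/
def wall (f : Y → X) (φ : AdaptedChart ΔX) (ψ : AdaptedChart ΔY) (w : Model n) : ℂ :=
  (∏ i with ψ.m i ≠ 1, w i) * ∏ j with φ.m j ≠ 1, components f φ.chart ψ.chart j w

theorem wall_eq_zero_iff {φ : AdaptedChart ΔX} {ψ : AdaptedChart ΔY} {w : Model n} :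
    wall f φ ψ w = 0 ↔ (∃ i, ψ.m i ≠ 1 ∧ w i = 0) ∨
      ∃ j, φ.m j ≠ 1 ∧ components f φ.chart ψ.chart j w = 0 := by
  simp [wall, Finset.prod_eq_zero_iff]

variable [IsManifold 𝓘(ℂ, Model n) ω Y]

/-- A good point of the wall is a regular point of it, with a distinguished equation if it lies
on the support of `Δ_Y`. -/
theorem exists_chart_wall {φ : AdaptedChart ΔX} {ψ : AdaptedChart ΔY} {b : Y}
    (hb : b ∈ ψ.chart.source) (hgood : IsGoodPoint (wall f φ ψ) (ψ.chart b)) :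
    ∃ χ ∈ holCharts n Y, ∃ k, b ∈ χ.source ∧ χ b k = 0 ∧
      (∀ᶠ z in 𝓝 b, wall f φ ψ (ψ.chart z) = 0 ↔ χ z k = 0) ∧
      ((χ = ψ.chart ∧ ψ.m k ≠ 1) ∨ ∀ i, ψ.m i ≠ 1 → ψ.chart b i ≠ 0) := by
  obtain ⟨v, hv, hv0, hvd, hvT⟩ := hgood
  obtain ⟨χ, hχ, k, hbχ, -, hcoord⟩ := exists_chart_of_fderiv_ne_zero ψ.chart_mem hb hv hvd
  have hk : χ b k = 0 := by rw [hcoord b hbχ, hv0]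
  have hT : ∀ᶠ z in 𝓝 b, wall f φ ψ (ψ.chart z) = 0 ↔ χ z k = 0 := by
    filter_upwards [(eventually_comp_chart_iff hb).2 hvT, χ.open_source.eventually_mem hbχ]
      with z h1 h2
    rw [h1, hcoord z h2]
  by_cases hα : ∀ i, ψ.m i ≠ 1 → ψ.chart b i ≠ 0
  · exact ⟨χ, hχ, k, hbχ, hk, hT, Or.inr hα⟩
  push Not at hα
  obtain ⟨i, hi, hbi⟩ := hα
  refine ⟨ψ.chart, ψ.chart_mem, i, hb, hbi, ?_, Or.inl ⟨rfl, hi⟩⟩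
  have hsub : ∀ᶠ z in 𝓝 b, ψ.chart z i = 0 → χ z k = 0 := by
    filter_upwards [hT] with z hz h0
    exact hz.1 (wall_eq_zero_iff.2 (Or.inl ⟨i, hi, h0⟩))
  -- The coordinate `y_i` vanishes only on the wall, so it is a unit times a power of the wall's
  -- equation. The exponent is positive because `y_i` vanishes at `b`; hence `y_i = 0` is the whole
  -- wall near `b`.
  obtain ⟨s, c, hc, hcb, hce⟩ := (holAt_coord ψ.chart_mem hb i).exists_eq_coord_pow_mul_unit
    hχ hbχ hk hsub
  have hs : s ≠ 0 := by
    rintro rfl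
    have := hce.self_of_nhds
    rw [hbi, pow_zero, one_mul] at this
    exact hcb this.symm
  filter_upwards [hT, hsub, hce] with z h1 h2 h3
  rw [h1]
  refine ⟨fun h => ?_, h2⟩
  rw [h3, h, zero_pow hs, zero_mul]

end Wall

/-! ### Orbifold morphisms pull sections back to sections -/

section MorphismEstimate

open Filter Asymptotics

variable {n p q N : ℕ} {Y X : Type*} [TopologicalSpace Y] [ChartedSpace (Model n) Y]
  [TopologicalSpace X] [ChartedSpace (Model p) X] [IsManifold 𝓘(ℂ, Model n) ω Y]
  [IsManifold 𝓘(ℂ, Model p) ω X] {f : Y → X} {ΔY : OrbifoldDivisor n Y}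
  {ΔX : OrbifoldDivisor p X}

/-- Smoothness of the components enters here: `x_j = 0` is all of `D` near `f b`, so the order `t`
of one coordinate is the full coefficient of `E` in `f^*D`. With several branches of `D` at `f b`
that coefficient would be a sum. -/
theorem IsOrbifoldMorphism.m_le (hmor : IsOrbifoldMorphism f ΔY ΔX)
    (hf : ContMDiff 𝓘(ℂ, Model n) 𝓘(ℂ, Model p) ω f) (hsm : ΔX.HasSmoothComponents)
    (φ : AdaptedChart ΔX) {b : Y} (hfb : f b ∈ φ.chart.source) {j : Fin p} (hj : φ.m j ≠ 1)
    {χ : OpenPartialHomeomorph Y (Model n)} (hχ : χ ∈ holCharts n Y) (hb : b ∈ χ.source)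
    {k : Fin n} (hk : χ b k = 0) {t : ℕ} (ht : 0 < t) {c : Y → ℂ} (hc : HolAt n c b)
    (hcb : c b ≠ 0) (heq : ∀ᶠ z in 𝓝 b, φ.chart (f z) j = χ z k ^ t * c z)
    {E : PrimeDivisor n Y} (hE : ∀ᶠ z in 𝓝 b, z ∈ E.carrier ↔ χ z k = 0) :
    φ.m j ≤ (t : WithTop ℚ≥0) * ΔY.mult E := by
  obtain ⟨D, hD, hm, hlt⟩ := φ.exists_label hj
  have h0 : φ.chart (f b) j = 0 := by
    rw [heq.self_of_nhds, hk, zero_pow ht.ne', zero_mul]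
  obtain ⟨h, g, hloc, hg, hgb, hge⟩ := φ.exists_straightening hlt (hsm D hlt) hD hfb h0
  obtain ⟨U, -, -, hst⟩ := isStraightenedBy_restr hχ hb hk hE
  rw [hm]
  refine hmor.mult_le D E t ht ⟨b, χ.restr U, k, h, fun z => c z * g (f z), hst, hloc,
    hc.mul (ContMDiffAt.comp b hg hf.contMDiffAt), ?_, ?_⟩
  · filter_upwards [heq, hf.continuous.continuousAt.eventually hge] with z h1 h2
    rw [h2, h1, OpenPartialHomeomorph.restr_apply]
    ring
  · exact fun hev => hev.self_of_nhds ⟨hst.2.2.1, mul_ne_zero hcb hgb⟩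

theorem analyticAt_wall (hf : ContMDiff 𝓘(ℂ, Model n) 𝓘(ℂ, Model p) ω f) {φ : AdaptedChart ΔX}
    {ψ : AdaptedChart ΔY} {a : Y} (ha : a ∈ ψ.chart.source) (hfa : f a ∈ φ.chart.source) :
    AnalyticAt ℂ (wall f φ ψ) (ψ.chart a) :=
  (Finset.analyticAt_fun_prod _ fun i _ => analyticAt_coord i _).mul
    (Finset.analyticAt_fun_prod _ fun j _ =>
      analyticAt_components hf φ.chart_mem ψ.chart_mem ha hfa j)

theorem not_eventually_wall_eq_zero (hf : ContMDiff 𝓘(ℂ, Model n) 𝓘(ℂ, Model p) ω f)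
    (hns : NotIntoSupport f ΔX) {φ : AdaptedChart ΔX}
    {ψ : AdaptedChart ΔY} {a : Y} (ha : a ∈ ψ.chart.source) (hfa : f a ∈ φ.chart.source) :
    ¬ ∀ᶠ w in 𝓝 (ψ.chart a), wall f φ ψ w = 0 := by
  intro h
  have hcomp : ∀ j, HolAt n (components f φ.chart ψ.chart j) (ψ.chart a) := fun j =>
    holAt_model_iff.2 (analyticAt_components hf φ.chart_mem ψ.chart_mem ha hfa j)
  have hcoord : ∀ i, HolAt n (fun w : Model n => w i) (ψ.chart a) := fun i =>
    holAt_model_iff.2 (analyticAt_coord i _)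
  refine not_eventually_prod_eq_zero (Finset.univ.filter fun j => φ.m j ≠ 1)
    (fun j _ => hcomp j) (fun j hj => ?_) (HolAt.eventually_eq_zero_of_mul
      (holAt_finset_prod (Finset.univ.filter fun i => ψ.m i ≠ 1) fun i _ => hcoord i)
      (holAt_finset_prod _ fun j _ => hcomp j)
      (not_eventually_prod_eq_zero _ (fun i _ => hcoord i)
        fun i _ => not_eventually_coord_eq_zero i _) h)
  intro h0
  refine hns.not_eventually_coord_eq_zero hf φ (Finset.mem_filter.1 hj).2 hfa ?_
  exact (eventually_chart_iff (p := fun z => φ.chart (f z) j = 0) ha).1 h0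

/-- Supplies the hypotheses of `isBigO_prod_minor` at a smooth point of the wall. On the support of
`Δ_Y` the equation `v` is an adapted coordinate and `mE` its multiplicity. Off the support `mE = 1`,
and the divisor to which the morphism condition applies is a component of `f⁻¹(D)`. -/
theorem IsOrbifoldMorphism.isBigO_wall (hmor : IsOrbifoldMorphism f ΔY ΔX)
    (hf : ContMDiff 𝓘(ℂ, Model n) 𝓘(ℂ, Model p) ω f) (hsm : ΔX.HasSmoothComponents)
    (φ : AdaptedChart ΔX) (ψ : AdaptedChart ΔY) {b : Y} (hb : b ∈ ψ.chart.source)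
    (hfb : f b ∈ φ.chart.source) (hgood : IsGoodPoint (wall f φ ψ) (ψ.chart b))
    (J : Fin N → Idx p q) (I : Fin N → Idx n q) :
    (fun w => (∏ l, minor (components f φ.chart ψ.chart) (J l) (I l) w) *
        ∏ i, w i ^ (occFun I i - ceilDiv (occFun I i) (ψ.m i))) =O[𝓝 (ψ.chart b)]
      fun w => ∏ j, components f φ.chart ψ.chart j w ^
        (occFun J j - ceilDiv (occFun J j) (φ.m j)) := by
  obtain ⟨χ, hχ, k, hbχ, hk, hT, hcase⟩ := exists_chart_wall hb hgood
  have hsrcY := ψ.chart.open_source.eventually_mem hb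
  have hsrcX := hf.continuous.continuousAt.eventually (φ.chart.open_source.eventually_mem hfb)
  have hwallX : ∀ᶠ z in 𝓝 b, ∀ j, φ.m j ≠ 1 → φ.chart (f z) j = 0 → χ z k = 0 := by
    filter_upwards [hT, hsrcY] with z h1 h2 j hj h0
    exact h1.1 (wall_eq_zero_iff.2 (Or.inr ⟨j, hj, by simpa [components, ψ.chart.left_inv h2]⟩))
  have hwallY : ∀ᶠ z in 𝓝 b, ∀ i, ψ.m i ≠ 1 → ψ.chart z i = 0 → χ z k = 0 := by
    filter_upwards [hT] with z h1 i hi h0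
    exact h1.1 (wall_eq_zero_iff.2 (Or.inl ⟨i, hi, h0⟩))
  have hhol : ∀ j, HolAt n (fun z => φ.chart (f z) j) b := fun j =>
    ContMDiffAt.comp b (holAt_coord φ.chart_mem hfb j) hf.contMDiffAt
  have hfac : ∀ j, ∃ (t : ℕ) (c : Y → ℂ), HolAt n c b ∧ (φ.m j ≠ 1 → c b ≠ 0) ∧
      (φ.m j = 1 → t = 0) ∧ ∀ᶠ z in 𝓝 b, φ.chart (f z) j = χ z k ^ t * c z := by
    intro j
    by_cases hj : φ.m j = 1
    -- Coordinates of multiplicity one occur in the denominator with exponent zero, so they are left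
    -- unfactored, with `t = 0`.
    · exact ⟨0, _, hhol j, fun h => absurd hj h, fun _ => rfl, by simp⟩
    · obtain ⟨t, c, hc, hcb, hce⟩ := (hhol j).exists_eq_coord_pow_mul_unit hχ hbχ hk
        (hwallX.mono fun z hz => hz j hj)
      exact ⟨t, c, hc, fun _ => hcb, fun h => absurd h hj, hce⟩
  choose t c hc hcb htj hce using hfac
  have hca : ∀ j, AnalyticAt ℂ (c j ∘ ψ.chart.symm) (ψ.chart b) := fun j =>
    (hc j).analyticAt ψ.chart_mem hb
  have hpos : ∀ j, 0 < t j → φ.m j ≠ 1 := fun j ht h => ht.ne' (htj j h)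
  have hFe : ∀ j, ∀ᶠ w in 𝓝 (ψ.chart b), components f φ.chart ψ.chart j w =
      χ (ψ.chart.symm w) k ^ t j * (c j ∘ ψ.chart.symm) w := fun j =>
    (eventually_chart_iff (p := fun z => φ.chart (f z) j = χ z k ^ t j * c j z) hb).2 (hce j)
  have hcb' : ∀ j, φ.m j ≠ 1 → (c j ∘ ψ.chart.symm) (ψ.chart b) ≠ 0 := fun j hj => by
    simpa [ψ.chart.left_inv hb] using hcb j hj
  rcases hcase with ⟨rfl, hkm⟩ | hβ
  · -- `b` lies on a component of the support of `Δ_Y`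
    obtain ⟨E, hE, hmE, hltE⟩ := ψ.exists_label hkm
    have hEev : ∀ᶠ z in 𝓝 b, z ∈ E.carrier ↔ ψ.chart z k = 0 := by
      filter_upwards [hsrcY, hwallY] with z h1 h2
      rw [ψ.mem_iff E hltE z h1]
      refine ⟨fun ⟨i, hi, h0⟩ => h2 i ?_ h0, fun h => ⟨k, hE, h⟩⟩
      rw [AdaptedChart.m, hi]
      exact hltE.ne'
    refine isBigO_prod_minor (v := fun w => w k) (t := t) (analyticAt_coord k _) hca
      (fun j => ?_) φ.one_le_m hcb' (ψ.one_le_m k) (fun j hj => ?_) (Or.inl ⟨k, rfl, rfl⟩) J I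
    · filter_upwards [hFe j, ψ.chart.open_target.eventually_mem (ψ.chart.map_source hb)]
        with w h1 h2
      rwa [ψ.chart.right_inv h2] at h1
    · rw [hmE]
      exact hmor.m_le hf hsm φ hfb (hpos j hj) hχ hb hk hj (hc j) (hcb j (hpos j hj)) (hce j) hEev
  · refine isBigO_prod_minor (v := fun w => χ (ψ.chart.symm w) k) (t := t)
      ((holAt_coord hχ hbχ k).analyticAt ψ.chart_mem hb) hca hFe φ.one_le_m hcb' le_rfl
      (fun j hj => ?_) (Or.inr rfl) J I
    obtain ⟨D, hD, -, hltD⟩ := φ.exists_label (hpos j hj)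
    have hpre : ∀ᶠ z in 𝓝 b, z ∈ f ⁻¹' D.carrier ↔ χ z k = 0 := by
      filter_upwards [hsrcX, hwallX, hce j] with z h1 h2 h3
      rw [Set.mem_preimage, φ.mem_iff D hltD _ h1]
      refine ⟨fun ⟨i, hi, h0⟩ => h2 i ?_ h0, fun h => ⟨j, hD, ?_⟩⟩
      · rw [AdaptedChart.m, hi]
        exact hltD.ne'
      · rw [h3, h, zero_pow hj.ne', zero_mul]
    obtain ⟨U, -, -, hst⟩ := isStraightenedBy_restr hχ hbχ hk hpre
    obtain ⟨E, hE⟩ := (hmor.notIntoSupport.isHypersurface_preimage hf hltD).exists_primeDivisor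
      ⟨_, k, hst⟩
    have hmE : ΔY.mult E = 1 := by
      by_contra hne
      have hltE := lt_of_le_of_ne (ΔY.one_le_mult E) (Ne.symm hne)
      have hbE : b ∈ E.carrier := hE.self_of_nhds.2 (hpre.self_of_nhds.2 hk)
      obtain ⟨i, hi, h0⟩ := (ψ.mem_iff E hltE b hb).1 hbE
      refine hβ i ?_ h0
      rw [AdaptedChart.m, hi]
      exact hne
    rw [← hmE]
    refine hmor.m_le hf hsm φ hfb (hpos j hj) hχ hbχ hk hj (hc j) (hcb j (hpos j hj)) (hce j) ?_
    filter_upwards [hE, hpre] with z h1 h2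
    rw [h1, h2]

theorem IsOrbifoldMorphism.pullbackIncluded (hmor : IsOrbifoldMorphism f ΔY ΔX)
    (hf : ContMDiff 𝓘(ℂ, Model n) 𝓘(ℂ, Model p) ω f) (hsm : ΔX.HasSmoothComponents)
    (hY : ΔY.IsSmooth) (N q : ℕ) : PullbackIncluded f ΔY ΔX N q := by
  intro V σ _ hσ a haV
  obtain ⟨φ, hfa, A, hA, hσA⟩ := hσ (f a) haV
  obtain ⟨ψ, ha⟩ := hY a
  refine ⟨ψ, ha, exists_coeff_pullbackSym hf φ ψ ha hfa (fun J I => ?_) hA hσA⟩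
  have hcomp : ∀ j, AnalyticAt ℂ (components f φ.chart ψ.chart j) (ψ.chart a) :=
    analyticAt_components hf φ.chart_mem ψ.chart_mem ha hfa
  refine exists_eq_mul_of_isBigO (analyticAt_wall hf ha hfa)
    (not_eventually_wall_eq_zero hf hmor.notIntoSupport ha hfa)
    (Finset.analyticAt_fun_prod _ fun j _ => (hcomp j).fun_pow _)
    ((Finset.analyticAt_fun_prod _ fun l _ => analyticAt_minor hcomp _ _).mul
      (Finset.analyticAt_fun_prod _ fun i _ => (analyticAt_coord i _).fun_pow _)) ?_ ?_
  · refine Eventually.of_forall fun w hw => ?_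
    obtain ⟨j, -, hj⟩ := Finset.prod_eq_zero_iff.1 hw
    refine wall_eq_zero_iff.2 (Or.inr ⟨j, fun h => ?_, eq_zero_of_pow_eq_zero hj⟩)
    simp [h, ceilDiv_one] at hj
  · filter_upwards [ψ.chart.open_target.eventually_mem (ψ.chart.map_source ha),
      (eventually_chart_iff (p := fun z => f z ∈ φ.chart.source) ha).2
        (hf.continuous.continuousAt.eventually (φ.chart.open_source.eventually_mem hfa))]
      with w hw hfw _ hgood
    have := hmor.isBigO_wall hf hsm φ ψ (ψ.chart.map_target hw) hfw
      (by rwa [ψ.chart.right_inv hw]) J I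
    rwa [ψ.chart.right_inv hw] at this

end MorphismEstimate

/-! ### Orders along the Euler field -/

section EulerField

open Filter Asymptotics

variable {n : ℕ} {i : Fin n} {b : Model n}

/-- The derivative of `X` along the Euler field `w_i ∂/∂w_i`. -/
def eulerDeriv (i : Fin n) (X : Model n → ℂ) (w : Model n) : ℂ :=
  fderiv ℂ X w (Pi.single i (w i))

theorem eulerDeriv_eq (i : Fin n) (X : Model n → ℂ) (w : Model n) :
    eulerDeriv i X w = w i * fderiv ℂ X w (Pi.single i 1) := by
  rw [eulerDeriv, show (Pi.single i (w i) : Model n) = w i • Pi.single i 1 by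
    rw [← Pi.single_smul, smul_eq_mul, mul_one], map_smul, smul_eq_mul]

theorem analyticAt_fderiv_single {X : Model n → ℂ} (hX : AnalyticAt ℂ X b) :
    AnalyticAt ℂ (fun w => fderiv ℂ X w (Pi.single i 1)) b :=
  AnalyticAt.fun_comp (g := ContinuousLinearMap.apply ℂ ℂ (Pi.single i (1 : ℂ) : Model n))
    (ContinuousLinearMap.analyticAt _ _) hX.fderiv

/-- The Euler field preserves the order along `w_i = 0`: it multiplies `w_i ^ T` by `T`. If `T > 0`
and `c` is a unit at a point of the hyperplane, the new cofactor is again a unit there, since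
`eulerDeriv i c` vanishes on the hyperplane. -/
theorem eventually_eulerDeriv_eq {X c : Model n → ℂ} {T : ℕ} (hc : AnalyticAt ℂ c b)
    (hX : ∀ᶠ w in 𝓝 b, X w = w i ^ T * c w) :
    ∀ᶠ w in 𝓝 b, eulerDeriv i X w = w i ^ T * (T * c w + eulerDeriv i c w) := by
  filter_upwards [hX.eventually_nhds, hc.eventually_analyticAt] with w hw hcw
  have hXw : X =ᶠ[𝓝 w] fun w => w i ^ T * c w := hw
  have hi : HasFDerivAt (fun w : Model n => w i)
      (ContinuousLinearMap.proj (R := ℂ) (φ := fun _ : Fin n => ℂ) i) w :=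
    (ContinuousLinearMap.proj (R := ℂ) (φ := fun _ : Fin n => ℂ) i).hasFDerivAt
  have hder := (hi.pow T).mul hcw.differentiableAt.hasFDerivAt
  rw [eulerDeriv, hXw.fderiv_eq]
  change fderiv ℂ ((fun w : Model n => w i ^ T) * c) w _ = _
  rw [hder.fderiv]
  rcases T with _ | T
  · simp [eulerDeriv]
  · simp [eulerDeriv, pow_succ]
    ring

theorem isBigO_coord_pow {l : Filter (Model n)} (hl : l ≤ 𝓝 b) {a a' : ℕ} (h : a ≤ a') :
    (fun w : Model n => w i ^ a') =O[l] fun w => w i ^ a := by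
  have h1 : (fun w : Model n => w i ^ (a' - a)) =O[l] fun _ => (1 : ℂ) :=
    (((analyticAt_coord i b).fun_pow _).continuousAt.isBigO_one ℂ).mono hl
  have h2 := (isBigO_refl (fun w : Model n => w i ^ a) l).mul h1
  refine h2.congr (fun w => ?_) fun w => mul_one _
  rw [← pow_add, Nat.add_sub_cancel' h]

theorem neBot_nhdsWithin_coord_ne_zero (i : Fin n) (b : Model n) :
    (𝓝[{w : Model n | w i ≠ 0}] b).NeBot := by
  rw [← mem_closure_iff_nhdsWithin_neBot, mem_closure_iff_frequently]
  intro h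
  refine not_eventually_coord_eq_zero i b ?_
  filter_upwards [h] with w hw
  simpa using hw

theorem le_of_isBigO_coord_pow (hb : b i = 0) {a a' : ℕ}
    (h : (fun w : Model n => w i ^ a) =O[𝓝[{w : Model n | w i ≠ 0}] b] fun w => w i ^ a') :
    a' ≤ a := by
  by_contra hlt
  push Not at hlt
  have := neBot_nhdsWithin_coord_ne_zero i b
  have ht : Tendsto (fun w : Model n => w i) (𝓝[{w : Model n | w i ≠ 0}] b) (𝓝 0) := by
    have := (analyticAt_coord i b).continuousAt.tendsto
    rw [hb] at this
    exact this.mono_left nhdsWithin_le_nhds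
  have h1 := (isLittleO_pow_pow (𝕜 := ℂ) hlt).comp_tendsto ht
  refine isLittleO_irrefl ?_ (h.trans_isLittleO h1)
  refine Eventually.frequently ?_
  filter_upwards [self_mem_nhdsWithin] with w hw
  exact pow_ne_zero _ hw

/-- Both `X` and its Euler derivative are `w_i ^ T` times a unit, so the product has order exactly
`T k`, independently of `N`. The filter avoids `w_i = 0`, where the exponent may be negative. -/
theorem isBigO_zpow_mul_eulerDeriv_pow {X c : Model n → ℂ} {T : ℕ} (hb : b i = 0) (hT : 0 < T)
    (hc : AnalyticAt ℂ c b) (hcb : c b ≠ 0) (hX : ∀ᶠ w in 𝓝 b, X w = w i ^ T * c w) (k N : ℕ) :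
    (fun w : Model n => w i ^ (T * k)) =O[𝓝[{w : Model n | w i ≠ 0}] b]
      (fun w => X w ^ ((k : ℤ) - (N : ℤ)) * eulerDeriv i X w ^ N) ∧
    (fun w => X w ^ ((k : ℤ) - (N : ℤ)) * eulerDeriv i X w ^ N)
      =O[𝓝[{w : Model n | w i ≠ 0}] b] (fun w : Model n => w i ^ (T * k)) := by
  set U : Model n → ℂ := fun w => c w ^ ((k : ℤ) - (N : ℤ)) *
    (T * c w + w i * fderiv ℂ c w (Pi.single i 1)) ^ N with hU
  have hUc : ContinuousAt U b := by
    refine (hc.continuousAt.zpow₀ _ (Or.inl hcb)).mul (ContinuousAt.pow ?_ _)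
    exact (continuousAt_const.mul hc.continuousAt).add
      ((analyticAt_coord i b).continuousAt.mul (analyticAt_fderiv_single hc).continuousAt)
  have hUb : U b ≠ 0 := by
    refine mul_ne_zero (zpow_ne_zero _ hcb) (pow_ne_zero _ ?_)
    rw [hb, zero_mul, add_zero]
    exact mul_ne_zero (Nat.cast_ne_zero.2 hT.ne') hcb
  have heq : ∀ᶠ w in 𝓝[{w : Model n | w i ≠ 0}] b, w i ^ (T * k) * U w =
      X w ^ ((k : ℤ) - (N : ℤ)) * eulerDeriv i X w ^ N := by
    filter_upwards [self_mem_nhdsWithin, hX.filter_mono nhdsWithin_le_nhds,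
      (eventually_eulerDeriv_eq hc hX).filter_mono nhdsWithin_le_nhds] with w hw h1 h2
    rw [h1, h2, eulerDeriv_eq, hU, mul_zpow, mul_pow]
    have hwT : w i ^ T ≠ 0 := pow_ne_zero _ hw
    have h3 : (w i ^ T) ^ ((k : ℤ) - (N : ℤ)) * (w i ^ T) ^ N = w i ^ (T * k) := by
      rw [← zpow_natCast (w i ^ T) N, ← zpow_add₀ hwT, sub_add_cancel, zpow_natCast, pow_mul]
    rw [← h3]
    ring
  have hone : U =O[𝓝[{w : Model n | w i ≠ 0}] b] fun _ => (1 : ℂ) :=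
    (hUc.isBigO_one ℂ).mono nhdsWithin_le_nhds
  have hinv : (fun w => (U w)⁻¹) =O[𝓝[{w : Model n | w i ≠ 0}] b] fun _ => (1 : ℂ) :=
    ((hUc.inv₀ hUb).isBigO_one ℂ).mono nhdsWithin_le_nhds
  constructor
  · refine IsBigO.congr' ((isBigO_refl (fun w : Model n => w i ^ (T * k) * U w) _).mul hinv) ?_
      (heq.mono fun w hw => (mul_one _).trans hw)
    filter_upwards [(hUc.eventually_ne hUb).filter_mono nhdsWithin_le_nhds] with w hw
    rw [mul_assoc, mul_inv_cancel₀ hw, mul_one]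
  · exact IsBigO.congr' ((isBigO_refl (fun w : Model n => w i ^ (T * k)) _).mul hone) heq
      (Eventually.of_forall fun w => mul_one _)

/-- A coordinate of multiplicity one has no pole, and each Euler derivative contributes one factor
`w_i`. If `s = 0`, the coordinate is a unit and the same bound applies. If `s > 0`, its multiplicity
is that of `E` and the order is `s⌈k/mE⌉`. -/
theorem isBigO_factor {X : Model n → ℂ} (hb : b i = 0) (hXa : AnalyticAt ℂ X b)
    {m mE : WithTop ℚ≥0} (hmE : 1 ≤ mE)
    (hX : m = 1 ∨ ∃ (s : ℕ) (d : Model n → ℂ), AnalyticAt ℂ d b ∧ d b ≠ 0 ∧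
      (∀ᶠ w in 𝓝 b, X w = w i ^ s * d w) ∧ (0 < s → m = mE)) (k : ℕ) :
    (fun w => X w ^ ((ceilDiv k m : ℤ) - (k : ℤ)) * eulerDeriv i X w ^ k)
      =O[𝓝[{w : Model n | w i ≠ 0}] b] fun w => w i ^ ceilDiv k mE := by
  have heul : (fun w => eulerDeriv i X w ^ k) =O[𝓝[{w : Model n | w i ≠ 0}] b]
      fun w => w i ^ ceilDiv k mE := by
    have h1 : (fun w => eulerDeriv i X w) =O[𝓝[{w : Model n | w i ≠ 0}] b] fun w => w i := by
      have h2 := (isBigO_refl (fun w : Model n => w i) (𝓝[{w : Model n | w i ≠ 0}] b)).mul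
        (((analyticAt_fderiv_single (i := i) hXa).continuousAt.isBigO_one ℂ).mono
          nhdsWithin_le_nhds)
      exact h2.congr (fun w => (eulerDeriv_eq i X w).symm) fun w => mul_one _
    exact (h1.pow k).trans (isBigO_coord_pow nhdsWithin_le_nhds (ceilDiv_le hmE k))
  rcases hX with rfl | ⟨s, d, hd, hdb, hXd, hs⟩
  · simpa [ceilDiv_one] using heul
  rcases Nat.eq_zero_or_pos s with rfl | hs0
  · have hXb : X b ≠ 0 := by
      rw [hXd.self_of_nhds, pow_zero, one_mul]
      exact hdb
    have h1 : (fun w => X w ^ ((ceilDiv k m : ℤ) - (k : ℤ))) =O[𝓝[{w : Model n | w i ≠ 0}] b]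
        fun _ => (1 : ℂ) :=
      ((hXa.continuousAt.zpow₀ _ (Or.inl hXb)).isBigO_one ℂ).mono nhdsWithin_le_nhds
    simpa using h1.mul heul
  · rw [hs hs0]
    refine (isBigO_zpow_mul_eulerDeriv_pow hb hs0 hd hdb hXd _ k).2.trans
      (isBigO_coord_pow nhdsWithin_le_nhds ?_)
    exact Nat.le_mul_of_pos_left _ hs0

theorem ceilDiv_sum_le {ι : Type*} (s : Finset ι) (k : ι → ℕ) (m : WithTop ℚ≥0) :
    ceilDiv (∑ i ∈ s, k i) m ≤ ∑ i ∈ s, ceilDiv (k i) m := by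
  induction m using WithTop.recTopCoe with
  | top => simp [ceilDiv_top]
  | coe r =>
    simp only [ceilDiv_coe]
    rw [Nat.ceil_le]
    push_cast
    rw [Finset.sum_div]
    exact Finset.sum_le_sum fun i _ => Nat.le_ceil _

/-- The element of a set with one element. -/
def Idx.elem (J : Idx n 1) : Fin n := J.1.orderEmbOfFin J.2 0

theorem Idx.mem_iff (J : Idx n 1) (i : Fin n) : i ∈ J.1 ↔ J.elem = i := by
  obtain ⟨a, ha⟩ := Finset.card_eq_one.1 J.2
  have h : J.elem ∈ J.1 := Finset.orderEmbOfFin_mem _ _ _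
  rw [ha, Finset.mem_singleton] at h
  rw [ha, Finset.mem_singleton, h, eq_comm]

theorem prod_elem_eq {N : ℕ} (I : Fin N → Idx n 1) (θ : Fin n → ℂ) :
    ∏ l, θ (I l).elem = ∏ i, θ i ^ occFun I i := by
  rw [← Finset.prod_fiberwise Finset.univ fun l => (I l).elem]
  refine Finset.prod_congr rfl fun i _ => ?_
  rw [occFun, Finset.prod_congr rfl fun l hl => by rw [(Finset.mem_filter.1 hl).2],
    Finset.prod_const]
  simp only [Idx.mem_iff]

theorem sum_occFun {N : ℕ} (I : Fin N → Idx n 1) : ∑ i, occFun I i = N := by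
  have h := sum_sum_eq_sum_mul_occFun I fun _ => 1
  simp only [one_mul] at h
  rw [← h]
  simp [fun l => (I l).2]

/-- Grouping equal indices reduces this to `isBigO_factor`. The orders `⌈k_i/mE⌉` add up to at least
`⌈N/mE⌉`, because rounding up is subadditive and the `k_i` have sum `N`. -/
theorem isBigO_prod_factor {N : ℕ} {X : Fin n → Model n → ℂ} (hb : b i = 0)
    (hXa : ∀ k, AnalyticAt ℂ (X k) b) {m : Fin n → WithTop ℚ≥0} {mE : WithTop ℚ≥0}
    (hmE : 1 ≤ mE)
    (hX : ∀ k, m k = 1 ∨ ∃ (s : ℕ) (d : Model n → ℂ), AnalyticAt ℂ d b ∧ d b ≠ 0 ∧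
      (∀ᶠ w in 𝓝 b, X k w = w i ^ s * d w) ∧ (0 < s → m k = mE)) (I : Fin N → Idx n 1) :
    (fun w => (∏ k, X k w ^ ((ceilDiv (occFun I k) (m k) : ℤ) - (occFun I k : ℤ))) *
        ∏ l, eulerDeriv i (X (I l).elem) w)
      =O[𝓝[{w : Model n | w i ≠ 0}] b] fun w => w i ^ ceilDiv N mE := by
  have h1 : ∀ w, (∏ k, X k w ^ ((ceilDiv (occFun I k) (m k) : ℤ) - (occFun I k : ℤ))) *
        ∏ l, eulerDeriv i (X (I l).elem) w =
      ∏ k, X k w ^ ((ceilDiv (occFun I k) (m k) : ℤ) - (occFun I k : ℤ)) *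
        eulerDeriv i (X k) w ^ occFun I k := fun w => by
    rw [prod_elem_eq I fun k => eulerDeriv i (X k) w, Finset.prod_mul_distrib]
  simp only [h1]
  have h2 := IsBigO.finsetProd (s := Finset.univ) fun k _ =>
    isBigO_factor hb (hXa k) hmE (hX k) (occFun I k)
  refine h2.trans ?_
  simp only [Finset.prod_pow_eq_pow_sum]
  refine isBigO_coord_pow nhdsWithin_le_nhds ?_
  have h3 := ceilDiv_sum_le Finset.univ (occFun I) mE
  rwa [sum_occFun] at h3

end EulerField

/-! ### Recovering the multiplicities from the orders -/

section Numerators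

theorem ceilDiv_mul_eq {r : ℚ≥0} (hr : 0 < r) {N : ℕ} (h : r.num ∣ N) :
    (ceilDiv N (r : WithTop ℚ≥0) : ℚ≥0) * r = N := by
  obtain ⟨k, rfl⟩ := h
  have h1 : ((r.num * k : ℕ) : ℚ≥0) / r = ((k * r.den : ℕ) : ℚ≥0) := by
    rw [div_eq_iff hr.ne']
    push_cast
    rw [mul_assoc, mul_comm (r.den : ℚ≥0), NNRat.mul_den_eq_num]
    ring
  rw [ceilDiv_coe, h1, Nat.ceil_natCast, ← h1, div_mul_cancel₀ _ hr.ne']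

/-- Divisibility of `N` by the numerator removes the rounding in `N / m`, while rounding `N / mE` up
only strengthens the hypothesis. For infinite `m` the right side is zero, and `N > 0` then excludes
finite `mE`. -/
theorem le_mul_of_ceilDiv_le {m mE : WithTop ℚ≥0} (hm : 1 ≤ m) (hmE : 1 ≤ mE) {N T : ℕ}
    (hN : 0 < N) (hT : 0 < T) (hnum : num m ∣ N) (h : ceilDiv N mE ≤ T * ceilDiv N m) :
    m ≤ (T : WithTop ℚ≥0) * mE := by
  induction mE using WithTop.recTopCoe with
  | top => rw [WithTop.mul_top (by exact_mod_cast hT.ne')]; exact le_top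
  | coe r =>
    have hr : 0 < r := one_pos.trans_le (by exact_mod_cast hmE)
    have h1 : (N : ℚ≥0) / r ≤ ceilDiv N (r : WithTop ℚ≥0) := Nat.le_ceil _
    have hNq : (0 : ℚ≥0) < N := by exact_mod_cast hN
    induction m using WithTop.recTopCoe with
    | top =>
      rw [ceilDiv_top, mul_zero, Nat.le_zero] at h
      rw [h, Nat.cast_zero] at h1
      exact absurd h1 (not_le.2 (div_pos hNq hr))
    | coe s =>
      have hs : 0 < s := one_pos.trans_le (by exact_mod_cast hm)
      have h2 := ceilDiv_mul_eq hs (N := N) hnum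
      have h3 : (ceilDiv N (r : WithTop ℚ≥0) : ℚ≥0) ≤ T * ceilDiv N (s : WithTop ℚ≥0) := by
        exact_mod_cast h
      have h4 : (N : ℚ≥0) * s ≤ N * (T * r) := by
        calc (N : ℚ≥0) * s = N / r * (r * s) := by field_simp
          _ ≤ (T * ceilDiv N (s : WithTop ℚ≥0)) * (r * s) := by gcongr; exact h1.trans h3
          _ = (ceilDiv N (s : WithTop ℚ≥0) * s) * (T * r) := by ring
          _ = _ := by rw [h2]
      have h5 : s ≤ T * r := le_of_mul_le_mul_left h4 hNq
      exact_mod_cast h5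

end Numerators

/-! ### Evaluation of symmetric differentials at tangent vectors -/

section Evaluation

open Filter

variable {n p q N : ℕ} {Y X : Type*} [TopologicalSpace Y] [ChartedSpace (Model n) Y]
  [TopologicalSpace X] [ChartedSpace (Model p) X]

/-- The evaluation of symmetric products of covectors at a tangent vector. -/
def evalSym {y : Y} (ξ : TangentSpace 𝓘(ℂ, Model n) y) : SymFibre n 1 y →ₐ[ℂ] ℂ :=
  SymmetricAlgebra.lift
    { toFun := fun α => α fun _ => ξ
      map_add' := fun _ _ => rfl
      map_smul' := fun _ _ => rfl }

theorem evalSym_ι {y : Y} (ξ : TangentSpace 𝓘(ℂ, Model n) y) (α : FormFibre n 1 y) :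
    evalSym ξ (SymmetricAlgebra.ι ℂ _ α) = α fun _ => ξ :=
  SymmetricAlgebra.lift_ι_apply _ _

theorem dForm_one_apply (φ : OpenPartialHomeomorph Y (Model n)) (J : Idx n 1) {y : Y}
    (ξ : TangentSpace 𝓘(ℂ, Model n) y) :
    dForm φ J y (fun _ => ξ) = coordDifferentials φ (J.1.orderEmbOfFin J.2) y ξ 0 :=
  Matrix.det_fin_one (Matrix.of fun _ : Fin 1 =>
    coordDifferentials φ (J.1.orderEmbOfFin J.2) y ξ)

theorem isOrbSection_generator [IsManifold 𝓘(ℂ, Model p) ω X] {Δ : OrbifoldDivisor p X}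
    (φ : AdaptedChart Δ) (s : Sym (Idx p q) N) :
    IsOrbSection Δ N q Δ.support φ.chart.source (generator φ s) := by
  classical
  intro a ha
  refine ⟨φ, ha, fun s' _ => if s' = s then 1 else 0, fun s' => holAt_const _, ?_⟩
  exact Eventually.of_forall fun z _ => by simp

variable {χ : OpenPartialHomeomorph Y (Model n)}

theorem exists_euler_vector (hχ : χ ∈ holCharts n Y) {y : Y} (hy : y ∈ χ.source)
    (u : Model n) : ∃ ξ : TangentSpace 𝓘(ℂ, Model n) y,
      mfderiv 𝓘(ℂ, Model n) 𝓘(ℂ, Model n) χ y ξ = u := by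
  have h : χ.MDifferentiable 𝓘(ℂ, Model n) 𝓘(ℂ, Model n) :=
    ⟨(contMDiffOn_of_mem_maximalAtlas hχ).mdifferentiableOn (by simp),
      (contMDiffOn_symm_of_mem_maximalAtlas hχ).mdifferentiableOn (by simp)⟩
  exact h.mfderiv_surjective hy u

variable [IsManifold 𝓘(ℂ, Model n) ω Y] [IsManifold 𝓘(ℂ, Model p) ω X]

theorem dForm_mfderiv_eq_eulerDeriv {f : Y → X}
    (hf : ContMDiff 𝓘(ℂ, Model n) 𝓘(ℂ, Model p) ω f)
    {φ : OpenPartialHomeomorph X (Model p)} (hφ : φ ∈ holCharts p X) (hχ : χ ∈ holCharts n Y)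
    {y : Y} (hy : y ∈ χ.source) (hfy : f y ∈ φ.source) {i : Fin n}
    {ξ : TangentSpace 𝓘(ℂ, Model n) y}
    (hξ : mfderiv 𝓘(ℂ, Model n) 𝓘(ℂ, Model n) χ y ξ = (Pi.single i (χ y i) : Model n))
    (J : Idx p 1) :
    dForm φ J (f y) (fun _ => mfderiv 𝓘(ℂ, Model n) 𝓘(ℂ, Model p) f y ξ) =
      eulerDeriv i (components f φ χ J.elem) (χ y) := by
  rw [dForm_one_apply, coordDifferentials_mfderiv hf hφ hχ hy hfy, hξ]
  rfl

/-- The chart `χ` straightens `E` and `ψ` is adapted to `Δ_Y`; they need not coincide. The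
coordinates of `ψ` are treated as components of the identity map, so source and target are computed
alike. -/
theorem evalSym_generator {ΔY : OrbifoldDivisor n Y} (ψ : AdaptedChart ΔY)
    (hχ : χ ∈ holCharts n Y) {y : Y} (hy : y ∈ χ.source) (hyψ : y ∈ ψ.chart.source) {i : Fin n}
    {ξ : TangentSpace 𝓘(ℂ, Model n) y}
    (hξ : mfderiv 𝓘(ℂ, Model n) 𝓘(ℂ, Model n) χ y ξ = (Pi.single i (χ y i) : Model n))
    (I : Fin N → Idx n 1) :
    evalSym ξ (generator ψ (symOf I) y) =
      (∏ k, components id ψ.chart χ k (χ y) ^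
        ((ceilDiv (occFun I k) (ψ.m k) : ℤ) - (occFun I k : ℤ))) *
        ∏ l, eulerDeriv i (components id ψ.chart χ (I l).elem) (χ y) := by
  rw [generator_symOf, map_smul, map_prod, smul_eq_mul]
  congr 1
  · simp [components, χ.left_inv hy]
  · refine Finset.prod_congr rfl fun l _ => ?_
    rw [evalSym_ι, ← dForm_mfderiv_eq_eulerDeriv contMDiff_id ψ.chart_mem hχ hy hyψ hξ (I l)]
    rw [mfderiv_id]
    rfl

theorem evalSym_pullbackSym {f : Y → X}
    (hf : ContMDiff 𝓘(ℂ, Model n) 𝓘(ℂ, Model p) ω f) {ΔX : OrbifoldDivisor p X}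
    (φ : AdaptedChart ΔX) (hχ : χ ∈ holCharts n Y) {y : Y} (hy : y ∈ χ.source)
    (hfy : f y ∈ φ.chart.source) {i : Fin n} {ξ : TangentSpace 𝓘(ℂ, Model n) y}
    (hξ : mfderiv 𝓘(ℂ, Model n) 𝓘(ℂ, Model n) χ y ξ = (Pi.single i (χ y i) : Model n))
    (J : Fin N → Idx p 1) :
    evalSym ξ (pullbackSym f 1 (generator φ (symOf J)) y) =
      (∏ k, components f φ.chart χ k (χ y) ^
        ((ceilDiv (occFun J k) (φ.m k) : ℤ) - (occFun J k : ℤ))) *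
        ∏ l, eulerDeriv i (components f φ.chart χ (J l).elem) (χ y) := by
  rw [pullbackSym, generator_symOf, map_smul, map_smul, map_prod, map_prod, smul_eq_mul]
  congr 1
  · simp [components, χ.left_inv hy]
  · refine Finset.prod_congr rfl fun l _ => ?_
    rw [SymmetricAlgebra.lift_ι_apply, LinearMap.comp_apply, evalSym_ι,
      ← dForm_mfderiv_eq_eulerDeriv hf φ.chart_mem hχ hy hfy hξ (J l)]
    rfl

end Evaluation

/-! ### The inclusion of symmetric differentials implies the inequalities -/

section Converse

open Filter Asymptotics

variable {n p N : ℕ} {Y X : Type*} [TopologicalSpace Y] [ChartedSpace (Model n) Y]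
  [TopologicalSpace X] [ChartedSpace (Model p) X] [IsManifold 𝓘(ℂ, Model n) ω Y]
  [IsManifold 𝓘(ℂ, Model p) ω X] {f : Y → X} {ΔY : OrbifoldDivisor n Y}
  {ΔX : OrbifoldDivisor p X}

/-- A hyperplane of an adapted chart that coincides with `E` near a regular point is labelled
by `E`. -/
theorem AdaptedChart.m_eq_mult (ψ : AdaptedChart ΔY) {E : PrimeDivisor n Y}
    {χ : OpenPartialHomeomorph Y (Model n)} {k : Fin n} {b : Y}
    (hE : IsStraightenedBy n E.carrier b χ k) (hb : b ∈ ψ.chart.source) {s : Fin n → ℕ}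
    {d : Fin n → Y → ℂ} (hd : ∀ i, ContinuousAt (d i) b) (hdb : ∀ i, d i b ≠ 0)
    (heq : ∀ i, ∀ᶠ z in 𝓝 b, ψ.chart z i = χ z k ^ s i * d i z) {i : Fin n} (hi : ψ.m i ≠ 1)
    (hs : 0 < s i) : ψ.m i = ΔY.mult E := by
  obtain ⟨E', hE', hm, hlt⟩ := ψ.exists_label hi
  rw [hm]
  congr 1
  refine (PrimeDivisor.eq_of_eventually ⟨χ, k, hE⟩ ?_).symm
  filter_upwards [ψ.chart.open_source.eventually_mem hb, χ.open_source.eventually_mem hE.2.1,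
    eventually_all.2 heq, eventually_all.2 fun i => (hd i).eventually_ne (hdb i)]
    with z h1 h2 h3 h4
  rw [hE.2.2.2 z h2, ψ.mem_iff E' hlt z h1]
  constructor
  · intro h0
    exact ⟨i, hE', by rw [h3 i, h0, zero_pow hs.ne', zero_mul]⟩
  · rintro ⟨i', -, h0⟩
    rw [h3 i'] at h0
    exact eq_zero_of_pow_eq_zero ((mul_eq_zero.1 h0).resolve_right (h4 i'))

/-- The inequality of multiplicities, along a component of the zero set of a coordinate. -/
theorem PullbackIncluded.m_le (hinc : PullbackIncluded f ΔY ΔX N 1)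
    (hf : ContMDiff 𝓘(ℂ, Model n) 𝓘(ℂ, Model p) ω f) (hN : 0 < N)
    {E : PrimeDivisor n Y} {χ : OpenPartialHomeomorph Y (Model n)} {i : Fin n} {b : Y}
    (hE : IsStraightenedBy n E.carrier b χ i) (φ : AdaptedChart ΔX)
    (hfb : f b ∈ φ.chart.source) {T : Fin p → ℕ} {c : Fin p → Y → ℂ}
    (hc : ∀ j, HolAt n (c j) b) (hcfr : ∀ j, ∃ᶠ z in 𝓝 b, χ z i = 0 ∧ c j z ≠ 0)
    (hce : ∀ j, φ.m j ≠ 1 → ∀ᶠ z in 𝓝 b, φ.chart (f z) j = χ z i ^ T j * c j z)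
    {j : Fin p} (hj : φ.m j ≠ 1) (hTj : 0 < T j) (hnum : num (φ.m j) ∣ N) :
    φ.m j ≤ (T j : WithTop ℚ≥0) * ΔY.mult E := by
  classical
  have hχ := hE.1
  have hbχ := hE.2.1
  have hbi : χ b i = 0 := (hE.2.2.2 b hbχ).1 hE.2.2.1
  -- The test section is the generator in which only `dx_j` occurs, `N` times.
  set J : Fin N → Idx p 1 := fun _ => ⟨{j}, Finset.card_singleton j⟩ with hJ
  have hJelem : ∀ l, (J l).elem = j := fun l => ((J l).mem_iff j).1 (Finset.mem_singleton_self j)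
  obtain ⟨ψ, hbψ, B, hB, hBe⟩ := hinc φ.chart.source (generator φ (symOf J))
    φ.chart.open_source (isOrbSection_generator φ (symOf J)) b hfb
  choose I hI using fun s : Sym (Idx n 1) N => exists_symOf_eq s
  -- the coordinates of `ψ` in terms of the equation of `E`
  have hfac : ∀ k, ∃ (s : ℕ) (d : Y → ℂ), HolAt n d b ∧
      (∀ᶠ z in 𝓝 b, ψ.chart z k = χ z i ^ s * d z) ∧ ∃ᶠ z in 𝓝 b, χ z i = 0 ∧ d z ≠ 0 :=
    fun k => (holAt_coord ψ.chart_mem hbψ k).exists_eq_coord_pow_mul hχ hbχ hbi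
      (not_eventually_chart_coord_eq_zero hbψ k)
  choose s d hd hde hdfr using hfac
  -- The cofactors `c` and `d` may vanish at `b` itself; a generic point `b'` of `E` near `b` makes
  -- all of them units.
  have hfr := frequently_coord_eq_zero_and_forall_ne (Finset.univ : Finset (Fin n ⊕ Fin p))
    (c := Sum.elim d c) hχ hbχ hbi (by simp [hd, hc]) (by simp [hdfr, hcfr])
  have hce' : ∀ᶠ z in 𝓝 b, ∀ j, φ.m j ≠ 1 → φ.chart (f z) j = χ z i ^ T j * c j z :=
    eventually_all.2 fun j => by
      by_cases h : φ.m j = 1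
      · simp [h]
      · simpa [h] using hce j h
  obtain ⟨b', ⟨hb'i, hb'ne⟩, hb'χ, hb'ψ, hb'φ, hb'c, hb'd, hb'B, hb'ce, hb'de, hb'Be⟩ :=
    (hfr.and_eventually ((χ.open_source.eventually_mem hbχ).and
      ((ψ.chart.open_source.eventually_mem hbψ).and
      ((hf.continuous.continuousAt.eventually (φ.chart.open_source.eventually_mem hfb)).and
      ((eventually_all.2 fun j => (hc j).eventually).and
      ((eventually_all.2 fun k => (hd k).eventually).and
      ((eventually_all.2 fun s => (hB s).eventually).and
      (hce'.eventually_nhds.and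
      ((eventually_all.2 hde).eventually_nhds.and hBe.eventually_nhds))))))))).exists
  have hc0 : ∀ j, c j b' ≠ 0 := fun j => hb'ne (Sum.inr j) (Finset.mem_univ _)
  have hd0 : ∀ k, d k b' ≠ 0 := fun k => hb'ne (Sum.inl k) (Finset.mem_univ _)
  have hE' : IsStraightenedBy n E.carrier b' χ i :=
    ⟨hχ, hb'χ, (hE.2.2.2 b' hb'χ).2 hb'i, hE.2.2.2⟩
  have hsrcX := hf.continuous.continuousAt.eventually
    (φ.chart.open_source.eventually_mem hb'φ)
  -- both sides evaluated at the Euler field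
  have hid : ∀ᶠ w in 𝓝 (χ b'), w i ≠ 0 →
      (∏ k, components f φ.chart χ k w ^
        ((ceilDiv (occFun J k) (φ.m k) : ℤ) - (occFun J k : ℤ))) *
        ∏ l, eulerDeriv i (components f φ.chart χ (J l).elem) w =
      ∑ s, (B s ∘ χ.symm) w * ((∏ k, components id ψ.chart χ k w ^
        ((ceilDiv (occFun (I s) k) (ψ.m k) : ℤ) - (occFun (I s) k : ℤ))) *
        ∏ l, eulerDeriv i (components id ψ.chart χ (I s l).elem) w) := by
    rw [← eventually_comp_chart_iff hb'χ]
    filter_upwards [χ.open_source.eventually_mem hb'χ, ψ.chart.open_source.eventually_mem hb'ψ,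
      hsrcX, hb'ce, hb'de, hb'Be,
      eventually_all.2 fun j => (hb'c j).continuousAt.eventually_ne (hc0 j),
      eventually_all.2 fun k => (hb'd k).continuousAt.eventually_ne (hd0 k)]
      with z h1 h2 h3 h4 h5 h6 h7 h8 hz
    have hzZ : z ∉ ΔY.support ∪ f ⁻¹' ΔX.support := by
      rintro (hzs | hzs)
      · obtain ⟨E', hE', hzE'⟩ := Set.mem_iUnion₂.1 hzs
        obtain ⟨k, -, h0⟩ := (ψ.mem_iff E' hE' z h2).1 hzE'
        rw [h5 k] at h0
        exact mul_ne_zero (pow_ne_zero _ hz) (h8 k) h0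
      · obtain ⟨D', hD', hzD'⟩ := Set.mem_iUnion₂.1 hzs
        obtain ⟨k, hk, h0⟩ := (φ.mem_iff D' hD' (f z) h3).1 hzD'
        have hm : φ.m k ≠ 1 := by
          rw [AdaptedChart.m, hk]
          exact ne_of_gt hD'
        rw [h4 k hm] at h0
        exact mul_ne_zero (pow_ne_zero _ hz) (h7 k) h0
    obtain ⟨ξ, hξ⟩ := exists_euler_vector hχ h1 (Pi.single i (χ z i))
    rw [← evalSym_pullbackSym hf φ hχ h1 h3 hξ J, h6 hzZ, map_sum]
    refine Finset.sum_congr rfl fun s _ => ?_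
    rw [map_smul, smul_eq_mul, ← evalSym_generator ψ hχ h1 h2 hξ (I s), hI s,
      Function.comp_apply, χ.left_inv h1]
  have hocc : ∀ k, occFun J k = if k = j then N else 0 := fun k => by
    simp only [occFun, Idx.mem_iff, hJelem]
    by_cases h : k = j
    · simp [h]
    · simp [h, Ne.symm h]
  have hlhs : ∀ w, (∏ k, components f φ.chart χ k w ^
        ((ceilDiv (occFun J k) (φ.m k) : ℤ) - (occFun J k : ℤ))) *
        ∏ l, eulerDeriv i (components f φ.chart χ (J l).elem) w =
      components f φ.chart χ j w ^ ((ceilDiv N (φ.m j) : ℤ) - (N : ℤ)) *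
        eulerDeriv i (components f φ.chart χ j) w ^ N := by
    intro w
    simp only [hJelem, Finset.prod_const, Finset.card_univ, Fintype.card_fin]
    congr 1
    rw [Finset.prod_eq_single j]
    · simp [hocc]
    · intro k _ hk
      have h0 : ceilDiv 0 (φ.m k) = 0 := Nat.le_zero.1 (ceilDiv_le (φ.one_le_m k) 0)
      simp [hocc, hk, h0]
    · simp
  have hwi : χ b' i = 0 := hb'i
  have hlow := (isBigO_zpow_mul_eulerDeriv_pow (i := i) (b := χ b')
    (X := components f φ.chart χ j) (c := c j ∘ χ.symm) hwi hTj ((hb'c j).analyticAt hχ hb'χ)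
    (by simpa [χ.left_inv hb'χ] using hc0 j) (by
      rw [← eventually_comp_chart_iff hb'χ]
      filter_upwards [hb'ce, χ.open_source.eventually_mem hb'χ] with z h1 h2
      simp [components, χ.left_inv h2, h1 j hj]) (ceilDiv N (φ.m j)) N).1
  have hup : ∀ s, _ := fun s => isBigO_prod_factor (i := i) (b := χ b') (N := N)
    (X := components id ψ.chart χ) (m := ψ.m) hwi
    (analyticAt_components contMDiff_id ψ.chart_mem hχ hb'χ hb'ψ) (ΔY.one_le_mult E)
    (fun k => by
      by_cases hk : ψ.m k = 1
      · exact Or.inl hk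
      · refine Or.inr ⟨_, d k ∘ χ.symm, (hb'd k).analyticAt hχ hb'χ,
          by simpa [χ.left_inv hb'χ] using hd0 k, ?_,
          ψ.m_eq_mult hE' hb'ψ (fun k => (hb'd k).continuousAt) hd0
            (fun k => hb'de.mono fun z hz => hz k) hk⟩
        rw [← eventually_comp_chart_iff hb'χ]
        filter_upwards [hb'de, χ.open_source.eventually_mem hb'χ] with z h1 h2
        simp [components, χ.left_inv h2, h1 k]) (I s)
  have hsum := IsBigO.fun_sum (s := Finset.univ) fun s _ =>
    ((((hb'B s).analyticAt hχ hb'χ).continuousAt.isBigO_one ℂ).mono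
      (nhdsWithin_le_nhds (s := {w : Model n | w i ≠ 0}))).mul (hup s)
  simp only [one_mul] at hsum
  refine le_mul_of_ceilDiv_le (φ.one_le_m j) (ΔY.one_le_mult E) hN hTj hnum
    (le_of_isBigO_coord_pow (i := i) (b := χ b') hwi (hlow.trans (hsum.congr' ?_ EventuallyEq.rfl)))
  filter_upwards [self_mem_nhdsWithin, hid.filter_mono nhdsWithin_le_nhds] with w h1 h2
  rw [← h2 h1, hlhs]

/-- Several branches `x_j = 0` of `D` may pass through `f b`. It is enough to find one whose order
`T j` along `E` is positive: then `m(D) ≤ T j * m(E)`, and `T j ≤ t`. -/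
theorem PullbackIncluded.isOrbifoldMorphism (hinc : PullbackIncluded f ΔY ΔX N 1)
    (hf : ContMDiff 𝓘(ℂ, Model n) 𝓘(ℂ, Model p) ω f) (hX : ΔX.IsSmooth)
    (hns : NotIntoSupport f ΔX) (hN : ΔX.IsLcmOfNumerators N) : IsOrbifoldMorphism f ΔY ΔX := by
  classical
  refine ⟨hns, fun D E t ht ⟨b, χ, i, h, g, hE, hloc, hg, heq, hgfr⟩ => ?_⟩
  have ht1 : (1 : WithTop ℚ≥0) ≤ t := by exact_mod_cast ht
  by_cases hD : ΔX.mult D = 1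
  · rw [hD]
    exact one_le_mul ht1 (ΔY.one_le_mult E)
  have hlt : 1 < ΔX.mult D := lt_of_le_of_ne (ΔX.one_le_mult D) (Ne.symm hD)
  have hχ := hE.1
  have hbχ := hE.2.1
  have hbi : χ b i = 0 := (hE.2.2.2 b hbχ).1 hE.2.2.1
  have hsrc := χ.open_source.eventually_mem hbχ
  obtain ⟨φ, hfb⟩ := hX (f b)
  have hhol : ∀ j, HolAt n (fun z => φ.chart (f z) j) b := fun j =>
    ContMDiffAt.comp b (holAt_coord φ.chart_mem hfb j) hf.contMDiffAt
  have hfac : ∀ j, ∃ (T : ℕ) (c : Y → ℂ), HolAt n c b ∧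
      (∃ᶠ z in 𝓝 b, χ z i = 0 ∧ c z ≠ 0) ∧
      (φ.m j ≠ 1 → ∀ᶠ z in 𝓝 b, φ.chart (f z) j = χ z i ^ T * c z) := by
    intro j
    by_cases hj : φ.m j = 1
    · exact ⟨0, fun _ => 1, holAt_const _, fun hev => hev.self_of_nhds ⟨hbi, one_ne_zero⟩,
        fun h => absurd hj h⟩
    · obtain ⟨T, c, hc, hce, hfr⟩ := (hhol j).exists_eq_coord_pow_mul hχ hbχ hbi
        (hns.not_eventually_coord_eq_zero hf φ hj hfb)
      exact ⟨T, c, hc, hfr, fun _ => hce⟩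
  choose T c hc hcfr hce using hfac
  have hlab : ∀ j, φ.label j = some D → φ.m j = ΔX.mult D := fun j hj => by
    rw [AdaptedChart.m, hj]
  -- one of the coordinates vanishes on `E`
  obtain ⟨j, hj, hTj⟩ : ∃ j, φ.label j = some D ∧ 0 < T j := by
    -- Otherwise no coordinate labelled by `D` vanishes at a generic point of `E`. But their product
    -- vanishes on `D`, so it is a multiple of `h`, and `h ∘ f` vanishes on `E` because `t > 0`.
    by_contra! hcon
    have hP : HolAt p (fun x => ∏ j with φ.label j = some D, φ.chart x j) (f b) :=
      holAt_finset_prod _ fun j _ => holAt_coord φ.chart_mem hfb j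
    obtain ⟨u, -, hu⟩ := hloc.2.2 _ hP (by
      filter_upwards [φ.chart.open_source.eventually_mem hfb] with x hx hxD
      obtain ⟨j, hj, h0⟩ := (φ.mem_iff D hlt x hx).1 hxD
      exact Finset.prod_eq_zero (Finset.mem_filter.2 ⟨Finset.mem_univ j, hj⟩) h0)
    have hfr := frequently_coord_eq_zero_and_forall_ne (Finset.univ : Finset (Fin p))
      (c := c) hχ hbχ hbi (fun j _ => hc j) (fun j _ => hcfr j)
    have hce' : ∀ᶠ z in 𝓝 b, ∀ j, φ.label j = some D →
        φ.chart (f z) j = χ z i ^ T j * c j z := eventually_all.2 fun j => by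
      by_cases hj : φ.label j = some D
      · simpa [hj] using hce j (by rw [hlab j hj]; exact hD)
      · simp [hj]
    obtain ⟨z, ⟨hzi, hzc⟩, h1, h2, h3⟩ := (hfr.and_eventually
      (hce'.and (heq.and (hf.continuous.continuousAt.eventually hu)))).exists
    rw [h2, hzi, zero_pow ht.ne', zero_mul, mul_zero] at h3
    obtain ⟨j, hj, h0⟩ := Finset.prod_eq_zero_iff.1 h3
    have hj' := (Finset.mem_filter.1 hj).2
    rw [h1 j hj', Nat.le_zero.1 (hcon j hj'), pow_zero, one_mul] at h0
    exact hzc j (Finset.mem_univ j) h0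
  have hmj : φ.m j ≠ 1 := by rw [hlab j hj]; exact hD
  -- the coordinate divides the equation of `D`
  have hle : T j ≤ t := by
    by_contra! hlt'
    obtain ⟨r, hr, hre⟩ := hloc.1.exists_eq_mul_coord (i := j) φ.chart_mem hfb (by
      filter_upwards [hloc.2.1, φ.chart.open_source.eventually_mem hfb] with x h1 h2 h0
      exact h1 ((φ.mem_iff D hlt x h2).2 ⟨j, hj, h0⟩))
    have hrf : HolAt n (fun z => r (f z)) b := ContMDiffAt.comp b hr hf.contMDiffAt
    -- Writing `h = r x_j` gives two expressions for `h ∘ f`. Cancelling `y_i ^ t` makes `g`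
    -- divisible by `y_i ^ (T j - t)`, so `g` would vanish on `E`.
    have hdiff : HolAt n (fun z => g z + -1 * (r (f z) * (χ z i ^ (T j - t) * c j z))) b :=
      hg.add ((holAt_const _).mul (hrf.mul (((holAt_coord hχ hbχ i).pow _).mul (hc j))))
    have hz := HolAt.eventually_eq_zero_of_mul ((holAt_coord hχ hbχ i).pow t) hdiff
      (fun hev => not_eventually_chart_coord_eq_zero hbχ i
        (hev.mono fun z hz => eq_zero_of_pow_eq_zero hz)) (by
        filter_upwards [heq, hf.continuous.continuousAt.eventually hre, hce j hmj]
          with z h1 h2 h3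
        have h4 : χ z i ^ T j = χ z i ^ t * χ z i ^ (T j - t) := by
          rw [← pow_add, Nat.add_sub_cancel' hlt'.le]
        rw [h2, h3, h4] at h1
        linear_combination -h1)
    obtain ⟨z, ⟨hzE, hgz⟩, h1, h2⟩ := (hgfr.and_eventually (hz.and hsrc)).exists
    rw [(hE.2.2.2 z h2).1 hzE, zero_pow (by lia)] at h1
    simp only [zero_mul, mul_zero, add_zero] at h1
    exact hgz h1
  have hfin := hinc.m_le hf hN.1 hE φ hfb hc hcfr hce hmj hTj
    (by rw [hlab j hj]; exact hN.2.1 D)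
  rw [hlab j hj] at hfin
  exact hfin.trans (mul_le_mul_left (by exact_mod_cast hle) _)

end Converse

end GeomOrbifold

end

open GeomOrbifold in
theorem mainTheorem12 {n p : ℕ} {Y X : Type*}
    [TopologicalSpace Y] [T2Space Y] [SigmaCompactSpace Y]
    [ChartedSpace (Model n) Y] [IsManifold 𝓘(ℂ, Model n) ω Y]
    [TopologicalSpace X] [T2Space X] [SigmaCompactSpace X]
    [ChartedSpace (Model p) X] [IsManifold 𝓘(ℂ, Model p) ω X]
    (ΔY : OrbifoldDivisor n Y) (hY : ΔY.IsSmooth)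
    (ΔX : OrbifoldDivisor p X) (hX : ΔX.IsSmooth)
    (f : Y → X) (hf : ContMDiff 𝓘(ℂ, Model n) 𝓘(ℂ, Model p) ω f) :
    (ΔX.HasSmoothComponents → IsOrbifoldMorphism f ΔY ΔX →
        ∀ N q : ℕ, PullbackIncluded f ΔY ΔX N q) ∧
      (NotIntoSupport f ΔX → ∀ N : ℕ, ΔX.IsLcmOfNumerators N →
        PullbackIncluded f ΔY ΔX N 1 → IsOrbifoldMorphism f ΔY ΔX) :=
  ⟨fun hsm hmor N q => hmor.pullbackIncluded hf hsm hY N q,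
    fun hns _ hN hinc => hinc.isOrbifoldMorphism hf hX hns hN⟩
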